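/- **Setting.** Consider $x_{k+1}=Ax_k+Bu_k+w_k$, $y_k=Cx_k+v_k$ with independent Gaussian noises $w_k\sim N(0,Q)$, $v_k\sim N(0,R)$, $Q\succ0$, $R\succ0$, $(A,B)$ controllable and $(A,C)$ detectable. Let $f(X)=AXA^\top+Q$ and let $\bar P\succeq0$ be the steady-state error covariance of the Kalman filter, i.e. $\bar P=(I-KC)f(\bar P)$ with $K=f(\bar P)C^\top(Cf(\bar P)C^\top+R)^{-1}$. A sensor runs this steady-state filter, with estimate $\hat x^s_k$. At stage $k$ the controller first chooses $\nu_k\in\{0,1\}$ (transmit $\hat x_k^s$ or not) and, simultaneously and independently, an attacker chooses $a_k\in\{0,1\}$. The packet is received ($\gamma_k=1$) with probability $0$ if $\nu_k=0$, $\lambda$ if $(\nu_k,a_k)=(1,0)$, and $\lambda_a$ if $(\nu_k,a_k)=(1,1)$, where $0\le\lambda_a<\lambda\le1$. Then the controller chooses $u_k$. The controller's estimate is $\hat x_k=\hat x^s_k$ if $\gamma_k=1$ and $\hat x_k=\bar x_k$ otherwise, where $\bar x_{k}=A\hat x_{k-1}+Bu_{k-1}$. The holding time is $\tau_k=0$ if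 $\gamma_k=1$ and $\tau_k=\tau_{k-1}+1$ otherwise. The initial holding time is $\tau_{-1}=t_0\in\mathbb N$, and $\bar x_0\sim N(0,\Sigma)$, $\hat x_0^s-\bar x_0\sim N(0,f^{t_0+1}(\bar P)-\bar P)$, $x_0-\hat x_0^s\sim N(0,\bar P)$ are independent of each other and of the noises, $\Sigma\succeq0$. Strategies may be randomized by private seeds and may use the whole past: $\nu_k$ is a function of $\bar x_0,\dots,\bar x_k$ and $(\nu_j,\gamma_j,\gamma_j\hat x^s_j)_{j<k}$; $u_k$ is a function of $(\bar x_j,\nu_j,\gamma_j,\gamma_j\hat x^s_j)_{j\le k}$; $a_k$ is a function of $(\gamma_j)_{j<k}$. In the infinite-horizon zero-sum game $\mathcal G$ the controller minimizes and the attacker maximizes $$J=\lim_{K\to\infty}\sum_{k=0}^{K}\eta^k\,\mathbb E\big(x_k^\top Wx_k+u_k^\top Uu_k+c_s\nu_k-c_aa_k\big)\in(-\infty,\infty],$$ where $0<\eta<1$, $W\succeq0$, $U\succ0$, $c_s,c_a\ge0$. Write $\sigma_i(A)$ for the eigenvalues of $A$. **Claim.** Suppose $\lambda_a>1-\eta/\max_i|\sigma_i(A)|^2$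 (with $\eta/0=\infty$). Then the Riccati recursion $S\mapsto \eta A^\top SA+W-\eta^2A^\top SB(\eta B^\top SB+U)^{-1}B^\top SA$ started at $W$ converges to a matrix $S_\infty\succeq0$ with $$S_\infty=\eta A^\top S_\infty A+W-\eta^2A^\top S_\infty B(\eta B^\top S_\infty B+U)^{-1}B^\top S_\infty A,$$ and, with the control law $$u_k^\star=-\eta(\eta B^\top S_\infty B+U)^{-1}B^\top S_\infty A\,\hat x_k ,$$ the following hold. 1. $\mathcal G$ has a Nash equilibrium: there are $p,q:\mathbb N\to[0,1]$, independent of $t_0$ and $\Sigma$, such that the controller's strategy "$\nu_k=1$ with probability $p(\tau_{k-1})$, $u_k=u_k^\star$" and the attacker's strategy "$a_k=1$ with probability $q(\tau_{k-1})$" form a Nash equilibrium. 2. For all scheduling and attack strategies $\rho,\sigma$ (choosing $\nu_k$, respectively $a_k$, from $\gamma_0,\dots,\gamma_{k-1}$ and private randomization), $u^\star$ minimizes $J$ among all control policies used together with $\rho$ against $\sigma$. 3. Consider the min-max problem over such scheduling and attack strategies $$\min_{\{\nu_k\}}\max_{\{a_k\}}\ \lim_{K\to\infty}\sum_{k=0}^{K}\eta^k\,\mathbb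 E\Big(\operatorname{tr}\big((\eta A^\top S_\infty A+W-S_\infty)f^{\tau_k}(\bar P)\big)+c_s\nu_k-c_aa_k\Big).$$ Call $(\rho,\sigma)$ a solution if $\min\max=\max\min$, $\rho$ attains the $\min\max$ and $\sigma$ attains the $\max\min$. The strategies given by $p,q$ in 1 are a solution; and $(\rho,\sigma)$ is a solution if and only if $(\rho,u^\star)$ and $\sigma$ form a Nash equilibrium of $\mathcal G$. -/

import Mathlib

open MeasureTheory ProbabilityTheory Matrix Filter Topology

noncomputable section

/-! ### Data of the networked control system -/

/-- Vectors in `ℝⁿ`. -/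
abbrev Vec (n : ℕ) := Fin n → ℝ

/-- The plant `x_{k+1} = A x_k + B u_k + w_k`, `y_k = C x_k + v_k`, the noise covariances
`Q` of `w_k` and `R` of `v_k`, the weights `W`, `U`, the discount factor `eta`, the probabilities of
a successful transmission without (`lam`) and with (`lamA`) an attack, and the costs of a
transmission (`cs`) and of an attack (`ca`). -/
structure GameData (nx nu ny : ℕ) where
  A : Matrix (Fin nx) (Fin nx) ℝ
  B : Matrix (Fin nx) (Fin nu) ℝ
  C : Matrix (Fin ny) (Fin nx) ℝ
  Q : Matrix (Fin nx) (Fin nx) ℝ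
  R : Matrix (Fin ny) (Fin ny) ℝ
  W : Matrix (Fin nx) (Fin nx) ℝ
  U : Matrix (Fin nu) (Fin nu) ℝ
  eta : ℝ
  lam : ℝ
  lamA : ℝ
  cs : ℝ
  ca : ℝ

/-- `(A, B)` is controllable: `[B, AB, …, A^{n-1}B]` has full row rank. -/
def IsControllable {nx nu : ℕ} (A : Matrix (Fin nx) (Fin nx) ℝ)
    (B : Matrix (Fin nx) (Fin nu) ℝ) : Prop :=
  (Matrix.of fun (i : Fin nx) (p : Fin nx × Fin nu) => (A ^ (p.1 : ℕ) * B) i p.2).rank = nx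

/-- `(A, C)` is detectable: some output injection makes all eigenvalues of `A - L C` lie in the
open unit disc. -/
def IsDetectable {nx ny : ℕ} (A : Matrix (Fin nx) (Fin nx) ℝ)
    (C : Matrix (Fin ny) (Fin nx) ℝ) : Prop :=
  ∃ L : Matrix (Fin nx) (Fin ny) ℝ,
    ∀ z ∈ spectrum ℂ ((A - L * C).map (algebraMap ℝ ℂ)), ‖z‖ < 1

namespace GameData

variable {nx nu ny : ℕ} (D : GameData nx nu ny)

/-- One open-loop step of the error covariance, `f(X) = A X Aᵀ + Q`. -/
def f (X : Matrix (Fin nx) (Fin nx) ℝ) : Matrix (Fin nx) (Fin nx) ℝ :=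
  D.A * X * D.Aᵀ + D.Q

/-- The Kalman gain belonging to the posterior error covariance `P` of the previous step. -/
def kalmanGain (P : Matrix (Fin nx) (Fin nx) ℝ) : Matrix (Fin nx) (Fin ny) ℝ :=
  D.f P * D.Cᵀ * (D.C * D.f P * D.Cᵀ + D.R)⁻¹

/-- `P` is the steady-state error covariance of the sensor's Kalman filter. -/
def IsSteadyState (P : Matrix (Fin nx) (Fin nx) ℝ) : Prop :=
  P.PosSemidef ∧ P = (1 - D.kalmanGain P * D.C) * D.f P

/-- The discounted Riccati operator. -/
def riccati (S : Matrix (Fin nx) (Fin nx) ℝ) : Matrix (Fin nx) (Fin nx) ℝ :=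
  D.eta • (D.Aᵀ * S * D.A) + D.W
    - D.eta ^ 2 •
      (D.Aᵀ * S * D.B * (D.eta • (D.Bᵀ * S * D.B) + D.U)⁻¹ * D.Bᵀ * S * D.A)

/-- The feedback gain `-η (η Bᵀ S B + U)⁻¹ Bᵀ S A`. -/
def gain (S : Matrix (Fin nx) (Fin nx) ℝ) : Matrix (Fin nu) (Fin nx) ℝ :=
  -(D.eta • ((D.eta • (D.Bᵀ * S * D.B) + D.U)⁻¹ * D.Bᵀ * S * D.A))

end GameData

/-! ### The link: acknowledgements, holding times, randomized decisions

A player's decision at stage `k` may use a private random seed drawn uniformly from `[0,1]` at every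
stage; this models randomized (behavioural or mixed) strategies. -/

/-- The holding time after `k` stages, as a function of the acknowledgements `γ₀, …, γ_{k-1}`, when
the holding time before stage `0` is `t₀`. Thus `holding t₀ k` is `τ_{k-1}`. -/
def holding (t₀ : ℕ) : (k : ℕ) → (Fin k → Bool) → ℕ
  | 0, _ => t₀
  | k + 1, h => if h (Fin.last k) then 0 else holding t₀ k (Fin.init h) + 1

/-- A strategy producing a binary decision at every stage `k` from the acknowledgements
`γ₀, …, γ_{k-1}` and the player's own seeds up to stage `k`. These are all the strategies of the
attacker, and the strategies of both players in the complete information game. -/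
structure LinkStrategy where
  play : (k : ℕ) → (Fin k → Bool) → (Fin (k + 1) → unitInterval) → Bool
  measurable_play : ∀ k, Measurable fun z : (Fin k → Bool) × (Fin (k + 1) → unitInterval) =>
    play k z.1 z.2

/-- The stationary strategy which, at every stage, chooses `1` with probability `p τ` when the
current holding time is `τ`, by a fresh randomization. -/
def stationary (t₀ : ℕ) (p : ℕ → unitInterval) : LinkStrategy where
  play k h s := decide (s (Fin.last k) < p (holding t₀ k h))
  measurable_play k := by
    refine measurable_to_bool ?_
    have hp : Measurable fun z : (Fin k → Bool) × (Fin (k + 1) → unitInterval) =>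
        p (holding t₀ k z.1) :=
      (measurable_of_countable fun h : Fin k → Bool => p (holding t₀ k h)).comp measurable_fst
    have hs : Measurable fun z : (Fin k → Bool) × (Fin (k + 1) → unitInterval) =>
        z.2 (Fin.last k) := (measurable_pi_apply _).comp measurable_snd
    have := measurableSet_lt hs hp
    convert this using 1
    ext z
    simp

/-- Link noise of a stage: the seed of the channel, of the controller, of the attacker. -/
abbrev LinkNoise := unitInterval × unitInterval × unitInterval

/-- All the seeds are independent and uniform on `[0,1]`. -/
def linkLaw : Measure (ℕ → LinkNoise) :=
  Measure.infinitePi fun _ => (volume : Measure LinkNoise)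

/-- The controller's seeds up to stage `k`. -/
def ctrlSeeds (ω : ℕ → LinkNoise) (k : ℕ) : Fin (k + 1) → unitInterval := fun i => (ω i).2.1

/-- The attacker's seeds up to stage `k`. -/
def attSeeds (ω : ℕ → LinkNoise) (k : ℕ) : Fin (k + 1) → unitInterval := fun i => (ω i).2.2

/-- The reception indicator `γ`: nothing is received without a transmission (`ν = 0`), and a
transmitted packet arrives with probability `lam`, or `lamA` under attack (`a = 1`). -/
def received {nx nu ny : ℕ} (D : GameData nx nu ny) (c : unitInterval) (ν a : Bool) : Bool :=
  ν && decide ((c : ℝ) < if a then D.lamA else D.lam)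

/-! ### The partially observable game -/

/-- What the controller has observed of a completed stage `j`: `(x̄_j, ν_j, γ_j, γ_j x̂ˢ_j)`. -/
abbrev CtrlObs (nx : ℕ) := Vec nx × Bool × Bool × Vec nx

/-- Scheduling part of the controller: `ν_k` is a measurable function of the
observations of the stages before `k`, of `x̄_k`, and of the controller's seeds. -/
structure SchedulingPolicy (nx : ℕ) where
  sched : (k : ℕ) → (Fin k → CtrlObs nx) → Vec nx → (Fin (k + 1) → unitInterval) → Bool
  measurable_sched : ∀ k, Measurable
    fun z : (Fin k → CtrlObs nx) × Vec nx × (Fin (k + 1) → unitInterval) => sched k z.1 z.2.1 z.2.2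

/-- Control part of the controller: `u_k` is a measurable function of the observations of the
stages up to and including `k` (so after the possible reception at stage `k`), and of the
controller's seeds. -/
structure ControlPolicy (nx nu : ℕ) where
  control : (k : ℕ) → (Fin (k + 1) → CtrlObs nx) → (Fin (k + 1) → unitInterval) → Vec nu
  measurable_control : ∀ k, Measurable
    fun z : (Fin (k + 1) → CtrlObs nx) × (Fin (k + 1) → unitInterval) => control k z.1 z.2

/-- A strategy of the controller chooses the schedule and the control input jointly. -/
abbrev ControllerStrategy (nx nu : ℕ) := SchedulingPolicy nx × ControlPolicy nx nu

/-- The controller's estimate `x̂_k`: the received `x̂ˢ_k` if `γ_k = 1`, and `x̄_k` otherwise. -/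
def estimate {nx : ℕ} (o : CtrlObs nx) : Vec nx := if o.2.2.1 then o.2.2.2 else o.1

/-- The acknowledgements contained in the controller's observations. -/
def acks {nx k : ℕ} (obs : Fin k → CtrlObs nx) : Fin k → Bool := fun i => (obs i).2.2.1

/-- The scheduling policy that uses only the acknowledgements, as `ρ` does. -/
def ackSchedule (nx : ℕ) (ρ : LinkStrategy) : SchedulingPolicy nx where
  sched k obs _ s := ρ.play k (acks obs) s
  measurable_sched k := by
    have h : Measurable fun z : (Fin k → CtrlObs nx) × Vec nx × (Fin (k + 1) → unitInterval) =>
        (acks z.1, z.2.2) := by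
      unfold acks
      fun_prop
    exact (ρ.measurable_play k).comp h

/-- The linear feedback `u_k = L x̂_k`. -/
def linearControl {nx nu : ℕ} (L : Matrix (Fin nu) (Fin nx) ℝ) : ControlPolicy nx nu where
  control k obs _ := L *ᵥ estimate (obs (Fin.last k))
  measurable_control k := by
    have h : Measurable (estimate : CtrlObs nx → Vec nx) := by
      unfold estimate
      refine Measurable.ite ?_ (by fun_prop) (by fun_prop)
      exact (measurable_fst.comp (measurable_snd.comp measurable_snd)) (measurableSet_singleton true)
    have hL : Measurable fun v : Vec nx => L *ᵥ v :=
      (Continuous.matrix_mulVec continuous_const continuous_id).measurable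
    exact hL.comp (h.comp ((measurable_pi_apply _).comp measurable_fst))

/-- The centred Gaussian law on `ℝⁿ` with (positive semidefinite) covariance matrix `M`. -/
def gaussianVec {n : ℕ} (M : Matrix (Fin n) (Fin n) ℝ) : Measure (Vec n) :=
  (multivariateGaussian 0 M).map WithLp.ofLp

instance {n : ℕ} (M : Matrix (Fin n) (Fin n) ℝ) : IsProbabilityMeasure (gaussianVec M) :=
  Measure.isProbabilityMeasure_map (by fun_prop)

/-- Initial randomness: the controller's prediction `x̄₀`, the sensor's correction `x̂ˢ₀ - x̄₀`, and
the sensor's estimation error `x₀ - x̂ˢ₀`. -/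
abbrev InitNoise (nx : ℕ) := Vec nx × Vec nx × Vec nx

/-- The sample space: initial randomness, plant noises `(w_k, v_k)`, and link noise. -/
abbrev Sample (nx ny : ℕ) := InitNoise nx × (ℕ → Vec nx × Vec ny) × (ℕ → LinkNoise)

/-- The probability measure of the game whose holding time before stage `0` is `t₀`. All primitive
random variables are independent; `x̄₀ ∼ N(0, Sig)`, `x₀ - x̄₀ ∼ N(0, f^{t₀+1}(P))`, and the sensor's
filter is in steady state, `x₀ - x̂ˢ₀ ∼ N(0, P)`; `w_k ∼ N(0, Q)` and `v_k ∼ N(0, R)`. -/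
def gameLaw {nx nu ny : ℕ} (D : GameData nx nu ny) (P Sig : Matrix (Fin nx) (Fin nx) ℝ) (t₀ : ℕ) :
    Measure (Sample nx ny) :=
  ((gaussianVec Sig).prod ((gaussianVec (D.f^[t₀ + 1] P - P)).prod (gaussianVec P))).prod
    ((Measure.infinitePi fun _ => (gaussianVec D.Q).prod (gaussianVec D.R)).prod linkLaw)

/-- The situation at the start of stage `k`: the state `x_k`, the sensor's estimate `x̂ˢ_k`, the
controller's prediction `x̄_k`, and the controller's observations of the previous stages. -/
structure Situation (nx k : ℕ) where
  x : Vec nx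
  xs : Vec nx
  xbar : Vec nx
  obs : Fin k → CtrlObs nx

section Dynamics

variable {nx nu ny : ℕ} (D : GameData nx nu ny) (P : Matrix (Fin nx) (Fin nx) ℝ)
  (π : ControllerStrategy nx nu) (σ : LinkStrategy) (ω : Sample nx ny)

/-- The transmission command `ν_k` in the situation `s`. -/
def commandAt {k : ℕ} (s : Situation nx k) : Bool :=
  π.1.sched k s.obs s.xbar (ctrlSeeds ω.2.2 k)

/-- The attack `a_k` in the situation `s`. -/
def attackAt {k : ℕ} (s : Situation nx k) : Bool :=
  σ.play k (acks s.obs) (attSeeds ω.2.2 k)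

/-- The controller's observation of stage `k`. -/
def observationAt {k : ℕ} (s : Situation nx k) : CtrlObs nx :=
  let ν := commandAt π ω s
  let γ := received D (ω.2.2 k).1 ν (attackAt σ ω s)
  (s.xbar, ν, γ, if γ then s.xs else 0)

/-- The control input `u_k` in the situation `s`. -/
def inputAt {k : ℕ} (s : Situation nx k) : Vec nu :=
  π.2.control k (Fin.snoc s.obs (observationAt D π σ ω s)) (ctrlSeeds ω.2.2 k)

/-- The evolution of the system, of the sensor's steady-state Kalman filter and of the controller's
prediction when the controller plays `π` and the attacker plays `σ`. -/
def situation : (k : ℕ) → Situation nx k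
  | 0 =>
    { x := ω.1.1 + ω.1.2.1 + ω.1.2.2
      xs := ω.1.1 + ω.1.2.1
      xbar := ω.1.1
      obs := Fin.elim0 }
  | k + 1 =>
    let s := situation k
    let o := observationAt D π σ ω s
    let u := inputAt D π σ ω s
    let x' := D.A *ᵥ s.x + D.B *ᵥ u + (ω.2.1 k).1
    let y' := D.C *ᵥ x' + (ω.2.1 (k + 1)).2
    let pred := D.A *ᵥ s.xs + D.B *ᵥ u
    { x := x'
      xs := pred + D.kalmanGain P *ᵥ (y' - D.C *ᵥ pred)
      xbar := D.A *ᵥ estimate o + D.B *ᵥ u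
      obs := Fin.snoc s.obs o }

/-- `x_kᵀ W x_k + u_kᵀ U u_k`. -/
def quadraticCost (k : ℕ) : ℝ :=
  let s := situation D P π σ ω k
  let u := inputAt D π σ ω s
  s.x ⬝ᵥ (D.W *ᵥ s.x) + u ⬝ᵥ (D.U *ᵥ u)

end Dynamics

section Payoff

variable {nx nu ny : ℕ} (D : GameData nx nu ny) (P : Matrix (Fin nx) (Fin nx) ℝ)

/-- The expected cost of stage `k`,
`𝔼 (x_kᵀ W x_k + u_kᵀ U u_k + c_s ν_k - c_a a_k)`. It is `⊤` if the (nonnegative) quadratic cost is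
not integrable. -/
def expectedCost (Sig : Matrix (Fin nx) (Fin nx) ℝ) (t₀ : ℕ)
    (π : ControllerStrategy nx nu) (σ : LinkStrategy) (k : ℕ) : EReal :=
  ((∫⁻ ω, ENNReal.ofReal (quadraticCost D P π σ ω k) ∂(gameLaw D P Sig t₀) : ENNReal) : EReal)
    + ((D.cs * (gameLaw D P Sig t₀).real {ω | commandAt π ω (situation D P π σ ω k) = true}
      - D.ca * (gameLaw D P Sig t₀).real {ω | attackAt σ ω (situation D P π σ ω k) = true} : ℝ) :
        EReal)

/-- The infinite horizon cost `J = lim_K ∑_{k ≤ K} η^k 𝔼 c_k`, minimized by the controller and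
maximized by the attacker. (The limit exists in `(-∞, ∞]`: the series is a series of nonnegative
terms plus an absolutely convergent one.) -/
def gameCost (Sig : Matrix (Fin nx) (Fin nx) ℝ) (t₀ : ℕ)
    (π : ControllerStrategy nx nu) (σ : LinkStrategy) : EReal :=
  limsup (fun K : ℕ => ∑ k ∈ Finset.range (K + 1),
    ((D.eta ^ k : ℝ) : EReal) * expectedCost D P Sig t₀ π σ k) atTop

/-- Acknowledgements of the stages before `k` in the complete information game, when `ρ` schedules
and `σ` attacks. -/
def linkAcks (ρ σ : LinkStrategy) (ω : ℕ → LinkNoise) : (k : ℕ) → (Fin k → Bool)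
  | 0 => Fin.elim0
  | k + 1 =>
    let h := linkAcks ρ σ ω k
    Fin.snoc h
      (received D (ω k).1 (ρ.play k h (ctrlSeeds ω k)) (σ.play k h (attSeeds ω k)))

/-- The expected cost of stage `k` in the complete information game,
`𝔼 (tr ((η Aᵀ S A + W - S) f^{τ_k}(P)) + c_s ν_k - c_a a_k)`. -/
def expectedReducedCost (S : Matrix (Fin nx) (Fin nx) ℝ) (t₀ : ℕ) (ρ σ : LinkStrategy) (k : ℕ) :
    EReal :=
  ((∫⁻ ω, ENNReal.ofReal (((D.eta • (D.Aᵀ * S * D.A) + D.W - S)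
      * D.f^[holding t₀ (k + 1) (linkAcks D ρ σ ω (k + 1))] P).trace) ∂linkLaw : ENNReal) : EReal)
    + ((D.cs * linkLaw.real {ω | ρ.play k (linkAcks D ρ σ ω k) (ctrlSeeds ω k) = true}
      - D.ca * linkLaw.real {ω | σ.play k (linkAcks D ρ σ ω k) (attSeeds ω k) = true} : ℝ) : EReal)

/-- The infinite horizon cost of the complete information game. -/
def reducedCost (S : Matrix (Fin nx) (Fin nx) ℝ) (t₀ : ℕ) (ρ σ : LinkStrategy) : EReal :=
  limsup (fun K : ℕ => ∑ k ∈ Finset.range (K + 1),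
    ((D.eta ^ k : ℝ) : EReal) * expectedReducedCost D P S t₀ ρ σ k) atTop

end Payoff

/-- `(a, b)` is a Nash equilibrium of the zero-sum game in which the first player minimizes `J` and
the second player maximizes it. -/
def IsNashEquilibrium {X Y : Type*} (J : X → Y → EReal) (a : X) (b : Y) : Prop :=
  (∀ x, J a b ≤ J x b) ∧ (∀ y, J a y ≤ J a b)

/-- `(a, b)` solves the problem `min_x max_y J x y`: the minimum and the maximum may be exchanged,
`a` attains the `min max`, and `b` attains the `max min`. -/
def SolvesMinMax {X Y : Type*} (J : X → Y → EReal) (a : X) (b : Y) : Prop :=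
  (⨅ x, ⨆ y, J x y) = (⨆ y, ⨅ x, J x y) ∧
  (⨆ y, J a y) = (⨅ x, ⨆ y, J x y) ∧
  (⨅ x, J x b) = (⨆ y, ⨅ x, J x y)

end

/-! The argument separates control from communication and then solves a discounted stochastic game
whose state is the holding time.

Separation. `riccati T` gives the minimum over u of the one-step cost with cost-to-go T, and
`completion_of_squares` expresses the excess of an arbitrary u as a quadratic form in u - `gain T`
x. The controller only has an estimate of x. In steady state the correction made by the sensor's
filter and its next error are independent (`IsSteadyState.map_filterMap`). Hence, given the
controller's information and all the link seeds, the estimation error is N(0, f^τ(P)) whatever the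
strategies are (`lintegral_information_estimationError`). Mixed terms vanish, and the excess splits
into a deviation from the feedback law and a trace that depends on τ only (`expectedQuadratic_add`).
Summation with the cost-to-go matrices of a finite horizon, followed by Fatou's lemma, bounds the
cost of every policy from below; summation with the limit S shows that the feedback law attains the
bound. Up to a finite constant, what remains is `trackingGameCost`.

Link game. A stage that ends with holding time τ costs g τ = tr (`errorWeight S` f^τ(P)). At each
holding time the one-stage payoff is bilinear in the mixed decisions and has a saddle point. Value
iteration from 0 increases and stays below the cost of transmitting always under a permanent attack.
The spectral condition makes this cost finite: g grows at most like r^k for some r above all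
|σ_i(A)|² with η (1 - λ_a) r < 1. The limit V solves the Shapley equation
(`exists_holdingGame_value`), and its saddle points define the stationary strategies. They guarantee
V against all strategies (`linkCost_stationary_le`, `le_linkCost_stationary`); for the attacker this
uses V ≤ C (1 + g), which makes the discounted expectation of V vanish as soon as the cost is
finite.

Comparison. A schedule in the original game may depend on the plant. With the plant data frozen, the
acknowledgements and the controller's seeds determine it, so that it is a schedule of the link game
(`informedSchedule_play`), and its cost is an average of link costs. Information on the plant thus
brings no gain, and the saddle points of the two games correspond
(`isNashEquilibrium_gameCost_iff`). Saddle points are the same as solutions of the min-max problem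
(`solvesMinMax_iff`).

All costs are shifted by ca / (1 - η), so that their terms are nonnegative and can be integrated and
summed without integrability conditions. -/

section LinearAlgebra

/-! ### Quadratic forms and positive semidefinite matrices -/

variable {m n : ℕ}

theorem dotProduct_mulVec_transpose (M : Matrix (Fin m) (Fin n) ℝ) (x : Vec m) (y : Vec n) :
    x ⬝ᵥ (M *ᵥ y) = (Mᵀ *ᵥ x) ⬝ᵥ y := by
  rw [dotProduct_mulVec, mulVec_transpose]

theorem dotProduct_mulVec_symm {T : Matrix (Fin n) (Fin n) ℝ} (hT : Tᵀ = T) (x y : Vec n) :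
    x ⬝ᵥ (T *ᵥ y) = y ⬝ᵥ (T *ᵥ x) := by
  rw [dotProduct_mulVec_transpose, hT, dotProduct_comm]

theorem Matrix.PosSemidef.transpose_eq {T : Matrix (Fin n) (Fin n) ℝ} (hT : T.PosSemidef) :
    Tᵀ = T := by
  simpa using hT.isHermitian.eq

theorem Matrix.PosSemidef.quadForm_nonneg {T : Matrix (Fin n) (Fin n) ℝ} (hT : T.PosSemidef)
    (x : Vec n) : 0 ≤ x ⬝ᵥ (T *ᵥ x) := by
  simpa using hT.dotProduct_mulVec_nonneg x

theorem posSemidef_of_quadForm_nonneg {T : Matrix (Fin n) (Fin n) ℝ} (h : Tᵀ = T)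
    (h' : ∀ x : Vec n, 0 ≤ x ⬝ᵥ (T *ᵥ x)) : T.PosSemidef :=
  .of_dotProduct_mulVec_nonneg (by simpa [IsHermitian] using h) (by simpa using h')

theorem Matrix.PosSemidef.congr_transpose {T : Matrix (Fin n) (Fin n) ℝ} (hT : T.PosSemidef)
    (M : Matrix (Fin m) (Fin n) ℝ) : (M * T * Mᵀ).PosSemidef := by
  simpa using hT.mul_mul_conjTranspose_same M

theorem Matrix.PosSemidef.transpose_congr {T : Matrix (Fin n) (Fin n) ℝ} (hT : T.PosSemidef)
    (M : Matrix (Fin n) (Fin m) ℝ) : (Mᵀ * T * M).PosSemidef := by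
  simpa using hT.conjTranspose_mul_mul_same M

theorem quadForm_congr (T : Matrix (Fin n) (Fin n) ℝ) (M : Matrix (Fin n) (Fin m) ℝ) (x : Vec m) :
    x ⬝ᵥ ((Mᵀ * T * M) *ᵥ x) = (M *ᵥ x) ⬝ᵥ (T *ᵥ (M *ᵥ x)) := by
  rw [← mulVec_mulVec, ← mulVec_mulVec, dotProduct_mulVec_transpose, transpose_transpose]

theorem dotProduct_congr {k : ℕ} (T : Matrix (Fin n) (Fin n) ℝ) (M : Matrix (Fin n) (Fin m) ℝ)
    (M' : Matrix (Fin n) (Fin k) ℝ) (x : Vec m) (y : Vec k) :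
    x ⬝ᵥ ((Mᵀ * T * M') *ᵥ y) = (M *ᵥ x) ⬝ᵥ (T *ᵥ (M' *ᵥ y)) := by
  rw [← mulVec_mulVec, ← mulVec_mulVec, dotProduct_mulVec_transpose, transpose_transpose]

/-- The trace of a product of two positive semidefinite matrices is nonnegative. -/
theorem Matrix.PosSemidef.trace_mul_nonneg {S T : Matrix (Fin n) (Fin n) ℝ} (hS : S.PosSemidef)
    (hT : T.PosSemidef) : 0 ≤ (S * T).trace := by
  obtain ⟨R, rfl⟩ : ∃ R : Matrix (Fin n) (Fin n) ℝ, T = Rᴴ * R := by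
    open scoped MatrixOrder in
    exact CStarAlgebra.nonneg_iff_eq_star_mul_self.1 hT.nonneg
  rw [← Matrix.mul_assoc, trace_mul_comm, ← Matrix.mul_assoc]
  exact (hS.mul_mul_conjTranspose_same R).trace_nonneg

theorem continuous_quadForm (x : Vec n) :
    Continuous fun T : Matrix (Fin n) (Fin n) ℝ => x ⬝ᵥ (T *ᵥ x) := by
  fun_prop

end LinearAlgebra

/-! ### The discounted Riccati operator -/

namespace GameData

variable {nx nu ny : ℕ} (D : GameData nx nu ny)

/-- The weight `η Bᵀ T B + U` of the control input in the one-step problem with cost-to-go `T`. -/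
noncomputable def inputWeight (T : Matrix (Fin nx) (Fin nx) ℝ) : Matrix (Fin nu) (Fin nu) ℝ :=
  D.eta • (D.Bᵀ * T * D.B) + D.U

/-- The weight `η Aᵀ T A + W - riccati T` of the estimation error. -/
noncomputable def errorWeight (T : Matrix (Fin nx) (Fin nx) ℝ) : Matrix (Fin nx) (Fin nx) ℝ :=
  D.eta • (D.Aᵀ * T * D.A) + D.W - D.riccati T

variable {D}

theorem inputWeight_posDef (hη : 0 ≤ D.eta) (hU : D.U.PosDef) {T : Matrix (Fin nx) (Fin nx) ℝ}
    (hT : T.PosSemidef) : (D.inputWeight T).PosDef :=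
  .posSemidef_add ((hT.transpose_congr D.B).smul hη) hU

/-- The normal equation of the one-step problem; it describes the gain without the inverse. -/
theorem inputWeight_mul_gain (hη : 0 ≤ D.eta) (hU : D.U.PosDef) {T : Matrix (Fin nx) (Fin nx) ℝ}
    (hT : T.PosSemidef) : D.inputWeight T * D.gain T = -(D.eta • (D.Bᵀ * T * D.A)) := by
  have h := (inputWeight_posDef hη hU hT).isUnit
  rw [gain, ← inputWeight, Matrix.mul_neg, Matrix.mul_smul, Matrix.mul_assoc, Matrix.mul_assoc,
    mul_nonsing_inv_cancel_left _ _ ((isUnit_iff_isUnit_det _).1 h), ← Matrix.mul_assoc]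

/-- An error e in the state seen by the feedback shifts the input by `gain T` e, and the shift is
charged with `inputWeight T`. This form also makes positive semidefiniteness evident. -/
theorem errorWeight_eq (hη : 0 ≤ D.eta) (hU : D.U.PosDef) {T : Matrix (Fin nx) (Fin nx) ℝ}
    (hT : T.PosSemidef) :
    D.errorWeight T = (D.gain T)ᵀ * D.inputWeight T * D.gain T := by
  have hM := (inputWeight_posDef hη hU hT).posSemidef.transpose_eq
  rw [Matrix.mul_assoc, inputWeight_mul_gain hη hU hT, errorWeight, riccati, gain, ← inputWeight]
  simp only [transpose_neg, transpose_smul, transpose_mul, transpose_transpose, hT.transpose_eq,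
    transpose_nonsing_inv, hM, sub_sub_cancel, Matrix.neg_mul, Matrix.mul_neg,
    Matrix.smul_mul, Matrix.mul_smul, Matrix.mul_assoc, sq]
  rw [smul_neg, neg_neg, smul_smul]

theorem errorWeight_posSemidef (hη : 0 ≤ D.eta) (hU : D.U.PosDef)
    {T : Matrix (Fin nx) (Fin nx) ℝ} (hT : T.PosSemidef) : (D.errorWeight T).PosSemidef := by
  rw [errorWeight_eq hη hU hT]
  exact (inputWeight_posDef hη hU hT).posSemidef.transpose_congr _

/-- By the normal equation, the terms mixing u and x are those of the square; the part of the square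
in x alone is `errorWeight T`, which `riccati T` subtracts. -/
theorem completion_of_squares (hη : 0 ≤ D.eta) (hU : D.U.PosDef)
    {T : Matrix (Fin nx) (Fin nx) ℝ} (hT : T.PosSemidef) (x : Vec nx) (u : Vec nu) :
    x ⬝ᵥ (D.W *ᵥ x) + u ⬝ᵥ (D.U *ᵥ u)
        + D.eta * ((D.A *ᵥ x + D.B *ᵥ u) ⬝ᵥ (T *ᵥ (D.A *ᵥ x + D.B *ᵥ u)))
      = x ⬝ᵥ (D.riccati T *ᵥ x)
        + (u - D.gain T *ᵥ x) ⬝ᵥ (D.inputWeight T *ᵥ (u - D.gain T *ᵥ x)) := by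
  have hM := (inputWeight_posDef hη hU hT).posSemidef.transpose_eq
  have h1 : D.riccati T = D.eta • (D.Aᵀ * T * D.A) + D.W
      - (D.gain T)ᵀ * D.inputWeight T * D.gain T := by
    rw [← errorWeight_eq hη hU hT, errorWeight]; abel
  have h2 : u ⬝ᵥ (D.inputWeight T *ᵥ (D.gain T *ᵥ x))
      = -(D.eta * ((D.B *ᵥ u) ⬝ᵥ (T *ᵥ (D.A *ᵥ x)))) := by
    rw [mulVec_mulVec, inputWeight_mul_gain hη hU hT, neg_mulVec, smul_mulVec,
      dotProduct_neg, dotProduct_smul, dotProduct_congr, smul_eq_mul]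
  have h3 : u ⬝ᵥ (D.inputWeight T *ᵥ u)
      = D.eta * ((D.B *ᵥ u) ⬝ᵥ (T *ᵥ (D.B *ᵥ u))) + u ⬝ᵥ (D.U *ᵥ u) := by
    rw [inputWeight, add_mulVec, smul_mulVec, dotProduct_add, dotProduct_smul, quadForm_congr,
      smul_eq_mul]
  have h4 := dotProduct_mulVec_symm hM (D.gain T *ᵥ x) u
  have h5 := dotProduct_mulVec_symm hT.transpose_eq (D.A *ᵥ x) (D.B *ᵥ u)
  rw [h1]
  simp only [mulVec_add, mulVec_sub, add_dotProduct, sub_dotProduct, dotProduct_add,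
    dotProduct_sub, sub_mulVec, add_mulVec, smul_mulVec, dotProduct_smul, smul_eq_mul,
    quadForm_congr, h2, h3, h4, h5]
  ring

theorem riccati_quadForm_le (hη : 0 ≤ D.eta) (hU : D.U.PosDef)
    {T : Matrix (Fin nx) (Fin nx) ℝ} (hT : T.PosSemidef) (x : Vec nx) (u : Vec nu) :
    x ⬝ᵥ (D.riccati T *ᵥ x) ≤ x ⬝ᵥ (D.W *ᵥ x) + u ⬝ᵥ (D.U *ᵥ u)
        + D.eta * ((D.A *ᵥ x + D.B *ᵥ u) ⬝ᵥ (T *ᵥ (D.A *ᵥ x + D.B *ᵥ u))) := by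
  rw [completion_of_squares hη hU hT]
  exact le_add_of_nonneg_right ((inputWeight_posDef hη hU hT).posSemidef.quadForm_nonneg _)

theorem riccati_quadForm_eq (hη : 0 ≤ D.eta) (hU : D.U.PosDef)
    {T : Matrix (Fin nx) (Fin nx) ℝ} (hT : T.PosSemidef) (x : Vec nx) :
    x ⬝ᵥ (D.riccati T *ᵥ x) = x ⬝ᵥ (D.W *ᵥ x)
      + (D.gain T *ᵥ x) ⬝ᵥ (D.U *ᵥ (D.gain T *ᵥ x))
      + D.eta * ((D.A *ᵥ x + D.B *ᵥ (D.gain T *ᵥ x)) ⬝ᵥ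
          (T *ᵥ (D.A *ᵥ x + D.B *ᵥ (D.gain T *ᵥ x)))) := by
  rw [completion_of_squares hη hU hT]
  simp

theorem riccati_transpose (hη : 0 ≤ D.eta) (hU : D.U.PosDef) (hW : D.W.PosSemidef)
    {T : Matrix (Fin nx) (Fin nx) ℝ} (hT : T.PosSemidef) :
    (D.riccati T)ᵀ = D.riccati T := by
  have h1 : D.riccati T = D.eta • (D.Aᵀ * T * D.A) + D.W - D.errorWeight T := by
    rw [errorWeight]; abel
  rw [h1, transpose_sub, transpose_add, transpose_smul, (hT.transpose_congr D.A).transpose_eq,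
    hW.transpose_eq, (errorWeight_posSemidef hη hU hT).transpose_eq]

theorem riccati_posSemidef (hη : 0 ≤ D.eta) (hU : D.U.PosDef) (hW : D.W.PosSemidef)
    {T : Matrix (Fin nx) (Fin nx) ℝ} (hT : T.PosSemidef) : (D.riccati T).PosSemidef := by
  refine posSemidef_of_quadForm_nonneg (riccati_transpose hη hU hW hT) fun x => ?_
  rw [riccati_quadForm_eq hη hU hT]
  have h1 := hW.quadForm_nonneg x
  have h2 := hU.posSemidef.quadForm_nonneg (D.gain T *ᵥ x)
  have h3 := mul_nonneg hη (hT.quadForm_nonneg (D.A *ᵥ x + D.B *ᵥ (D.gain T *ᵥ x)))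
  linarith

/-- The Riccati form is a minimum over inputs of a cost that is monotone in the cost-to-go, so the
optimal input for T' is tried in the problem for T. -/
theorem riccati_mono (hη : 0 ≤ D.eta) (hU : D.U.PosDef)
    {T T' : Matrix (Fin nx) (Fin nx) ℝ} (hT : T.PosSemidef) (hT' : T'.PosSemidef)
    (h : ∀ x : Vec nx, x ⬝ᵥ (T *ᵥ x) ≤ x ⬝ᵥ (T' *ᵥ x)) (x : Vec nx) :
    x ⬝ᵥ (D.riccati T *ᵥ x) ≤ x ⬝ᵥ (D.riccati T' *ᵥ x) := by
  rw [riccati_quadForm_eq hη hU hT' x]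
  refine (riccati_quadForm_le hη hU hT x (D.gain T' *ᵥ x)).trans ?_
  gcongr
  exact h _

theorem iterate_riccati_posSemidef (hη : 0 ≤ D.eta) (hU : D.U.PosDef) (hW : D.W.PosSemidef)
    (k : ℕ) : (D.riccati^[k] D.W).PosSemidef := by
  induction k with
  | zero => exact hW
  | succ k ih =>
    rw [Function.iterate_succ_apply']
    exact riccati_posSemidef hη hU hW ih

/-- The iterates are optimal costs of longer and longer horizons. The first comparison holds because
a further stage has nonnegative cost; monotonicity of the operator propagates it. -/
theorem iterate_riccati_monotone (hη : 0 ≤ D.eta) (hU : D.U.PosDef) (hW : D.W.PosSemidef)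
    (x : Vec nx) : Monotone fun k : ℕ => x ⬝ᵥ (D.riccati^[k] D.W *ᵥ x) := by
  refine monotone_nat_of_le_succ fun k => ?_
  induction k generalizing x with
  | zero =>
    have h := riccati_quadForm_eq hη hU hW x
    have h2 := hU.posSemidef.quadForm_nonneg (D.gain D.W *ᵥ x)
    have h3 := mul_nonneg hη
      (hW.quadForm_nonneg (D.A *ᵥ x + D.B *ᵥ (D.gain D.W *ᵥ x)))
    simp only [Function.iterate_zero, id, zero_add, Function.iterate_one]
    linarith
  | succ k ih =>
    rw [Function.iterate_succ_apply', Function.iterate_succ_apply' _ (k + 1)]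
    exact riccati_mono hη hU (iterate_riccati_posSemidef hη hU hW k)
      (iterate_riccati_posSemidef hη hU hW (k + 1)) ih x

end GameData

/-! ### Controllability and convergence of the Riccati iterates -/

/-- The trajectory of `x_{k+1} = A x_k + B u_k` started at `x`. -/
noncomputable def openLoop {nx nu : ℕ} (A : Matrix (Fin nx) (Fin nx) ℝ) (B : Matrix (Fin nx) (Fin nu) ℝ)
    (u : ℕ → Vec nu) (x : Vec nx) : ℕ → Vec nx
  | 0 => x
  | k + 1 => A *ᵥ openLoop A B u x k + B *ᵥ u k

theorem openLoop_eq {nx nu : ℕ} (A : Matrix (Fin nx) (Fin nx) ℝ) (B : Matrix (Fin nx) (Fin nu) ℝ)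
    (u : ℕ → Vec nu) (x : Vec nx) (k : ℕ) :
    openLoop A B u x k
      = A ^ k *ᵥ x + ∑ i ∈ Finset.range k, (A ^ i * B) *ᵥ u (k - 1 - i) := by
  induction k with
  | zero => simp [openLoop]
  | succ k ih =>
    rw [openLoop, ih, mulVec_add, mulVec_mulVec, ← pow_succ', Finset.sum_range_succ', mulVec_sum]
    simp only [pow_zero, Matrix.one_mul, mulVec_mulVec, ← Matrix.mul_assoc, ← pow_succ', add_assoc]
    simp [Nat.sub_sub, add_comm 1]

/-- Full row rank makes -A^nx x a combination of the columns of the controllability matrix; the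
coefficients are the inputs. -/
theorem IsControllable.exists_openLoop_eq_zero {nx nu : ℕ} {A : Matrix (Fin nx) (Fin nx) ℝ}
    {B : Matrix (Fin nx) (Fin nu) ℝ} (h : IsControllable A B) (x : Vec nx) :
    ∃ u : ℕ → Vec nu, openLoop A B u x nx = 0 := by
  rw [IsControllable, Matrix.rank] at h
  set M := Matrix.of fun (i : Fin nx) (p : Fin nx × Fin nu) => (A ^ (p.1 : ℕ) * B) i p.2
  have hs : LinearMap.range M.mulVecLin = ⊤ :=
    Submodule.eq_top_of_finrank_eq (by rw [h]; simp)
  obtain ⟨z, hz⟩ := LinearMap.range_eq_top.1 hs (-(A ^ nx *ᵥ x))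
  -- The blocks are traversed backwards in time, since the input of time k gets multiplied by
  -- A^(nx-1-k) B. Inputs from time nx on play no role.
  refine ⟨fun k => if hk : nx - 1 - k < nx then fun j => z (⟨nx - 1 - k, hk⟩, j) else 0, ?_⟩
  rw [openLoop_eq, Finset.sum_range, ← neg_eq_iff_add_eq_zero, ← hz]
  ext i
  simp only [mulVecLin_apply, mulVec, dotProduct, M, of_apply, Finset.sum_apply,
    Fintype.sum_prod_type]
  refine Finset.sum_congr rfl fun k _ => Finset.sum_congr rfl fun j _ => ?_
  have h1 : nx - 1 - (nx - 1 - (k : ℕ)) = k := by omega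
  simp [h1]

namespace GameData

variable {nx nu ny : ℕ} {D : GameData nx nu ny}

/-- Each application of `riccati` is at most the cost of the prescribed input, so m prescribed
inputs are paid before the optimal cost of the remaining horizon. -/
theorem iterate_riccati_le_openLoop (hη : 0 ≤ D.eta) (hU : D.U.PosDef) (hW : D.W.PosSemidef)
    (u : ℕ → Vec nu) (x : Vec nx) (m k : ℕ) :
    x ⬝ᵥ (D.riccati^[m + k] D.W *ᵥ x) ≤
      ∑ i ∈ Finset.range m, D.eta ^ i *
        (openLoop D.A D.B u x i ⬝ᵥ (D.W *ᵥ openLoop D.A D.B u x i) + u i ⬝ᵥ (D.U *ᵥ u i))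
      + D.eta ^ m * (openLoop D.A D.B u x m ⬝ᵥ (D.riccati^[k] D.W *ᵥ openLoop D.A D.B u x m)) := by
  induction m generalizing k with
  | zero => simp [openLoop]
  | succ m ih =>
    have h1 := ih (k + 1)
    rw [← add_assoc, add_right_comm] at h1
    refine h1.trans ?_
    rw [Finset.sum_range_succ, add_assoc]
    gcongr
    rw [Function.iterate_succ_apply', openLoop, pow_succ, mul_assoc, ← mul_add]
    gcongr
    exact riccati_quadForm_le hη hU (iterate_riccati_posSemidef hη hU hW k) _ _

/-- An input that steers x to 0 in nx steps has a finite cost and leaves nothing to pay afterwards,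
so the bound does not depend on the horizon. -/
theorem bddAbove_iterate_riccati (hη : 0 ≤ D.eta) (hU : D.U.PosDef) (hW : D.W.PosSemidef)
    (hAB : IsControllable D.A D.B) (x : Vec nx) :
    BddAbove (Set.range fun k : ℕ => x ⬝ᵥ (D.riccati^[k] D.W *ᵥ x)) := by
  obtain ⟨u, hu⟩ := hAB.exists_openLoop_eq_zero x
  refine ⟨∑ i ∈ Finset.range nx, D.eta ^ i *
        (openLoop D.A D.B u x i ⬝ᵥ (D.W *ᵥ openLoop D.A D.B u x i) + u i ⬝ᵥ (D.U *ᵥ u i)), ?_⟩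
  rintro _ ⟨k, rfl⟩
  refine (iterate_riccati_monotone hη hU hW x (Nat.le_add_left k nx)).trans ?_
  refine (iterate_riccati_le_openLoop hη hU hW u x nx k).trans ?_
  simp [hu]

theorem continuousAt_riccati (hη : 0 ≤ D.eta) (hU : D.U.PosDef)
    {T : Matrix (Fin nx) (Fin nx) ℝ} (hT : T.PosSemidef) : ContinuousAt D.riccati T := by
  have hdet := (isUnit_iff_isUnit_det _).1 (inputWeight_posDef hη hU hT).isUnit
  have hinv : ContinuousAt (fun T => (D.eta • (D.Bᵀ * T * D.B) + D.U)⁻¹) T := by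
    refine ContinuousAt.comp (g := fun X : Matrix (Fin nu) (Fin nu) ℝ => X⁻¹)
      (continuousAt_matrix_inv _ ?_) (by fun_prop)
    rw [← inputWeight, Ring.inverse_eq_inv']
    exact continuousAt_inv₀ hdet.ne_zero
  unfold riccati
  have hid : ContinuousAt (fun T : Matrix (Fin nx) (Fin nx) ℝ => T) T := continuousAt_id
  have hc : ∀ {a b : ℕ} (X : Matrix (Fin a) (Fin b) ℝ),
      ContinuousAt (fun _ : Matrix (Fin nx) (Fin nx) ℝ => X) T := fun X => continuousAt_const
  have hmul : ∀ {a b c : ℕ} {f : Matrix (Fin nx) (Fin nx) ℝ → Matrix (Fin a) (Fin b) ℝ}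
      {g : Matrix (Fin nx) (Fin nx) ℝ → Matrix (Fin b) (Fin c) ℝ}, ContinuousAt f T →
      ContinuousAt g T → ContinuousAt (fun X => f X * g X) T := by
    intro a b c f g hf hg
    have h : Continuous fun p : Matrix (Fin a) (Fin b) ℝ × Matrix (Fin b) (Fin c) ℝ =>
      p.1 * p.2 := by fun_prop
    exact h.continuousAt.comp (hf.prodMk hg)
  have h1 := hmul (hmul (hc D.Aᵀ) hid) (hc D.A)
  have h2 := hmul (hmul (hmul (hmul (hmul (hmul (hc D.Aᵀ) hid) (hc D.B)) hinv) (hc D.Bᵀ)) hid)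
    (hc D.A)
  exact ((h1.const_smul D.eta).add (hc D.W)).sub (h2.const_smul (D.eta ^ 2))

/-- The quadratic forms are monotone and bounded, hence convergent, and so are the matrices.
Continuity at the positive semidefinite limit gives the fixed point. -/
theorem exists_tendsto_iterate_riccati (hη : 0 ≤ D.eta) (hU : D.U.PosDef) (hW : D.W.PosSemidef)
    (hAB : IsControllable D.A D.B) :
    ∃ S : Matrix (Fin nx) (Fin nx) ℝ, S.PosSemidef ∧
      Tendsto (fun n : ℕ => D.riccati^[n] D.W) atTop (𝓝 S) ∧ S = D.riccati S := by
  have hq : ∀ x : Vec nx, ∃ l : ℝ,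
      Tendsto (fun k : ℕ => x ⬝ᵥ (D.riccati^[k] D.W *ᵥ x)) atTop (𝓝 l) := fun x =>
    ⟨_, tendsto_atTop_ciSup (iterate_riccati_monotone hη hU hW x)
      (bddAbove_iterate_riccati hη hU hW hAB x)⟩
  choose l hl using hq
  -- Polarization: the entries are recovered from the quadratic forms at e_i + e_j, e_i and e_j.
  have hpolar : ∀ (k : ℕ) (i j : Fin nx), (D.riccati^[k] D.W) i j =
      ((Pi.single i 1 + Pi.single j 1) ⬝ᵥ
          (D.riccati^[k] D.W *ᵥ (Pi.single i 1 + Pi.single j 1 : Vec nx))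
        - Pi.single i 1 ⬝ᵥ (D.riccati^[k] D.W *ᵥ (Pi.single i 1 : Vec nx))
        - Pi.single j 1 ⬝ᵥ (D.riccati^[k] D.W *ᵥ (Pi.single j 1 : Vec nx))) / 2 := by
    intro k i j
    have h := congrFun (congrFun (iterate_riccati_posSemidef hη hU hW k).transpose_eq i) j
    rw [transpose_apply] at h
    simp [mulVec_add, add_dotProduct, dotProduct_add, h]
    ring
  set S : Matrix (Fin nx) (Fin nx) ℝ := Matrix.of fun i j =>
    (l (Pi.single i 1 + Pi.single j 1) - l (Pi.single i 1) - l (Pi.single j 1)) / 2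
  have hS : Tendsto (fun n : ℕ => D.riccati^[n] D.W) atTop (𝓝 S) := by
    refine tendsto_pi_nhds.2 fun i => tendsto_pi_nhds.2 fun j => ?_
    simp only [hpolar _ i j]
    exact (((hl _).sub (hl _)).sub (hl _)).div_const 2
  have hpsd : S.PosSemidef := by
    refine posSemidef_of_quadForm_nonneg ?_ fun x => ?_
    · refine tendsto_nhds_unique (f := fun n : ℕ => D.riccati^[n] D.W) ?_ hS
      refine (((continuous_id.matrix_transpose).tendsto S).comp hS).congr fun k => ?_
      exact (iterate_riccati_posSemidef hη hU hW k).transpose_eq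
    · refine ge_of_tendsto' (((continuous_quadForm x).tendsto S).comp hS) fun k => ?_
      exact (iterate_riccati_posSemidef hη hU hW k).quadForm_nonneg x
  refine ⟨S, hpsd, hS, ?_⟩
  refine tendsto_nhds_unique ((tendsto_add_atTop_iff_nat 1).2 hS) ?_
  simp only [Function.iterate_succ_apply']
  exact (continuousAt_riccati hη hU hpsd).tendsto.comp hS

end GameData

/-! ### Powers of a matrix and its spectral radius -/

section PowerBounds

variable {n : ℕ}

open scoped Matrix.Norms.Operator in
/-- A consequence of Gelfand's formula for complex matrices. -/
theorem exists_norm_pow_le_complex (A : Matrix (Fin n) (Fin n) ℂ) {s : ℝ} (hs : 0 < s)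
    (h : ∀ z ∈ spectrum ℂ A, ‖z‖ < s) : ∃ C : ℝ, 0 ≤ C ∧ ∀ k i j, ‖(A ^ k) i j‖ ≤ C * s ^ k := by
  rcases Nat.eq_zero_or_pos n with rfl | hn
  · exact ⟨0, le_rfl, fun k i => i.elim0⟩
  have : Nonempty (Fin n) := ⟨⟨0, hn⟩⟩
  lift s to NNReal using hs.le
  have hrad : spectralRadius ℂ A < s :=
    spectrum.spectralRadius_lt_of_forall_lt_of_nonempty (spectrum.nonempty A)
      fun z hz => by exact_mod_cast h z hz
  have hev := (spectrum.pow_nnnorm_pow_one_div_tendsto_nhds_spectralRadius A).eventually_lt_const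
    hrad
  obtain ⟨k₀, hk₀⟩ := eventually_atTop.1 hev
  have hlarge : ∀ k, k₀ ⊔ 1 ≤ k → ‖A ^ k‖ ≤ s ^ k := by
    intro k hk
    have hk1 : (k : ℝ) ≠ 0 := by
      have : 1 ≤ k := le_of_max_le_right hk
      positivity
    have h1 := ENNReal.rpow_le_rpow (hk₀ k (le_of_max_le_left hk)).le (Nat.cast_nonneg k)
    rw [← ENNReal.rpow_mul, one_div_mul_cancel hk1, ENNReal.rpow_one, ENNReal.rpow_natCast] at h1
    exact_mod_cast h1
  have hentry : ∀ (M : Matrix (Fin n) (Fin n) ℂ) i j, ‖M i j‖ ≤ ‖M‖ := by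
    intro M i j
    have h1 : ‖M i j‖₊ ≤ ‖M‖₊ := by
      rw [linfty_opNNNorm_def]
      exact (Finset.single_le_sum (f := fun j => ‖M i j‖₊) (fun _ _ => zero_le) 
        (Finset.mem_univ j)).trans (Finset.le_sup (f := fun i => ∑ j, ‖M i j‖₊) (Finset.mem_univ i))
    exact_mod_cast h1
  -- The summand 1 serves the large exponents, where Gelfand's formula applies; the sum of ratios
  -- serves the finitely many smaller ones.
  refine ⟨1 + ∑ k ∈ Finset.range (k₀ ⊔ 1), ‖A ^ k‖ / s ^ k, by positivity, fun k i j => ?_⟩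
  have hsk : (0 : ℝ) < s ^ k := pow_pos hs k
  refine (hentry _ i j).trans ?_
  by_cases hk : k₀ ⊔ 1 ≤ k
  · refine (hlarge k hk).trans (le_mul_of_one_le_left hsk.le ?_)
    have : 0 ≤ ∑ k ∈ Finset.range (k₀ ⊔ 1), ‖A ^ k‖ / (s : ℝ) ^ k := by positivity
    linarith
  · rw [← div_le_iff₀ hsk]
    have h1 := Finset.single_le_sum (f := fun k => ‖A ^ k‖ / (s : ℝ) ^ k)
      (fun i _ => by positivity) (Finset.mem_range.2 (not_le.1 hk))
    linarith

theorem exists_abs_pow_le (A : Matrix (Fin n) (Fin n) ℝ) {s : ℝ} (hs : 0 < s)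
    (h : ∀ z ∈ spectrum ℂ (A.map (algebraMap ℝ ℂ)), ‖z‖ < s) :
    ∃ C : ℝ, 0 ≤ C ∧ ∀ k i j, |(A ^ k) i j| ≤ C * s ^ k := by
  obtain ⟨C, hC, hle⟩ := exists_norm_pow_le_complex _ hs h
  refine ⟨C, hC, fun k i j => (hle k i j).trans' ?_⟩
  have h1 : (A.map (algebraMap ℝ ℂ)) ^ k = (A ^ k).map (algebraMap ℝ ℂ) :=
    (map_pow (algebraMap ℝ ℂ).mapMatrix A k).symm
  rw [h1, map_apply]
  simp

/-- Cayley-Hamilton: A^k is the value at A of the remainder of X^k modulo the characteristic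
polynomial. -/
theorem pow_mem_range_sum_pow (A : Matrix (Fin n) (Fin n) ℝ) (k : ℕ) :
    ∃ c : Fin n → ℝ, ∑ j, c j • A ^ (j : ℕ) = A ^ k := by
  rcases Nat.eq_zero_or_pos n with rfl | hn
  · exact ⟨0, Subsingleton.elim _ _⟩
  refine ⟨fun j => (Polynomial.X ^ k %ₘ A.charpoly).coeff j, ?_⟩
  rw [pow_eq_aeval_mod_charpoly, Polynomial.aeval_eq_sum_range' (n := n), Finset.sum_range]
  refine (Polynomial.natDegree_modByMonic_lt _ A.charpoly_monic ?_).trans_eq ?_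
  · intro h1
    have := A.charpoly_natDegree_eq_dim
    rw [h1] at this
    simp at this
    omega
  · simp

/-- The powers of `A` are combinations of the first `n` powers, with coefficients that grow no
faster than the spectral radius allows. -/
theorem exists_pow_eq_sum_pow (A : Matrix (Fin n) (Fin n) ℝ) {s : ℝ} (hs : 0 < s)
    (h : ∀ z ∈ spectrum ℂ (A.map (algebraMap ℝ ℂ)), ‖z‖ < s) :
    ∃ C : ℝ, 0 ≤ C ∧ ∀ k, ∃ c : Fin n → ℝ,
      A ^ k = ∑ j, c j • A ^ (j : ℕ) ∧ ∀ j, |c j| ≤ C * s ^ k := by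
  obtain ⟨C, hC, hle⟩ := exists_abs_pow_le A hs h
  -- The powers may be linearly dependent. A linear right inverse of Φ on its range, extended to all
  -- matrices, selects coefficients that depend linearly on A^k and are therefore bounded by its
  -- entries.
  let Φ : (Fin n → ℝ) →ₗ[ℝ] Matrix (Fin n) (Fin n) ℝ :=
    Fintype.linearCombination ℝ fun j : Fin n => A ^ (j : ℕ)
  obtain ⟨Ψ₀, hΨ₀⟩ := Φ.rangeRestrict.exists_rightInverse_of_surjective Φ.range_rangeRestrict
  obtain ⟨Ψ, hΨ⟩ := LinearMap.exists_extend Ψ₀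
  have hinv : ∀ k, Φ (Ψ (A ^ k)) = A ^ k := by
    intro k
    have hmem : A ^ k ∈ LinearMap.range Φ := by
      obtain ⟨c, hc⟩ := pow_mem_range_sum_pow A k
      exact ⟨c, by simpa [Φ, Fintype.linearCombination_apply] using hc⟩
    have h1 : Ψ (A ^ k) = Ψ₀ ⟨A ^ k, hmem⟩ := LinearMap.congr_fun hΨ ⟨A ^ k, hmem⟩
    have h2 := congrArg Subtype.val (LinearMap.congr_fun hΨ₀ ⟨A ^ k, hmem⟩)
    rw [h1]
    exact h2
  refine ⟨∑ i, ∑ j, C * ∑ l, |Ψ (Matrix.single i j 1) l|, by positivity, fun k =>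
    ⟨Ψ (A ^ k), ?_, fun l => ?_⟩⟩
  · conv_lhs => rw [← hinv k]
    simp [Φ, Fintype.linearCombination_apply]
  · have h1 : Ψ (A ^ k) l = ∑ i, ∑ j, (A ^ k) i j * Ψ (Matrix.single i j 1) l := by
      conv_lhs => rw [matrix_eq_sum_single (A ^ k)]
      simp only [map_sum, Finset.sum_apply]
      refine Finset.sum_congr rfl fun i _ => Finset.sum_congr rfl fun j _ => ?_
      have : Matrix.single i j ((A ^ k) i j) = (A ^ k) i j • Matrix.single i j (1 : ℝ) := by
        rw [smul_single, smul_eq_mul, mul_one]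
      rw [this, map_smul, Pi.smul_apply, smul_eq_mul]
    rw [h1]
    refine (Finset.abs_sum_le_sum_abs _ _).trans ?_
    rw [Finset.sum_mul]
    refine Finset.sum_le_sum fun i _ => (Finset.abs_sum_le_sum_abs _ _).trans ?_
    rw [Finset.sum_mul]
    refine Finset.sum_le_sum fun j _ => ?_
    rw [abs_mul, mul_right_comm]
    gcongr
    · exact hle k i j
    · exact Finset.single_le_sum (f := fun l => |Ψ (Matrix.single i j 1) l|)
        (fun _ _ => abs_nonneg _) (Finset.mem_univ l)

/-- For positive semidefinite `N` and `X`, the function `Y ↦ tr (N Y X Yᵀ)` is the square of a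
seminorm. -/
theorem trace_congr_sum_le {N X : Matrix (Fin n) (Fin n) ℝ} (hN : N.PosSemidef)
    (hX : X.PosSemidef) (c : Fin n → ℝ) (Y : Fin n → Matrix (Fin n) (Fin n) ℝ) :
    (N * ((∑ j, c j • Y j) * X * (∑ j, c j • Y j)ᵀ)).trace
      ≤ n * ∑ j, c j ^ 2 * (N * (Y j * X * (Y j)ᵀ)).trace := by
  obtain ⟨R, rfl⟩ : ∃ R : Matrix (Fin n) (Fin n) ℝ, N = Rᴴ * R := by
    open scoped MatrixOrder in
    exact CStarAlgebra.nonneg_iff_eq_star_mul_self.1 hN.nonneg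
  obtain ⟨Z, rfl⟩ : ∃ Z : Matrix (Fin n) (Fin n) ℝ, X = Zᴴ * Z := by
    open scoped MatrixOrder in
    exact CStarAlgebra.nonneg_iff_eq_star_mul_self.1 hX.nonneg
  -- The trace is the squared Frobenius norm of R M Zᴴ, which is linear in M.
  have key : ∀ M : Matrix (Fin n) (Fin n) ℝ,
      (Rᴴ * R * (M * (Zᴴ * Z) * Mᵀ)).trace = ∑ a, ∑ b, (R * M * Zᴴ) a b ^ 2 := by
    intro M
    have h1 : (Rᴴ * R * (M * (Zᴴ * Z) * Mᵀ)).trace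
        = ((R * M * Zᴴ) * (R * M * Zᴴ)ᵀ).trace := by
      rw [Matrix.mul_assoc, trace_mul_comm]
      simp [Matrix.mul_assoc]
    rw [h1]
    generalize R * M * Zᴴ = Y
    simp [Matrix.trace, Matrix.mul_apply, sq]
  have hlin : ∀ a b, (R * (∑ j, c j • Y j) * Zᴴ) a b = ∑ j, c j * (R * Y j * Zᴴ) a b := by
    intro a b
    rw [Matrix.mul_sum, Matrix.sum_mul, Matrix.sum_apply]
    simp
  simp only [key, hlin]
  -- Cauchy-Schwarz for a sum of n terms.
  have h2 : ∀ a b, (∑ j, c j * (R * Y j * Zᴴ) a b) ^ 2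
      ≤ n * ∑ j, c j ^ 2 * (R * Y j * Zᴴ) a b ^ 2 := by
    intro a b
    refine (sq_sum_le_card_mul_sum_sq (s := Finset.univ)).trans ?_
    simp [mul_pow]
  refine (Finset.sum_le_sum fun a _ => Finset.sum_le_sum fun b _ => h2 a b).trans_eq ?_
  simp only [← Finset.mul_sum]
  congr 1
  rw [Finset.sum_congr rfl fun a _ => Finset.sum_comm, Finset.sum_comm]
  simp only [Finset.mul_sum]

end PowerBounds

/-! ### Growth of the error covariance with the holding time -/

namespace GameData

variable {nx nu ny : ℕ} {D : GameData nx nu ny} {P : Matrix (Fin nx) (Fin nx) ℝ}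

theorem f_posSemidef (hQ : D.Q.PosSemidef) {X : Matrix (Fin nx) (Fin nx) ℝ} (hX : X.PosSemidef) :
    (D.f X).PosSemidef :=
  (hX.congr_transpose D.A).add hQ

theorem iterate_f_posSemidef (hQ : D.Q.PosSemidef) {X : Matrix (Fin nx) (Fin nx) ℝ}
    (hX : X.PosSemidef) (k : ℕ) : (D.f^[k] X).PosSemidef := by
  induction k with
  | zero => exact hX
  | succ k ih =>
    rw [Function.iterate_succ_apply']
    exact f_posSemidef hQ ih

theorem iterate_f_succ_sub (X : Matrix (Fin nx) (Fin nx) ℝ) (k : ℕ) :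
    D.f^[k + 1] X - D.f^[k] X = D.A ^ k * (D.f X - X) * (D.A ^ k)ᵀ := by
  induction k with
  | zero => simp
  | succ k ih =>
    have h1 : ∀ Y Z, D.f Y - D.f Z = D.A * (Y - Z) * D.Aᵀ := fun Y Z => by
      rw [f, f, add_sub_add_right_eq_sub, ← Matrix.sub_mul, ← Matrix.mul_sub]
    rw [Function.iterate_succ_apply', Function.iterate_succ_apply' _ k, h1,
      ← Function.iterate_succ_apply' D.f k, ih, pow_succ' D.A k,
      transpose_mul]
    simp only [Matrix.mul_assoc]

theorem iterate_f_eq (X : Matrix (Fin nx) (Fin nx) ℝ) (k : ℕ) :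
    D.f^[k] X = D.A ^ k * X * (D.A ^ k)ᵀ
      + ∑ i ∈ Finset.range k, D.A ^ i * D.Q * (D.A ^ i)ᵀ := by
  induction k with
  | zero => simp
  | succ k ih =>
    rw [Function.iterate_succ_apply', ih, f, Finset.sum_range_succ', Matrix.mul_add, Matrix.add_mul,
      Matrix.mul_sum, Matrix.sum_mul, add_assoc]
    simp only [pow_succ' D.A, transpose_mul, Matrix.mul_assoc, pow_zero, transpose_one,
      Matrix.one_mul, Matrix.mul_one]

/-- The increments are A^k (f X - X) (A^k)ᵀ, so an initial increase persists. -/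
theorem trace_iterate_f_mono {N X : Matrix (Fin nx) (Fin nx) ℝ} (hN : N.PosSemidef)
    (hX : (D.f X - X).PosSemidef) : Monotone fun k : ℕ => (N * D.f^[k] X).trace := by
  refine monotone_nat_of_le_succ fun k => ?_
  rw [← sub_nonneg, ← trace_sub, ← Matrix.mul_sub, iterate_f_succ_sub]
  exact hN.trace_mul_nonneg (hX.congr_transpose _)

theorem trace_congr_pow_le_iterate_f {N X : Matrix (Fin nx) (Fin nx) ℝ} (hQ : D.Q.PosSemidef)
    (hN : N.PosSemidef) (k : ℕ) :
    (N * (D.A ^ k * X * (D.A ^ k)ᵀ)).trace ≤ (N * D.f^[k] X).trace := by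
  rw [iterate_f_eq, Matrix.mul_add, trace_add]
  exact le_add_of_nonneg_right (hN.trace_mul_nonneg
    (posSemidef_sum _ fun i _ => hQ.congr_transpose _))

/-- The cost `tr (N f^t(P))` grows by at most the factor `C r^k` in `k` steps, if `r` exceeds the
squares of the moduli of the eigenvalues of `A`. -/
theorem exists_trace_iterate_f_le {N : Matrix (Fin nx) (Fin nx) ℝ} (hQ : D.Q.PosSemidef)
    (hN : N.PosSemidef) (hP : P.PosSemidef) (hPf : (D.f P - P).PosSemidef) {r : ℝ} (hr : 1 < r)
    (h : ∀ z ∈ spectrum ℂ (D.A.map (algebraMap ℝ ℂ)), ‖z‖ ^ 2 < r) :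
    ∃ C : ℝ, 0 ≤ C ∧ ∀ t k : ℕ,
      (N * D.f^[t + k] P).trace ≤ C * r ^ k * (1 + (N * D.f^[t] P).trace) := by
  have hr0 : 0 < r := one_pos.trans hr
  obtain ⟨C, hC, hc⟩ := exists_pow_eq_sum_pow D.A (Real.sqrt_pos.2 hr0)
    (fun z hz => Real.lt_sqrt_of_sq_lt (h z hz))
  set g : ℕ → ℝ := fun t => (N * D.f^[t] P).trace with hg
  have hg0 : ∀ t, 0 ≤ g t := fun t => hN.trace_mul_nonneg (iterate_f_posSemidef hQ hP t)
  have hmono : Monotone g := trace_iterate_f_mono hN hPf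
  -- Since N may be singular, tr (N X) alone does not control tr (N A^k X (A^k)ᵀ); the first nx
  -- powers together do. Their coefficients, at most C √r^k, enter squared.
  have hpow : ∀ (X : Matrix (Fin nx) (Fin nx) ℝ), X.PosSemidef → ∀ k : ℕ,
      (N * (D.A ^ k * X * (D.A ^ k)ᵀ)).trace ≤
        nx * C ^ 2 * r ^ k * ∑ j : Fin nx, (N * (D.A ^ (j : ℕ) * X * (D.A ^ (j : ℕ))ᵀ)).trace := by
    intro X hX k
    obtain ⟨c, hc1, hc2⟩ := hc k
    rw [hc1]
    refine (trace_congr_sum_le hN hX c _).trans ?_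
    rw [mul_assoc, mul_assoc, ← mul_assoc (C ^ 2), Finset.mul_sum _ _ (C ^ 2 * r ^ k)]
    gcongr with j
    · exact hN.trace_mul_nonneg (hX.congr_transpose _)
    · have h1 := pow_le_pow_left₀ (abs_nonneg _) (hc2 j) 2
      rw [sq_abs, mul_pow, ← pow_mul, mul_comm k, pow_mul, Real.sq_sqrt hr0.le] at h1
      exact h1
  set q : ℝ := ∑ j : Fin nx, (N * (D.A ^ (j : ℕ) * D.Q * (D.A ^ (j : ℕ))ᵀ)).trace with hq
  have hq0 : 0 ≤ q := Finset.sum_nonneg fun j _ => hN.trace_mul_nonneg (hQ.congr_transpose _)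
  obtain ⟨c₁, hc₁e⟩ : ∃ c₁ : ℝ, c₁ = nx * C ^ 2 * r ^ nx := ⟨_, rfl⟩
  have hc₁ : 0 ≤ c₁ := by rw [hc₁e]; positivity
  -- the estimate for holding times of at least `nx`
  have hlarge : ∀ s k : ℕ, g (s + nx + k) ≤ c₁ * (nx + q / (r - 1)) * r ^ k * (1 + g (s + nx)) := by
    intro s k
    have e1 : s + nx + k = (nx + k) + s := by ring
    have h1 : g (s + nx + k) = (N * (D.A ^ (nx + k) * D.f^[s] P * (D.A ^ (nx + k))ᵀ)).trace
        + ∑ i ∈ Finset.range (nx + k), (N * (D.A ^ i * D.Q * (D.A ^ i)ᵀ)).trace := by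
      rw [hg, e1]
      simp only
      rw [Function.iterate_add_apply, iterate_f_eq, Matrix.mul_add, trace_add, Matrix.mul_sum,
        trace_sum]
    have h2 : (N * (D.A ^ (nx + k) * D.f^[s] P * (D.A ^ (nx + k))ᵀ)).trace
        ≤ c₁ * r ^ k * (nx * g (s + nx)) := by
      refine (hpow _ (iterate_f_posSemidef hQ hP s) _).trans ?_
      rw [pow_add, ← mul_assoc, ← hc₁e]
      -- A^j f^s(P) (A^j)ᵀ costs at most f^(s+j)(P), and j < nx, so monotonicity bounds each summand
      -- by g (s + nx). This is why holding times of at least nx are treated first.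
      refine mul_le_mul_of_nonneg_left ?_ (by positivity)
      refine (Finset.sum_le_card_nsmul _ _ (g (s + nx)) fun j _ => ?_).trans_eq (by simp)
      refine (trace_congr_pow_le_iterate_f hQ hN _).trans ?_
      rw [← Function.iterate_add_apply]
      exact hmono (by omega)
    have h3 : ∑ i ∈ Finset.range (nx + k), (N * (D.A ^ i * D.Q * (D.A ^ i)ᵀ)).trace
        ≤ c₁ * r ^ k * (q / (r - 1)) := by
      refine (Finset.sum_le_sum fun i _ => hpow _ hQ i).trans ?_
      rw [← hq, ← Finset.sum_mul, ← Finset.mul_sum, geom_sum_eq hr.ne']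
      have h4 : (r ^ (nx + k) - 1) / (r - 1) ≤ r ^ nx * r ^ k / (r - 1) := by
        rw [pow_add]
        have : 0 < r - 1 := by linarith
        gcongr
        linarith
      calc nx * C ^ 2 * ((r ^ (nx + k) - 1) / (r - 1)) * q
          ≤ nx * C ^ 2 * (r ^ nx * r ^ k / (r - 1)) * q := by gcongr
        _ = _ := by rw [hc₁e]; ring
    have h5 : 0 ≤ q / (r - 1) := div_nonneg hq0 (by linarith)
    have h6 := hg0 (s + nx)
    have h7 : 0 ≤ c₁ * r ^ k := mul_nonneg hc₁ (pow_pos hr0 k).le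
    rw [h1]
    generalize g (s + nx) = G at h2 h6 ⊢
    generalize q / (r - 1) = w at h3 h5 ⊢
    calc _ ≤ c₁ * r ^ k * (nx * G) + c₁ * r ^ k * w := add_le_add h2 h3
      _ = c₁ * r ^ k * (nx * G + w) := by ring
      _ ≤ c₁ * r ^ k * ((nx + w) * (1 + G)) := by
        refine mul_le_mul_of_nonneg_left ?_ h7
        have := mul_nonneg h5 h6
        have : (0 : ℝ) ≤ nx := Nat.cast_nonneg nx
        linarith
      _ = _ := by ring
  obtain ⟨c₂, hc₂e⟩ : ∃ c₂ : ℝ, c₂ = c₁ * (nx + q / (r - 1)) := ⟨_, rfl⟩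
  rw [← hc₂e] at hlarge
  have hc₂ : 0 ≤ c₂ := by
    have : 0 ≤ q / (r - 1) := div_nonneg hq0 (by linarith)
    rw [hc₂e]
    positivity
  -- For t ≤ nx the estimate from nx is used; the factor 1 + g nx pays for the replacement of t by
  -- nx.
  refine ⟨c₂ * (1 + g nx), mul_nonneg hc₂ (by linarith [hg0 nx]), fun t k => ?_⟩
  change g (t + k) ≤ _ * (1 + g t)
  rcases le_total nx t with ht | ht
  · obtain ⟨s, rfl⟩ := Nat.exists_eq_add_of_le' ht
    refine (hlarge s k).trans ?_
    have := hg0 (s + nx)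
    have : c₂ ≤ c₂ * (1 + g nx) := le_mul_of_one_le_right hc₂ (by linarith [hg0 nx])
    gcongr
  · have h1 := hlarge 0 k
    rw [zero_add] at h1
    have h2 : g (t + k) ≤ g (nx + k) := hmono (by omega)
    refine h2.trans (h1.trans ?_)
    rw [mul_right_comm]
    refine le_mul_of_one_le_right ?_ (by linarith [hg0 t])
    have := hg0 nx
    positivity

end GameData

/-! ### The Shapley equation of the game on holding times -/

section HoldingGame

variable {η lam lamA cs ca : ℝ} {g : ℕ → ℝ}

/-- Expected cost of a stage plus the discounted value `V` of the next one, when the holding time is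
`t`, a transmission occurs with probability `p` and an attack with probability `q`. The reward of
the attack is normalized so that it is the *absence* of an attack that costs `ca`. -/
def holdingPayoff (η lam lamA cs ca : ℝ) (g V : ℕ → ℝ) (t : ℕ) (p q : ℝ) : ℝ :=
  cs * p + ca * (1 - q) + (1 - p * (lam - (lam - lamA) * q)) * (g (t + 1) + η * V (t + 1))
    + p * (lam - (lam - lamA) * q) * (g 0 + η * V 0)

/-- The payoff is continuous and affine in each of p and q, so Sion's theorem applies on the compact
intervals. -/
theorem exists_isSaddlePointOn_holdingPayoff (η lam lamA cs ca : ℝ) (g V : ℕ → ℝ) (t : ℕ) :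
    ∃ p ∈ Set.Icc (0 : ℝ) 1, ∃ q ∈ Set.Icc (0 : ℝ) 1,
      IsSaddlePointOn (Set.Icc 0 1) (Set.Icc 0 1)
        (holdingPayoff η lam lamA cs ca g V t) p q := by
  refine Sion.exists_isSaddlePointOn (Set.nonempty_Icc.2 zero_le_one) (convex_Icc 0 1)
    isCompact_Icc ?_ ?_ (convex_Icc 0 1) (Set.nonempty_Icc.2 zero_le_one) isCompact_Icc ?_ ?_
  · intro q _
    refine Continuous.continuousOn ?_ |>.lowerSemicontinuousOn
    unfold holdingPayoff
    fun_prop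
  · intro q _
    refine ConvexOn.quasiconvexOn ⟨convex_Icc 0 1, fun x _ y _ a b _ _ hab => le_of_eq ?_⟩
    obtain rfl : b = 1 - a := by linarith
    simp only [holdingPayoff, smul_eq_mul]
    ring
  · intro p _
    refine Continuous.continuousOn ?_ |>.upperSemicontinuousOn
    unfold holdingPayoff
    fun_prop
  · intro p _
    refine ConcaveOn.quasiconcaveOn ⟨convex_Icc 0 1, fun x _ y _ a b _ _ hab => le_of_eq ?_⟩
    obtain rfl : b = 1 - a := by linarith
    simp only [holdingPayoff, smul_eq_mul]
    ring

theorem reception_mem_Icc (hA : 0 ≤ lamA) (hlam : lamA ≤ lam) (hl : lam ≤ 1) {p q : ℝ}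
    (hp : p ∈ Set.Icc (0 : ℝ) 1) (hq : q ∈ Set.Icc (0 : ℝ) 1) :
    0 ≤ p * (lam - (lam - lamA) * q) ∧ p * (lam - (lam - lamA) * q) ≤ 1 := by
  have h1 : (lam - lamA) * q ≤ lam - lamA := mul_le_of_le_one_right (by linarith) hq.2
  have h2 : 0 ≤ (lam - lamA) * q := mul_nonneg (by linarith) hq.1
  exact ⟨mul_nonneg hp.1 (by linarith), mul_le_one₀ hp.2 (by linarith) (by linarith)⟩

theorem holdingPayoff_mono (hη : 0 ≤ η) (hA : 0 ≤ lamA) (hlam : lamA ≤ lam) (hl : lam ≤ 1)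
    {V V' : ℕ → ℝ} (h : V ≤ V') (t : ℕ) {p q : ℝ}
    (hp : p ∈ Set.Icc (0 : ℝ) 1) (hq : q ∈ Set.Icc (0 : ℝ) 1) :
    holdingPayoff η lam lamA cs ca g V t p q ≤ holdingPayoff η lam lamA cs ca g V' t p q := by
  obtain ⟨h1, h2⟩ := reception_mem_Icc hA hlam hl hp hq
  unfold holdingPayoff
  have h3 := h (t + 1)
  have h4 := h 0
  have h5 : 0 ≤ 1 - p * (lam - (lam - lamA) * q) := by linarith
  gcongr

/-- The weights of both continuation values are at most 1. The resulting error involves neither p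
nor q and vanishes as V' tends to V, so it survives a comparison of saddle points. -/
theorem holdingPayoff_le_add (hη : 0 ≤ η) (hA : 0 ≤ lamA) (hlam : lamA ≤ lam) (hl : lam ≤ 1)
    {V V' : ℕ → ℝ} (h : V' ≤ V) (t : ℕ) {p q : ℝ}
    (hp : p ∈ Set.Icc (0 : ℝ) 1) (hq : q ∈ Set.Icc (0 : ℝ) 1) :
    holdingPayoff η lam lamA cs ca g V t p q ≤ holdingPayoff η lam lamA cs ca g V' t p q
      + (η * (V (t + 1) - V' (t + 1)) + η * (V 0 - V' 0)) := by
  obtain ⟨h1, h2⟩ := reception_mem_Icc hA hlam hl hp hq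
  unfold holdingPayoff
  generalize p * (lam - (lam - lamA) * q) = b at h1 h2 ⊢
  have h3 := mul_nonneg h1 (mul_nonneg hη (sub_nonneg.2 (h (t + 1))))
  have h4 := mul_nonneg (sub_nonneg.2 h2) (mul_nonneg hη (sub_nonneg.2 (h 0)))
  linarith

/-- The cost of the always-transmitting strategy under a permanent attack bounds the value. -/
theorem exists_holdingPayoff_one_le (hη₀ : 0 < η) (hη₁ : η < 1) (hA : 0 ≤ lamA) (hlam : lamA ≤ lam)
    (hl : lam ≤ 1) (hcs : 0 ≤ cs) (hca : 0 ≤ ca) (hg : ∀ t, 0 ≤ g t) {C r : ℝ} (hC : 0 ≤ C)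
    (hr : 0 ≤ r) (hηr : η * (1 - lamA) * r < 1)
    (hgrowth : ∀ t k, g (t + k) ≤ C * r ^ k * (1 + g t)) :
    ∃ V : ℕ → ℝ, (∀ t, 0 ≤ V t) ∧ (∃ C', 0 ≤ C' ∧ ∀ t, V t ≤ C' * (1 + g t)) ∧
      ∀ t, ∀ q ∈ Set.Icc (0 : ℝ) 1, holdingPayoff η lam lamA cs ca g V t 1 q ≤ V t := by
  -- The discounted probability that an attacked transmission fails.
  obtain ⟨θ, hθ⟩ : ∃ θ, θ = η * (1 - lamA) := ⟨_, rfl⟩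
  have hl0 : 0 ≤ 1 - lamA := by linarith
  have hθ0 : 0 ≤ θ := by rw [hθ]; positivity
  rw [← hθ] at hηr
  have hθr : 0 ≤ θ * r := by positivity
  have hle : ∀ t k, θ ^ k * ((1 - lamA) * g (t + k + 1))
      ≤ (1 - lamA) * C * r * (1 + g t) * (θ * r) ^ k := by
    intro t k
    have h1 := hgrowth t (k + 1)
    calc θ ^ k * ((1 - lamA) * g (t + k + 1))
        ≤ θ ^ k * ((1 - lamA) * (C * r ^ (k + 1) * (1 + g t))) := by gcongr; exact h1
      _ = _ := by rw [mul_pow]; ring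
  have hs' : ∀ t, Summable fun k => (1 - lamA) * C * r * (1 + g t) * (θ * r) ^ k := fun t =>
    (summable_geometric_of_lt_one hθr hηr).mul_left _
  have h0 : ∀ t k, 0 ≤ θ ^ k * ((1 - lamA) * g (t + k + 1)) := fun t k => by
    have := hg (t + k + 1)
    positivity
  have hs : ∀ t, Summable fun k => θ ^ k * ((1 - lamA) * g (t + k + 1)) := fun t =>
    Summable.of_nonneg_of_le (h0 t) (hle t) (hs' t)
  -- X t is the expected discounted error cost before the first reception when every stage has a
  -- transmission and an attack.
  obtain ⟨X, hX⟩ : ∃ X : ℕ → ℝ, ∀ t, X t = ∑' k, θ ^ k * ((1 - lamA) * g (t + k + 1)) :=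
    ⟨_, fun t => rfl⟩
  have hX0 : ∀ t, 0 ≤ X t := fun t => by rw [hX]; exact tsum_nonneg (h0 t)
  have hXrec : ∀ t, X t = (1 - lamA) * g (t + 1) + θ * X (t + 1) := by
    intro t
    rw [hX, (hs t).tsum_eq_zero_add, hX, ← tsum_mul_left]
    congr 1
    · simp
    · refine tsum_congr fun k => ?_
      rw [pow_succ', show t + (k + 1) + 1 = t + 1 + k + 1 by ring]
      ring
  have hXle : ∀ t, X t ≤ (1 - lamA) * C * r * (1 - θ * r)⁻¹ * (1 + g t) := by
    intro t
    rw [hX]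
    refine ((hs t).tsum_le_tsum (hle t) (hs' t)).trans_eq ?_
    rw [tsum_mul_left, tsum_geometric_of_lt_one hθr hηr]
    ring
  -- κ solves κ = cs + ca + g 0 + η X 0 + η κ: it charges, at every stage, a transmission, a missing
  -- attack and a restart after a reception.
  obtain ⟨κ, hκ⟩ : ∃ κ, κ = (cs + ca + g 0 + η * X 0) / (1 - η) := ⟨_, rfl⟩
  have hη1 : 0 < 1 - η := by linarith
  have hκ0 : 0 ≤ κ := by
    rw [hκ]
    have := hg 0
    have := hX0 0
    positivity
  have hκ1 : cs + ca + g 0 + η * X 0 + η * κ = κ := by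
    rw [eq_div_iff hη1.ne'] at hκ
    linarith
  refine ⟨fun t => X t + κ, fun t => add_nonneg (hX0 t) hκ0,
    ⟨(1 - lamA) * C * r * (1 - θ * r)⁻¹ + κ, ?_, fun t => ?_⟩, fun t q hq => ?_⟩
  · have : 0 < 1 - θ * r := by linarith
    positivity
  · have h1 := mul_nonneg hκ0 (hg t)
    have h2 := hXle t
    linarith
  · have hone : (1 : ℝ) ∈ Set.Icc (0 : ℝ) 1 := ⟨zero_le_one, le_rfl⟩
    obtain ⟨h1, h2⟩ := reception_mem_Icc hA hlam hl hone hq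
    have h3 : lamA ≤ 1 * (lam - (lam - lamA) * q) := by
      have : (lam - lamA) * q ≤ lam - lamA := mul_le_of_le_one_right (by linarith) hq.2
      linarith
    unfold holdingPayoff
    generalize 1 * (lam - (lam - lamA) * q) = b at h1 h2 h3 ⊢
    have h4 : 0 ≤ g (t + 1) + η * X (t + 1) := by
      have := hg (t + 1)
      have := hX0 (t + 1)
      positivity
    have h5 : 0 ≤ g 0 + η * X 0 := by
      have := hg 0
      have := hX0 0
      positivity
    -- Whatever the attacker does, the failure probability 1 - b is at most 1 - lamA.
    have h6 : (1 - b) * (g (t + 1) + η * X (t + 1)) ≤ X t := by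
      rw [hXrec t, hθ]
      have := mul_le_mul_of_nonneg_right (sub_le_sub_left h3 1) h4
      linarith
    have h7 : b * (g 0 + η * X 0) ≤ g 0 + η * X 0 := mul_le_of_le_one_left h5 h2
    have h8 : ca * (1 - q) ≤ ca := mul_le_of_le_one_right hca (by linarith [hq.1])
    linarith

/-- The discounted zero-sum game on the holding times has a value `V`, which solves the Shapley
equation, and optimal stationary strategies `p`, `q`. -/
theorem exists_holdingGame_value (hη₀ : 0 < η) (hη₁ : η < 1) (hA : 0 ≤ lamA) (hlam : lamA ≤ lam)
    (hl : lam ≤ 1) (hcs : 0 ≤ cs) (hca : 0 ≤ ca) (hg : ∀ t, 0 ≤ g t) {C r : ℝ} (hC : 0 ≤ C)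
    (hr : 0 ≤ r) (hηr : η * (1 - lamA) * r < 1)
    (hgrowth : ∀ t k, g (t + k) ≤ C * r ^ k * (1 + g t)) :
    ∃ (V : ℕ → ℝ) (p q : ℕ → unitInterval), (∀ t, 0 ≤ V t) ∧
      (∃ C', 0 ≤ C' ∧ ∀ t, V t ≤ C' * (1 + g t)) ∧
      (∀ t, ∀ a ∈ Set.Icc (0 : ℝ) 1, holdingPayoff η lam lamA cs ca g V t (p t) a ≤ V t) ∧
      (∀ t, ∀ b ∈ Set.Icc (0 : ℝ) 1, V t ≤ holdingPayoff η lam lamA cs ca g V t b (q t)) := by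
  choose p hp q hq hpq using exists_isSaddlePointOn_holdingPayoff η lam lamA cs ca g
  -- The Shapley operator: the payoff at the chosen saddle point.
  set T : (ℕ → ℝ) → ℕ → ℝ := fun V t =>
    holdingPayoff η lam lamA cs ca g V t (p V t) (q V t) with hT
  -- The two saddle values are compared at the mixed pair made of the minimizer for V' and the
  -- maximizer for V.
  have hTmono : Monotone T := fun V V' h t =>
    (hpq V t _ (hp V' t) _ (hq V t)).trans <|
      (holdingPayoff_mono hη₀.le hA hlam hl h t (hp V' t) (hq V t)).trans <|
      (hpq V' t _ (hp V' t) _ (hq V t))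
  obtain ⟨B, hB0, ⟨C', hC', hBC⟩, hB⟩ := exists_holdingPayoff_one_le hη₀ hη₁ hA hlam hl hcs hca hg
    hC hr hηr hgrowth
  have hTB : T B ≤ B := fun t =>
    (hpq B t 1 ⟨zero_le_one, le_rfl⟩ _ (hq B t)).trans (hB t _ (hq B t))
  have hT0 : 0 ≤ T 0 := fun t => by
    have h1 := reception_mem_Icc hA hlam hl (hp 0 t) (hq 0 t)
    have h2 := hg (t + 1)
    have h3 := hg 0
    have h4 := (hp 0 t).1
    have h5 : 0 ≤ 1 - q 0 t := by linarith [(hq 0 t).2]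
    have h6 : 0 ≤ 1 - p 0 t * (lam - (lam - lamA) * q 0 t) := by linarith
    have h7 := h1.1
    simp only [hT, holdingPayoff, Pi.zero_apply, mul_zero, add_zero]
    positivity
  -- Value iteration from 0 increases and stays below the supersolution B.
  have hmono : Monotone fun n : ℕ => T^[n] 0 := hTmono.monotone_iterate_of_le_map hT0
  have hle : ∀ n : ℕ, T^[n] 0 ≤ B := by
    intro n
    induction n with
    | zero => exact fun t => hB0 t
    | succ n ih =>
      rw [Function.iterate_succ_apply']
      exact (hTmono ih).trans hTB
  have hbdd : ∀ t, BddAbove (Set.range fun n : ℕ => T^[n] 0 t) := fun t =>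
    ⟨B t, by rintro _ ⟨n, rfl⟩; exact hle n t⟩
  obtain ⟨V, hV⟩ : ∃ V : ℕ → ℝ, ∀ t, V t = ⨆ n : ℕ, T^[n] 0 t := ⟨_, fun t => rfl⟩
  have hlim : ∀ t, Tendsto (fun n : ℕ => T^[n] 0 t) atTop (𝓝 (V t)) := fun t => by
    rw [hV]
    exact tendsto_atTop_ciSup (fun i j hij => hmono hij t) (hbdd t)
  have hnV : ∀ n : ℕ, T^[n] 0 ≤ V := fun n t => by
    rw [hV]
    exact le_ciSup (hbdd t) n
  have hVB : V ≤ B := fun t => le_of_tendsto' (hlim t) fun n => hle n t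
  have hfix : ∀ t, T V t = V t := by
    intro t
    refine le_antisymm ?_ ?_
    -- The excess of T V over the n-th iterate of T V is at most η times the gaps at t + 1 and at 0.
    -- Pointwise convergence therefore suffices, although the costs may be unbounded.
    · have h1 : Tendsto (fun n : ℕ => T^[n + 1] 0 t
          + (η * (V (t + 1) - T^[n] 0 (t + 1)) + η * (V 0 - T^[n] 0 0))) atTop
          (𝓝 (V t + (η * (V (t + 1) - V (t + 1)) + η * (V 0 - V 0)))) :=
        ((tendsto_add_atTop_iff_nat 1).2 (hlim t)).add
          (((tendsto_const_nhds.sub (hlim (t + 1))).const_mul η).add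
            ((tendsto_const_nhds.sub (hlim 0)).const_mul η))
      simp only [sub_self, mul_zero, add_zero] at h1
      refine ge_of_tendsto' h1 fun n => ?_
      rw [Function.iterate_succ_apply']
      set Vn := T^[n] 0
      refine (hpq V t _ (hp Vn t) _ (hq V t)).trans ?_
      refine (holdingPayoff_le_add hη₀.le hA hlam hl (hnV n) t (hp Vn t) (hq V t)).trans ?_
      gcongr
      exact hpq Vn t _ (hp Vn t) _ (hq V t)
    · refine le_of_tendsto' ((tendsto_add_atTop_iff_nat 1).2 (hlim t)) fun n => ?_
      rw [Function.iterate_succ_apply']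
      exact hTmono (hnV n) t
  refine ⟨V, fun t => ⟨p V t, hp V t⟩, fun t => ⟨q V t, hq V t⟩, fun t => hnV 0 t,
    ⟨C', hC', fun t => (hVB t).trans (hBC t)⟩, fun t a ha => ?_, fun t b hb => ?_⟩
  · exact (hpq V t _ (hp V t) _ ha).trans_eq (hfix t)
  · exact (hfix t).symm.trans_le (hpq V t _ hb _ (hq V t))

end HoldingGame

/-! ### Covariances of the steady-state Kalman filter -/

namespace GameData

variable {nx nu ny : ℕ} {D : GameData nx nu ny} {P : Matrix (Fin nx) (Fin nx) ℝ}

/-- The covariance of the innovation `C (f P) Cᵀ + R`. -/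
def innovationCov (D : GameData nx nu ny) (P : Matrix (Fin nx) (Fin nx) ℝ) :
    Matrix (Fin ny) (Fin ny) ℝ :=
  D.C * D.f P * D.Cᵀ + D.R

theorem innovationCov_posDef (hQ : D.Q.PosSemidef) (hR : D.R.PosDef) (hP : P.PosSemidef) :
    (D.innovationCov P).PosDef :=
  .posSemidef_add ((f_posSemidef hQ hP).congr_transpose D.C) hR

theorem kalmanGain_mul_innovationCov (hQ : D.Q.PosSemidef) (hR : D.R.PosDef) (hP : P.PosSemidef) :
    D.kalmanGain P * D.innovationCov P = D.f P * D.Cᵀ := by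
  rw [kalmanGain, ← innovationCov, Matrix.nonsing_inv_mul_cancel_right]
  exact (isUnit_iff_isUnit_det _).1 (innovationCov_posDef hQ hR hP).isUnit

theorem IsSteadyState.f_sub (h : D.IsSteadyState P) :
    D.f P - P = D.kalmanGain P * (D.C * D.f P) := by
  have h1 := h.2
  rw [Matrix.sub_mul, Matrix.one_mul, Matrix.mul_assoc] at h1
  exact sub_eq_iff_eq_add.2 (sub_eq_iff_eq_add'.1 h1.symm)

/-- The decrease of the error covariance in the measurement update is the covariance of the
correction: the gain times the innovation. -/
theorem IsSteadyState.f_sub_eq (hQ : D.Q.PosSemidef) (hR : D.R.PosDef) (h : D.IsSteadyState P) :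
    D.f P - P = D.kalmanGain P * D.innovationCov P * (D.kalmanGain P)ᵀ := by
  have h1 := kalmanGain_mul_innovationCov hQ hR h.1
  have h2 : D.innovationCov P * (D.kalmanGain P)ᵀ = D.C * D.f P := by
    have h3 := congrArg transpose h1
    rwa [transpose_mul, transpose_mul, transpose_transpose,
      (innovationCov_posDef hQ hR h.1).posSemidef.transpose_eq,
      (f_posSemidef hQ h.1).transpose_eq] at h3
  rw [Matrix.mul_assoc, h2, h.f_sub]

theorem IsSteadyState.f_sub_posSemidef (hQ : D.Q.PosSemidef) (hR : D.R.PosDef)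
    (h : D.IsSteadyState P) : (D.f P - P).PosSemidef := by
  rw [h.f_sub_eq hQ hR]
  exact (innovationCov_posDef hQ hR h.1).posSemidef.congr_transpose _

/-- The increments A^i (f P - P) (A^i)ᵀ are summed. In particular the matrix used in `gameLaw` for
the initial correction is a genuine covariance. -/
theorem IsSteadyState.iterate_f_sub_posSemidef (hQ : D.Q.PosSemidef) (hR : D.R.PosDef)
    (h : D.IsSteadyState P) (k : ℕ) : (D.f^[k] P - P).PosSemidef := by
  induction k with
  | zero => simpa using Matrix.PosSemidef.zero
  | succ k ih =>
    have h1 := (h.f_sub_posSemidef hQ hR).congr_transpose (D.A ^ k)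
    rw [← iterate_f_succ_sub] at h1
    simpa using h1.add ih

/-- The variance identity behind the independence of the filter's error and its innovation. -/
theorem IsSteadyState.variance_identity (hQ : D.Q.PosSemidef) (hR : D.R.PosDef)
    (h : D.IsSteadyState P) (s z : Vec nx) :
    (s + (D.kalmanGain P * D.C)ᵀ *ᵥ z) ⬝ᵥ (D.f P *ᵥ (s + (D.kalmanGain P * D.C)ᵀ *ᵥ z))
        + ((D.kalmanGain P)ᵀ *ᵥ z) ⬝ᵥ (D.R *ᵥ ((D.kalmanGain P)ᵀ *ᵥ z))
      = (s + z) ⬝ᵥ ((D.f P - P) *ᵥ (s + z)) + s ⬝ᵥ (P *ᵥ s) := by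
  have hF := (f_posSemidef hQ h.1).transpose_eq
  have hsym : (D.f P - P)ᵀ = D.f P - P := by rw [transpose_sub, hF, h.1.transpose_eq]
  -- The variance of the correction, split into the contributions of the prediction error and of the
  -- measurement noise.
  have h1 : z ⬝ᵥ ((D.f P - P) *ᵥ z)
      = ((D.kalmanGain P * D.C)ᵀ *ᵥ z) ⬝ᵥ (D.f P *ᵥ ((D.kalmanGain P * D.C)ᵀ *ᵥ z))
        + ((D.kalmanGain P)ᵀ *ᵥ z) ⬝ᵥ (D.R *ᵥ ((D.kalmanGain P)ᵀ *ᵥ z)) := by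
    rw [← quadForm_congr, ← quadForm_congr, ← dotProduct_add, ← add_mulVec, h.f_sub_eq hQ hR,
      innovationCov]
    simp only [transpose_transpose, transpose_mul, Matrix.mul_add, Matrix.add_mul,
      Matrix.mul_assoc]
  have h2 : ((D.kalmanGain P * D.C)ᵀ *ᵥ z) ⬝ᵥ (D.f P *ᵥ s) = z ⬝ᵥ ((D.f P - P) *ᵥ s) := by
    rw [← dotProduct_mulVec_transpose, mulVec_mulVec, Matrix.mul_assoc, h.f_sub]
  have h3 := dotProduct_mulVec_symm hF s ((D.kalmanGain P * D.C)ᵀ *ᵥ z)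
  have h4 := dotProduct_mulVec_symm hsym s z
  have h5 : s ⬝ᵥ ((D.f P - P) *ᵥ s) = s ⬝ᵥ (D.f P *ᵥ s) - s ⬝ᵥ (P *ᵥ s) := by
    rw [sub_mulVec, dotProduct_sub]
  simp only [mulVec_add, add_dotProduct, dotProduct_add, h1, h2, h3, h4, h5]
  ring

end GameData

/-! ### Discounted costs as integrals of nonnegative series -/

section DiscountedSums

/-- The cost of a stage with schedule `ν`, attack `a` and remaining cost `c`, normalized so that it
is the absence of an attack that costs `ca`. -/
noncomputable def stageCost (cs ca : ℝ) (c : ENNReal) (ν a : Bool) : ENNReal :=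
  c + (if ν then ENNReal.ofReal cs else 0) + (if a then 0 else ENNReal.ofReal ca)

theorem measurable_stageCost {Ω : Type*} [MeasurableSpace Ω] (cs ca : ℝ) {c : Ω → ENNReal}
    {ν a : Ω → Bool} (hc : Measurable c) (hν : Measurable ν) (ha : Measurable a) :
    Measurable fun ω => stageCost cs ca (c ω) (ν ω) (a ω) :=
  (hc.add (.ite (hν (measurableSet_singleton true)) measurable_const measurable_const)).add
    (.ite (ha (measurableSet_singleton true)) measurable_const measurable_const)

theorem lintegral_stageCost {Ω : Type*} [MeasurableSpace Ω] (μ : Measure Ω)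
    [IsProbabilityMeasure μ] {cs ca : ℝ} (hcs : 0 ≤ cs) (hca : 0 ≤ ca) {c : Ω → ENNReal}
    {ν a : Ω → Bool} (hc : Measurable c) (hν : Measurable ν) (ha : Measurable a) :
    ∫⁻ ω, stageCost cs ca (c ω) (ν ω) (a ω) ∂μ = ∫⁻ ω, c ω ∂μ
      + ENNReal.ofReal (cs * μ.real {ω | ν ω = true} + ca * (1 - μ.real {ω | a ω = true})) := by
  have hνs : MeasurableSet {ω | ν ω = true} := hν (measurableSet_singleton true)
  have has : MeasurableSet {ω | a ω = true} := ha (measurableSet_singleton true)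
  have hν' : Measurable fun ω => if ν ω then ENNReal.ofReal cs else 0 :=
    .ite hνs measurable_const measurable_const
  have hcν : Measurable fun ω => c ω + if ν ω then ENNReal.ofReal cs else 0 := hc.add hν'
  unfold stageCost
  rw [lintegral_add_left hcν, lintegral_add_left hc, add_assoc]
  congr 1
  have h1 : ∫⁻ ω, (if ν ω then ENNReal.ofReal cs else 0) ∂μ
      = ENNReal.ofReal (cs * μ.real {ω | ν ω = true}) := by
    rw [ENNReal.ofReal_mul hcs, ofReal_measureReal, ← lintegral_indicator_const hνs]
    exact lintegral_congr fun ω => by simp [Set.indicator_apply]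
  have h2 : ∫⁻ ω, (if a ω then 0 else ENNReal.ofReal ca) ∂μ
      = ENNReal.ofReal (ca * (1 - μ.real {ω | a ω = true})) := by
    rw [← probReal_compl_eq_one_sub has, ENNReal.ofReal_mul hca, ofReal_measureReal,
      ← lintegral_indicator_const has.compl]
    refine lintegral_congr fun ω => ?_
    cases h : a ω <;> simp [h]
  rw [h1, h2, ← ENNReal.ofReal_add (by positivity)]
  exact mul_nonneg hca (sub_nonneg.2 measureReal_le_one)

/-- The shift by y makes the real part nonnegative, so it can join c in `ENNReal`; the quantity
subtracted is finite, so no ∞ - ∞ arises. -/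
theorem coe_mul_coe_ennreal_add (η x y : ℝ) (hη : 0 ≤ η) (h : 0 ≤ x + y) (c : ENNReal) :
    (η : EReal) * ((c : EReal) + (x : EReal))
      = ((ENNReal.ofReal η * (c + ENNReal.ofReal (x + y)) : ENNReal) : EReal)
        + ((-(η * y) : ℝ) : EReal) := by
  rcases eq_or_ne c ⊤ with rfl | hc
  · rcases hη.eq_or_lt with rfl | hη
    · simp
    · rw [EReal.coe_ennreal_top, EReal.top_add_coe, EReal.coe_mul_top_of_pos hη, top_add,
        ENNReal.mul_top (by simpa using hη), EReal.coe_ennreal_top, EReal.top_add_coe]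
  · lift c to NNReal using hc
    rw [EReal.coe_ennreal_mul, EReal.coe_ennreal_add, EReal.coe_ennreal_ofReal,
      EReal.coe_ennreal_ofReal, max_eq_left hη, max_eq_left h]
    have : ((c : ENNReal) : EReal) = ((c : ℝ) : EReal) := rfl
    rw [this]
    norm_cast
    ring

/-- The discounted cost of a game is, up to the constant `ca / (1 - η)`, the integral of a series
with nonnegative terms. -/
theorem limsup_discounted_eq {Ω : Type*} [MeasurableSpace Ω] (μ : Measure Ω)
    [IsProbabilityMeasure μ] {η cs ca : ℝ} (hη₀ : 0 < η) (hη₁ : η < 1) (hcs : 0 ≤ cs)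
    (hca : 0 ≤ ca) {c : ℕ → Ω → ENNReal} {ν a : ℕ → Ω → Bool} (hc : ∀ k, Measurable (c k))
    (hν : ∀ k, Measurable (ν k)) (ha : ∀ k, Measurable (a k)) :
    limsup (fun K : ℕ => ∑ k ∈ Finset.range (K + 1), ((η ^ k : ℝ) : EReal) *
        (((∫⁻ ω, c k ω ∂μ : ENNReal) : EReal)
          + ((cs * μ.real {ω | ν k ω = true} - ca * μ.real {ω | a k ω = true} : ℝ) : EReal))) atTop
      = ((∫⁻ ω, ∑' k, ENNReal.ofReal (η ^ k) * stageCost cs ca (c k ω) (ν k ω) (a k ω) ∂μ :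
          ENNReal) : EReal) + ((-(ca / (1 - η)) : ℝ) : EReal) := by
  rw [lintegral_tsum fun k =>
    ((measurable_stageCost cs ca (hc k) (hν k) (ha k)).const_mul _).aemeasurable]
  -- The reward -ca a is written as ca (1 - a) - ca.
  have hterm : ∀ k : ℕ, ((η ^ k : ℝ) : EReal) * (((∫⁻ ω, c k ω ∂μ : ENNReal) : EReal)
          + ((cs * μ.real {ω | ν k ω = true} - ca * μ.real {ω | a k ω = true} : ℝ) : EReal))
      = ((∫⁻ ω, ENNReal.ofReal (η ^ k) * stageCost cs ca (c k ω) (ν k ω) (a k ω) ∂μ : ENNReal) :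
          EReal) + ((-(η ^ k * ca) : ℝ) : EReal) := by
    intro k
    have h0 : (0 : ℝ) ≤ μ.real {ω | a k ω = true} := measureReal_nonneg
    have h1 : μ.real {ω | a k ω = true} ≤ 1 := measureReal_le_one
    have h2 : (0 : ℝ) ≤ μ.real {ω | ν k ω = true} := measureReal_nonneg
    have h3 := mul_nonneg hcs h2
    have h4 := mul_nonneg hca (sub_nonneg.2 h1)
    rw [coe_mul_coe_ennreal_add _ _ ca (by positivity) (by linarith),
      lintegral_const_mul _ (measurable_stageCost cs ca (hc k) (hν k) (ha k)),
      lintegral_stageCost μ hcs hca (hc k) (hν k) (ha k)]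
    congr 5
    ring
  have hsum : ∀ K : ℕ, ∑ k ∈ Finset.range K, ((η ^ k : ℝ) : EReal) *
        (((∫⁻ ω, c k ω ∂μ : ENNReal) : EReal)
          + ((cs * μ.real {ω | ν k ω = true} - ca * μ.real {ω | a k ω = true} : ℝ) : EReal))
      = ((∑ k ∈ Finset.range K,
          ∫⁻ ω, ENNReal.ofReal (η ^ k) * stageCost cs ca (c k ω) (ν k ω) (a k ω) ∂μ : ENNReal) :
          EReal) + ((-∑ k ∈ Finset.range K, η ^ k * ca : ℝ) : EReal) := by
    intro K
    induction K with
    | zero => simp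
    | succ K ih =>
      rw [Finset.sum_range_succ, ih, hterm, Finset.sum_range_succ, Finset.sum_range_succ, neg_add,
        EReal.coe_ennreal_add, EReal.coe_add]
      abel
  simp only [hsum]
  refine Tendsto.limsup_eq ?_
  have h1 : Tendsto (fun K : ℕ => ((∑ k ∈ Finset.range (K + 1),
      ∫⁻ ω, ENNReal.ofReal (η ^ k) * stageCost cs ca (c k ω) (ν k ω) (a k ω) ∂μ : ENNReal) : EReal))
      atTop (𝓝 ((∑' k, ∫⁻ ω, ENNReal.ofReal (η ^ k) * stageCost cs ca (c k ω) (ν k ω) (a k ω) ∂μ :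
          ENNReal) : EReal)) :=
    (continuous_coe_ennreal_ereal.tendsto _).comp
      ((tendsto_add_atTop_iff_nat 1).2 (ENNReal.tendsto_nat_tsum _))
  have h2 : Tendsto (fun K : ℕ => ((-∑ k ∈ Finset.range (K + 1), η ^ k * ca : ℝ) : EReal))
      atTop (𝓝 ((-(ca / (1 - η)) : ℝ) : EReal)) := by
    refine (continuous_coe_real_ereal.tendsto _).comp (Tendsto.neg ?_)
    have h3 := ((hasSum_geometric_of_lt_one hη₀.le hη₁).mul_right ca).tendsto_sum_nat
    rw [inv_mul_eq_div] at h3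
    exact (tendsto_add_atTop_iff_nat 1).2 h3
  -- Addition is continuous at this pair because the second limit is finite.
  exact (EReal.continuousAt_add (by simp) (by simp)).tendsto.comp (h1.prodMk_nhds h2)

end DiscountedSums

/-! ### Resampling one coordinate of a product measure -/

section Resampling

/-- Replacing one coordinate of an infinite product by an independent copy. -/
theorem measurePreserving_update_infinitePi {ι : Type*} [DecidableEq ι] {X : ι → Type*}
    [∀ i, MeasurableSpace (X i)] (μ : ∀ i, Measure (X i)) [∀ i, IsProbabilityMeasure (μ i)]
    (k : ι) :
    MeasurePreserving (fun p : (∀ i, X i) × X k => Function.update p.1 k p.2)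
      ((Measure.infinitePi μ).prod (μ k)) (Measure.infinitePi μ) := by
  have hm : Measurable fun p : (∀ i, X i) × X k => Function.update p.1 k p.2 := by
    refine measurable_pi_iff.2 fun i => ?_
    by_cases hi : i = k
    · subst hi
      simpa using measurable_snd
    · simp only [Function.update_of_ne hi]
      fun_prop
  -- A product measure is determined by its values on boxes; in a box the factor at k comes from the
  -- copy and the other factors from the original.
  refine ⟨hm, Measure.eq_infinitePi _ fun s t ht => ?_⟩
  rw [Measure.map_apply hm (MeasurableSet.pi s.countable_toSet fun i _ => ht i)]
  by_cases hk : k ∈ s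
  · have h1 : (fun p : (∀ i, X i) × X k => Function.update p.1 k p.2) ⁻¹' (Set.pi s t)
        = (Set.pi (s.erase k : Finset ι) t) ×ˢ (t k) := by
      ext p
      simp only [Set.mem_preimage, Set.mem_pi, Set.mem_prod, Finset.coe_erase]
      constructor
      · intro h
        refine ⟨fun i hi => ?_, by simpa using h k hk⟩
        simpa [Function.update_of_ne hi.2] using h i hi.1
      · rintro ⟨h, h'⟩ i hi
        by_cases hik : i = k
        · subst hik; simpa using h'
        · simpa [Function.update_of_ne hik] using h i ⟨hi, hik⟩
    rw [h1, Measure.prod_prod, Measure.infinitePi_pi _ (fun i _ => ht i), Finset.prod_erase_mul _ _ hk]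
  · have h1 : (fun p : (∀ i, X i) × X k => Function.update p.1 k p.2) ⁻¹' (Set.pi s t)
        = (Set.pi s t) ×ˢ Set.univ := by
      ext p
      simp only [Set.mem_preimage, Set.mem_pi, Set.mem_prod, Set.mem_univ, and_true]
      refine forall₂_congr fun i hi => ?_
      rw [Function.update_of_ne (ne_of_mem_of_not_mem (Finset.mem_coe.1 hi) hk)]
    rw [h1, Measure.prod_prod, Measure.infinitePi_pi _ (fun i _ => ht i), measure_univ, mul_one]

/-- This plays the role of conditioning on all coordinates other than k. -/
theorem lintegral_infinitePi_update {ι : Type*} [DecidableEq ι] {X : ι → Type*}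
    [∀ i, MeasurableSpace (X i)] (μ : ∀ i, Measure (X i)) [∀ i, IsProbabilityMeasure (μ i)]
    (k : ι) {F : (∀ i, X i) → ENNReal} (hF : Measurable F) :
    ∫⁻ ω, F ω ∂Measure.infinitePi μ
      = ∫⁻ ω, ∫⁻ z, F (Function.update ω k z) ∂μ k ∂Measure.infinitePi μ := by
  have h := measurePreserving_update_infinitePi μ k
  rw [← h.lintegral_comp hF]
  exact lintegral_prod _ (hF.comp h.measurable).aemeasurable

end Resampling

/-! ### Dynamics and cost of the link game -/

section LinkDynamics

variable {nx nu ny : ℕ} {D : GameData nx nu ny}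

theorem holding_snoc (t₀ k : ℕ) (h : Fin k → Bool) (γ : Bool) :
    holding t₀ (k + 1) (Fin.snoc h γ) = if γ then 0 else holding t₀ k h + 1 := by
  simp [holding]

theorem measurable_finSnoc {α Ω : Type*} [MeasurableSpace α] [MeasurableSpace Ω] {k : ℕ}
    {u : Ω → Fin k → α} {v : Ω → α} (hu : Measurable u) (hv : Measurable v) :
    Measurable fun ω => (Fin.snoc (u ω) (v ω) : Fin (k + 1) → α) := by
  refine measurable_pi_iff.2 fun i => ?_
  induction i using Fin.lastCases with
  | last => simpa using hv
  | cast i => simpa using measurable_pi_iff.1 hu i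

theorem measurable_ctrlSeeds (k : ℕ) : Measurable fun ω : ℕ → LinkNoise => ctrlSeeds ω k := by
  unfold ctrlSeeds
  fun_prop

theorem measurable_attSeeds (k : ℕ) : Measurable fun ω : ℕ → LinkNoise => attSeeds ω k := by
  unfold attSeeds
  fun_prop

theorem measurable_received {Ω : Type*} [MeasurableSpace Ω] {c : Ω → unitInterval} {ν a : Ω → Bool}
    (hc : Measurable c) (hν : Measurable ν) (ha : Measurable a) :
    Measurable fun ω => received D (c ω) (ν ω) (a ω) := by
  have hite : Measurable fun ω => if a ω then D.lamA else D.lam :=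
    .ite (ha (measurableSet_singleton true)) measurable_const measurable_const
  have h1 : MeasurableSet {ω | (c ω : ℝ) < if a ω then D.lamA else D.lam} :=
    measurableSet_lt (measurable_subtype_coe.comp hc) hite
  refine measurable_to_bool ?_
  have h2 : (fun ω => received D (c ω) (ν ω) (a ω)) ⁻¹' {true}
      = {ω | ν ω = true} ∩ {ω | (c ω : ℝ) < if a ω then D.lamA else D.lam} := by
    ext ω
    simp [received]
  rw [h2]
  exact (hν (measurableSet_singleton true)).inter h1

theorem LinkStrategy.measurable_comp (ρ : LinkStrategy) {Ω : Type*} [MeasurableSpace Ω] {k : ℕ}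
    {h : Ω → Fin k → Bool} {s : Ω → Fin (k + 1) → unitInterval} (hh : Measurable h)
    (hs : Measurable s) : Measurable fun ω => ρ.play k (h ω) (s ω) :=
  (ρ.measurable_play k).comp (hh.prodMk hs)

theorem measurable_linkAcks (ρ σ : LinkStrategy) (k : ℕ) :
    Measurable fun ω => linkAcks D ρ σ ω k := by
  induction k with
  | zero => exact measurable_const
  | succ k ih =>
    exact measurable_finSnoc ih (measurable_received (by fun_prop)
      (ρ.measurable_comp ih (measurable_ctrlSeeds k)) (σ.measurable_comp ih (measurable_attSeeds k)))

theorem measurable_schedule (ρ σ : LinkStrategy) (k : ℕ) :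
    Measurable fun ω => ρ.play k (linkAcks D ρ σ ω k) (ctrlSeeds ω k) :=
  ρ.measurable_comp (measurable_linkAcks ρ σ k) (measurable_ctrlSeeds k)

theorem measurable_attack (ρ σ : LinkStrategy) (k : ℕ) :
    Measurable fun ω => σ.play k (linkAcks D ρ σ ω k) (attSeeds ω k) :=
  σ.measurable_comp (measurable_linkAcks ρ σ k) (measurable_attSeeds k)

theorem ctrlSeeds_congr {ω ω' : ℕ → LinkNoise} {k : ℕ} (h : ∀ i < k, ω i = ω' i) {j : ℕ}
    (hj : j < k) : ctrlSeeds ω j = ctrlSeeds ω' j :=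
  funext fun i => by rw [ctrlSeeds, ctrlSeeds, h i (by omega)]

theorem attSeeds_congr {ω ω' : ℕ → LinkNoise} {k : ℕ} (h : ∀ i < k, ω i = ω' i) {j : ℕ}
    (hj : j < k) : attSeeds ω j = attSeeds ω' j :=
  funext fun i => by rw [attSeeds, attSeeds, h i (by omega)]

theorem linkAcks_congr (ρ σ : LinkStrategy) {ω ω' : ℕ → LinkNoise} (k : ℕ)
    (h : ∀ i < k, ω i = ω' i) : linkAcks D ρ σ ω k = linkAcks D ρ σ ω' k := by
  induction k with
  | zero => rfl
  | succ k ih =>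
    simp only [linkAcks, ih fun i hi => h i (hi.trans k.lt_succ_self),
      ctrlSeeds_congr h k.lt_succ_self, attSeeds_congr h k.lt_succ_self, h k k.lt_succ_self]

/-- Decisions before stage k do not see the noise of stage k; this is the independence used when
that noise is integrated out. -/
theorem linkAcks_update (ρ σ : LinkStrategy) (ω : ℕ → LinkNoise) (k : ℕ) (z : LinkNoise) :
    linkAcks D ρ σ (Function.update ω k z) k = linkAcks D ρ σ ω k :=
  linkAcks_congr ρ σ k fun _ hi => Function.update_of_ne hi.ne _ _

theorem measurable_holding {Ω : Type*} [MeasurableSpace Ω] (t₀ : ℕ) {k : ℕ} {h : Ω → Fin k → Bool}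
    (hh : Measurable h) : Measurable fun ω => holding t₀ k (h ω) :=
  (measurable_of_countable fun h : Fin k → Bool => holding t₀ k h).comp hh

/-- The normalized cost of the complete information game in which a stage that ends with the holding
time `τ` costs `g τ`. -/
noncomputable def linkCost (D : GameData nx nu ny) (g : ℕ → ℝ) (t₀ : ℕ) (ρ σ : LinkStrategy) :
    ENNReal :=
  ∫⁻ ω, ∑' k, ENNReal.ofReal (D.eta ^ k) * stageCost D.cs D.ca
    (ENNReal.ofReal (g (holding t₀ (k + 1) (linkAcks D ρ σ ω (k + 1)))))
    (ρ.play k (linkAcks D ρ σ ω k) (ctrlSeeds ω k))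
    (σ.play k (linkAcks D ρ σ ω k) (attSeeds ω k)) ∂linkLaw

instance : IsProbabilityMeasure linkLaw := by unfold linkLaw; infer_instance

theorem reducedCost_eq (hη₀ : 0 < D.eta) (hη₁ : D.eta < 1) (hcs : 0 ≤ D.cs) (hca : 0 ≤ D.ca)
    (P S : Matrix (Fin nx) (Fin nx) ℝ) (t₀ : ℕ) (ρ σ : LinkStrategy) :
    reducedCost D P S t₀ ρ σ =
      (linkCost D (fun t => ((D.eta • (D.Aᵀ * S * D.A) + D.W - S) * D.f^[t] P).trace) t₀ ρ σ :
        EReal) + ((-(D.ca / (1 - D.eta)) : ℝ) : EReal) := by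
  refine limsup_discounted_eq linkLaw hη₀ hη₁ hcs hca (fun k => ?_)
    (fun k => measurable_schedule ρ σ k) (fun k => measurable_attack ρ σ k)
  exact (measurable_of_countable fun t : ℕ => ENNReal.ofReal
    ((D.eta • (D.Aᵀ * S * D.A) + D.W - S) * D.f^[t] P).trace).comp
    (measurable_holding t₀ (measurable_linkAcks ρ σ (k + 1)))

end LinkDynamics

/-! ### Verification: the stationary strategies guarantee the value -/

section LinkVerification

variable {nx nu ny : ℕ} {D : GameData nx nu ny} {g V : ℕ → ℝ}

/-- The uniform distribution of a seed. -/
noncomputable def uniformSeed : Measure unitInterval := volume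

instance : IsProbabilityMeasure uniformSeed := by unfold uniformSeed; infer_instance

theorem linkLaw_eq :
    linkLaw = Measure.infinitePi fun _ => uniformSeed.prod (uniformSeed.prod uniformSeed) := rfl

theorem lintegral_unitInterval_ite (r : ℝ) (h₀ : 0 ≤ r) (h₁ : r ≤ 1) (a b : ENNReal) :
    ∫⁻ c, (if (c : ℝ) < r then a else b) ∂uniformSeed
      = ENNReal.ofReal r * a + ENNReal.ofReal (1 - r) * b := by
  have h : ∀ c : unitInterval, (if (c : ℝ) < r then a else b)
      = (Set.Iio (⟨r, h₀, h₁⟩ : unitInterval)).indicator (fun _ => a) c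
        + (Set.Ici (⟨r, h₀, h₁⟩ : unitInterval)).indicator (fun _ => b) c := by
    intro c
    by_cases hc : (c : ℝ) < r
    · have h1 : c ∈ Set.Iio (⟨r, h₀, h₁⟩ : unitInterval) := hc
      have h2 : c ∉ Set.Ici (⟨r, h₀, h₁⟩ : unitInterval) := fun h => hc.not_ge h
      simp only [hc, if_true, Set.indicator_of_mem h1, Set.indicator_of_notMem h2, add_zero]
    · have h1 : c ∉ Set.Iio (⟨r, h₀, h₁⟩ : unitInterval) := hc
      have h2 : c ∈ Set.Ici (⟨r, h₀, h₁⟩ : unitInterval) := le_of_not_gt hc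
      simp only [hc, if_false, Set.indicator_of_notMem h1, Set.indicator_of_mem h2, zero_add]
  rw [lintegral_congr h, lintegral_add_left (measurable_const.indicator measurableSet_Iio),
    lintegral_indicator_const measurableSet_Iio, lintegral_indicator_const measurableSet_Ici,
    uniformSeed, unitInterval.volume_Iio, unitInterval.volume_Ici, mul_comm a, mul_comm b]

theorem lintegral_unitInterval_ite_ofReal (r : ℝ) (h₀ : 0 ≤ r) (h₁ : r ≤ 1) {a b : ℝ} (ha : 0 ≤ a)
    (hb : 0 ≤ b) :
    ∫⁻ c, ENNReal.ofReal (if (c : ℝ) < r then a else b) ∂uniformSeed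
      = ENNReal.ofReal (r * a + (1 - r) * b) := by
  simp only [apply_ite ENNReal.ofReal]
  rw [lintegral_unitInterval_ite r h₀ h₁, ← ENNReal.ofReal_mul h₀,
    ← ENNReal.ofReal_mul (sub_nonneg.2 h₁), ← ENNReal.ofReal_add (mul_nonneg h₀ ha)
      (mul_nonneg (sub_nonneg.2 h₁) hb)]

/-- The payoff of the one-stage game at the holding time `t`. -/
abbrev GameData.payoff (D : GameData nx nu ny) (g V : ℕ → ℝ) (t : ℕ) (p q : ℝ) : ℝ :=
  holdingPayoff D.eta D.lam D.lamA D.cs D.ca g V t p q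

/-- Cost of a stage plus discounted value of the next one, as a function of the channel seed. -/
noncomputable def stageValue (D : GameData nx nu ny) (g V : ℕ → ℝ) (t : ℕ) (c : unitInterval)
    (ν a : Bool) : ENNReal :=
  stageCost D.cs D.ca (ENNReal.ofReal (g (if received D c ν a then 0 else t + 1))) ν a
    + ENNReal.ofReal (D.eta * V (if received D c ν a then 0 else t + 1))

theorem stageCost_ofReal {cs ca c : ℝ} (hc : 0 ≤ c) (hcs : 0 ≤ cs) (hca : 0 ≤ ca) (ν a : Bool) :
    stageCost cs ca (ENNReal.ofReal c) ν a
      = ENNReal.ofReal (c + (if ν then cs else 0) + (if a then 0 else ca)) := by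
  unfold stageCost
  rw [ENNReal.ofReal_add (by split_ifs <;> positivity) (by split_ifs <;> positivity),
    ENNReal.ofReal_add hc (by split_ifs <;> positivity)]
  congr 2 <;> split_ifs <;> simp

theorem stageValue_eq (hη : 0 ≤ D.eta) (hcs : 0 ≤ D.cs) (hca : 0 ≤ D.ca) (hg : ∀ t, 0 ≤ g t)
    (hV : ∀ t, 0 ≤ V t) (t : ℕ) (c : unitInterval) (ν a : Bool) :
    stageValue D g V t c ν a = ENNReal.ofReal
      (if (c : ℝ) < (if ν then (if a then D.lamA else D.lam) else 0)
        then g 0 + (if ν then D.cs else 0) + (if a then 0 else D.ca) + D.eta * V 0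
        else g (t + 1) + (if ν then D.cs else 0) + (if a then 0 else D.ca)
          + D.eta * V (t + 1)) := by
  have h1 : received D c ν a = true ↔
      (c : ℝ) < (if ν then (if a then D.lamA else D.lam) else 0) := by
    cases ν
    · simpa [received] using c.2.1
    · simp [received]
  have h2 : 0 ≤ if ν then D.cs else 0 := by split_ifs <;> positivity
  have h3 : 0 ≤ if a then 0 else D.ca := by split_ifs <;> positivity
  unfold stageValue
  rw [stageCost_ofReal (hg _) hcs hca]
  simp only [h1]
  split_ifs with h
  all_goals
    rw [← ENNReal.ofReal_add]
    · have := hg 0; have := hg (t + 1); positivity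
    · exact mul_nonneg hη (hV _)

/-- With both decisions fixed only the channel seed is random, and the payoff at a corner of the
unit square results. -/
theorem lintegral_stageValue (hη : 0 ≤ D.eta) (hA : 0 ≤ D.lamA) (hlam : D.lamA ≤ D.lam)
    (hl : D.lam ≤ 1) (hcs : 0 ≤ D.cs) (hca : 0 ≤ D.ca) (hg : ∀ t, 0 ≤ g t) (hV : ∀ t, 0 ≤ V t)
    (t : ℕ) (ν a : Bool) :
    ∫⁻ c, stageValue D g V t c ν a ∂uniformSeed
      = ENNReal.ofReal (D.payoff g V t (if ν then 1 else 0) (if a then 1 else 0)) := by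
  have h2 : 0 ≤ if ν then D.cs else 0 := by split_ifs <;> positivity
  have h3 : 0 ≤ if a then 0 else D.ca := by split_ifs <;> positivity
  simp only [stageValue_eq hη hcs hca hg hV]
  rw [lintegral_unitInterval_ite_ofReal]
  · congr 1
    unfold GameData.payoff holdingPayoff
    cases ν <;> cases a <;> simp <;> ring
  · split_ifs <;> linarith
  · split_ifs <;> linarith
  · have := hg 0; have := hV 0; positivity
  · have := hg (t + 1); have := hV (t + 1); positivity

theorem measurable_stageValue {Ω : Type*} [MeasurableSpace Ω] {t : Ω → ℕ} {c : Ω → unitInterval}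
    {ν a : Ω → Bool} (ht : Measurable t) (hc : Measurable c) (hν : Measurable ν)
    (ha : Measurable a) :
    Measurable fun ω => stageValue D g V (t ω) (c ω) (ν ω) (a ω) := by
  have h1 : Measurable fun ω => if received D (c ω) (ν ω) (a ω) then 0 else t ω + 1 :=
    .ite (measurable_received hc hν ha (measurableSet_singleton true)) measurable_const
      (ht.add_const 1)
  refine (measurable_stageCost _ _ ?_ hν ha).add ?_
  · exact (measurable_of_countable fun n : ℕ => ENNReal.ofReal (g n)).comp h1
  · exact (measurable_of_countable fun n : ℕ => ENNReal.ofReal (D.eta * V n)).comp h1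

/-- The payoff is affine in the first probability, so averaging over the seed replaces the decision
by its probability. -/
theorem lintegral_payoff_left (hA : 0 ≤ D.lamA) (hlam : D.lamA ≤ D.lam) (hl : D.lam ≤ 1)
    (hcs : 0 ≤ D.cs) (hca : 0 ≤ D.ca) (hη : 0 ≤ D.eta) (hg : ∀ t, 0 ≤ g t) (hV : ∀ t, 0 ≤ V t)
    (t : ℕ) (p : unitInterval) {b : ℝ} (hb : b ∈ Set.Icc (0 : ℝ) 1) :
    ∫⁻ s, ENNReal.ofReal (D.payoff g V t (if decide (s < p) then 1 else 0) b)
        ∂uniformSeed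
      = ENNReal.ofReal (D.payoff g V t p b) := by
  have hnn : ∀ r ∈ Set.Icc (0 : ℝ) 1, 0 ≤ D.payoff g V t r b := by
    intro r hr
    have h1 := reception_mem_Icc hA hlam hl hr hb
    have h2 : 0 ≤ 1 - r * (D.lam - (D.lam - D.lamA) * b) := by linarith
    have := hg 0; have := hg (t + 1); have := hV 0; have := hV (t + 1)
    have := hr.1; have := h1.1
    have : 0 ≤ 1 - b := by linarith [hb.2]
    unfold GameData.payoff holdingPayoff
    positivity
  have h1 : ∀ s : unitInterval, D.payoff g V t (if decide (s < p) then 1 else 0) b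
      = if (s : ℝ) < p then D.payoff g V t 1 b else D.payoff g V t 0 b := by
    intro s
    by_cases h : s < p
    · have h' : (s : ℝ) < p := h
      simp [h, h']
    · have h' : ¬ (s : ℝ) < p := h
      simp [h, h']
  simp only [h1]
  rw [lintegral_unitInterval_ite_ofReal _ p.2.1 p.2.2 (hnn 1 ⟨zero_le_one, le_rfl⟩)
    (hnn 0 ⟨le_rfl, zero_le_one⟩)]
  congr 1
  unfold GameData.payoff holdingPayoff
  ring

theorem lintegral_payoff_right (hA : 0 ≤ D.lamA) (hlam : D.lamA ≤ D.lam) (hl : D.lam ≤ 1)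
    (hcs : 0 ≤ D.cs) (hca : 0 ≤ D.ca) (hη : 0 ≤ D.eta) (hg : ∀ t, 0 ≤ g t) (hV : ∀ t, 0 ≤ V t)
    (t : ℕ) {b : ℝ} (hb : b ∈ Set.Icc (0 : ℝ) 1) (q : unitInterval) :
    ∫⁻ s, ENNReal.ofReal (D.payoff g V t b (if decide (s < q) then 1 else 0))
        ∂uniformSeed
      = ENNReal.ofReal (D.payoff g V t b q) := by
  have hnn : ∀ r ∈ Set.Icc (0 : ℝ) 1, 0 ≤ D.payoff g V t b r := by
    intro r hr
    have h1 := reception_mem_Icc hA hlam hl hb hr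
    have h2 : 0 ≤ 1 - b * (D.lam - (D.lam - D.lamA) * r) := by linarith
    have := hg 0; have := hg (t + 1); have := hV 0; have := hV (t + 1)
    have := hb.1; have := h1.1
    have : 0 ≤ 1 - r := by linarith [hr.2]
    unfold GameData.payoff holdingPayoff
    positivity
  have h1 : ∀ s : unitInterval, D.payoff g V t b (if decide (s < q) then 1 else 0)
      = if (s : ℝ) < q then D.payoff g V t b 1 else D.payoff g V t b 0 := by
    intro s
    by_cases h : s < q
    · have h' : (s : ℝ) < q := h
      simp [h, h']
    · have h' : ¬ (s : ℝ) < q := h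
      simp [h, h']
  simp only [h1]
  rw [lintegral_unitInterval_ite_ofReal _ q.2.1 q.2.2 (hnn 1 ⟨zero_le_one, le_rfl⟩)
    (hnn 0 ⟨le_rfl, zero_le_one⟩)]
  congr 1
  unfold GameData.payoff holdingPayoff
  ring

/-- The seeds of a player, given the previous ones and the current one. -/
def withLast {k : ℕ} (s : Fin (k + 1) → unitInterval) (x : unitInterval) :
    Fin (k + 1) → unitInterval := Function.update s (Fin.last k) x

theorem ctrlSeeds_update (ω : ℕ → LinkNoise) (k : ℕ) (z : LinkNoise) :
    ctrlSeeds (Function.update ω k z) k = withLast (ctrlSeeds ω k) z.2.1 := by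
  funext i
  induction i using Fin.lastCases with
  | last => simp [ctrlSeeds, withLast]
  | cast i =>
    simp [ctrlSeeds, withLast, Function.update_of_ne i.2.ne]

theorem attSeeds_update (ω : ℕ → LinkNoise) (k : ℕ) (z : LinkNoise) :
    attSeeds (Function.update ω k z) k = withLast (attSeeds ω k) z.2.2 := by
  funext i
  induction i using Fin.lastCases with
  | last => simp [attSeeds, withLast]
  | cast i =>
    simp [attSeeds, withLast, Function.update_of_ne i.2.ne]

theorem measurable_withLast {k : ℕ} (s : Fin (k + 1) → unitInterval) : Measurable (withLast s) :=
  measurable_update s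

theorem stationary_play_withLast (t₀ : ℕ) (p : ℕ → unitInterval) {k : ℕ} (h : Fin k → Bool)
    (s : Fin (k + 1) → unitInterval) (x : unitInterval) :
    (stationary t₀ p).play k h (withLast s x) = decide (x < p (holding t₀ k h)) := by
  simp [stationary, withLast]

theorem lintegral_linkNoise (hη : 0 ≤ D.eta) (hA : 0 ≤ D.lamA) (hlam : D.lamA ≤ D.lam)
    (hl : D.lam ≤ 1) (hcs : 0 ≤ D.cs) (hca : 0 ≤ D.ca) (hg : ∀ t, 0 ≤ g t) (hV : ∀ t, 0 ≤ V t)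
    (t : ℕ) {ν a : unitInterval → Bool} (hν : Measurable ν) (ha : Measurable a) :
    ∫⁻ z, stageValue D g V t z.1 (ν z.2.1) (a z.2.2) ∂(uniformSeed.prod (uniformSeed.prod uniformSeed))
      = ∫⁻ s, ENNReal.ofReal
        (D.payoff g V t (if ν s.1 then 1 else 0) (if a s.2 then 1 else 0))
        ∂(uniformSeed.prod uniformSeed) := by
  have hm : Measurable fun z : LinkNoise => stageValue D g V t z.1 (ν z.2.1) (a z.2.2) :=
    measurable_stageValue measurable_const measurable_fst
      (hν.comp (measurable_fst.comp measurable_snd)) (ha.comp (measurable_snd.comp measurable_snd))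
  rw [ lintegral_prod_symm _ hm.aemeasurable]
  refine lintegral_congr fun s => ?_
  exact lintegral_stageValue hη hA hlam hl hcs hca hg hV t (ν s.1) (a s.2)

/-- The expected cost of stage `k` plus the discounted value of the next stage, after integrating
out the link noise of stage `k`. -/
theorem lintegral_stage_add_value (hη : 0 ≤ D.eta) (hA : 0 ≤ D.lamA) (hlam : D.lamA ≤ D.lam)
    (hl : D.lam ≤ 1) (hcs : 0 ≤ D.cs) (hca : 0 ≤ D.ca) (hg : ∀ t, 0 ≤ g t) (hV : ∀ t, 0 ≤ V t)
    (t₀ : ℕ) (ρ σ : LinkStrategy) (k : ℕ) :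
    ∫⁻ ω, (stageCost D.cs D.ca
        (ENNReal.ofReal (g (holding t₀ (k + 1) (linkAcks D ρ σ ω (k + 1)))))
        (ρ.play k (linkAcks D ρ σ ω k) (ctrlSeeds ω k))
        (σ.play k (linkAcks D ρ σ ω k) (attSeeds ω k))
      + ENNReal.ofReal (D.eta * V (holding t₀ (k + 1) (linkAcks D ρ σ ω (k + 1))))) ∂linkLaw
    = ∫⁻ ω, (∫⁻ s, ENNReal.ofReal
        (D.payoff g V (holding t₀ k (linkAcks D ρ σ ω k))
          (if ρ.play k (linkAcks D ρ σ ω k) (withLast (ctrlSeeds ω k) s.1) then 1 else 0)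
          (if σ.play k (linkAcks D ρ σ ω k) (withLast (attSeeds ω k) s.2) then 1 else 0))
          ∂(uniformSeed.prod uniformSeed))
        ∂linkLaw := by
  have hF : ∀ ω, (stageCost D.cs D.ca
        (ENNReal.ofReal (g (holding t₀ (k + 1) (linkAcks D ρ σ ω (k + 1)))))
        (ρ.play k (linkAcks D ρ σ ω k) (ctrlSeeds ω k))
        (σ.play k (linkAcks D ρ σ ω k) (attSeeds ω k))
      + ENNReal.ofReal (D.eta * V (holding t₀ (k + 1) (linkAcks D ρ σ ω (k + 1)))))
      = stageValue D g V (holding t₀ k (linkAcks D ρ σ ω k)) (ω k).1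
        (ρ.play k (linkAcks D ρ σ ω k) (ctrlSeeds ω k))
        (σ.play k (linkAcks D ρ σ ω k) (attSeeds ω k)) := by
    intro ω
    rw [linkAcks, holding_snoc, stageValue]
  simp only [hF]
  have hm : Measurable fun ω => stageValue D g V (holding t₀ k (linkAcks D ρ σ ω k)) (ω k).1
        (ρ.play k (linkAcks D ρ σ ω k) (ctrlSeeds ω k))
        (σ.play k (linkAcks D ρ σ ω k) (attSeeds ω k)) :=
    measurable_stageValue (measurable_holding t₀ (measurable_linkAcks ρ σ k)) (by fun_prop)
      (measurable_schedule ρ σ k) (measurable_attack ρ σ k)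
  -- The noise of stage k is resampled; the holding time and the earlier seeds stay fixed.
  rw [linkLaw_eq, lintegral_infinitePi_update _ k hm]
  refine lintegral_congr fun ω => ?_
  simp only [linkAcks_update, ctrlSeeds_update, attSeeds_update, Function.update_self]
  have hν : Measurable fun s : unitInterval =>
      ρ.play k (linkAcks D ρ σ ω k) (withLast (ctrlSeeds ω k) s) :=
    ρ.measurable_comp measurable_const (measurable_withLast _)
  have ha : Measurable fun s : unitInterval =>
      σ.play k (linkAcks D ρ σ ω k) (withLast (attSeeds ω k) s) :=
    σ.measurable_comp measurable_const (measurable_withLast _)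
  exact lintegral_linkNoise (ν := fun s => ρ.play k (linkAcks D ρ σ ω k) (withLast (ctrlSeeds ω k) s))
    (a := fun s => σ.play k (linkAcks D ρ σ ω k) (withLast (attSeeds ω k) s))
    hη hA hlam hl hcs hca hg hV (holding t₀ k (linkAcks D ρ σ ω k)) hν ha

/-- The moves are simultaneous: once the attacker's seed is fixed, the attack does not depend on the
controller's fresh seed. Averaging over the latter first yields the mixed payoff against a pure
attack, which is at most V. -/
theorem lintegral_stage_add_value_le (hη : 0 ≤ D.eta) (hA : 0 ≤ D.lamA) (hlam : D.lamA ≤ D.lam)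
    (hl : D.lam ≤ 1) (hcs : 0 ≤ D.cs) (hca : 0 ≤ D.ca) (hg : ∀ t, 0 ≤ g t) (hV : ∀ t, 0 ≤ V t)
    {p : ℕ → unitInterval}
    (hp : ∀ t, ∀ a ∈ Set.Icc (0 : ℝ) 1, D.payoff g V t (p t) a ≤ V t)
    (t₀ : ℕ) (σ : LinkStrategy) (k : ℕ) :
    ∫⁻ ω, (stageCost D.cs D.ca
        (ENNReal.ofReal (g (holding t₀ (k + 1) (linkAcks D (stationary t₀ p) σ ω (k + 1)))))
        ((stationary t₀ p).play k (linkAcks D (stationary t₀ p) σ ω k) (ctrlSeeds ω k))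
        (σ.play k (linkAcks D (stationary t₀ p) σ ω k) (attSeeds ω k))
      + ENNReal.ofReal (D.eta * V (holding t₀ (k + 1)
          (linkAcks D (stationary t₀ p) σ ω (k + 1))))) ∂linkLaw
    ≤ ∫⁻ ω, ENNReal.ofReal (V (holding t₀ k (linkAcks D (stationary t₀ p) σ ω k))) ∂linkLaw := by
  rw [lintegral_stage_add_value hη hA hlam hl hcs hca hg hV]
  refine lintegral_mono fun ω => ?_
  set h := linkAcks D (stationary t₀ p) σ ω k
  have hmem : ∀ b : Bool, (if b then (1 : ℝ) else 0) ∈ Set.Icc (0 : ℝ) 1 := by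
    intro b; cases b <;> simp
  have hm : Measurable fun s : unitInterval × unitInterval => ENNReal.ofReal
        (D.payoff g V (holding t₀ k h)
          (if (stationary t₀ p).play k h (withLast (ctrlSeeds ω k) s.1) then 1 else 0)
          (if σ.play k h (withLast (attSeeds ω k) s.2) then 1 else 0)) :=
    (measurable_of_countable fun b : Bool × Bool => ENNReal.ofReal
        (D.payoff g V (holding t₀ k h) (if b.1 then 1 else 0) (if b.2 then 1 else 0))).comp
      (((stationary t₀ p).measurable_comp measurable_const
          ((measurable_withLast _).comp measurable_fst)).prodMk
        (σ.measurable_comp measurable_const ((measurable_withLast _).comp measurable_snd)))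
  rw [lintegral_prod_symm _ hm.aemeasurable]
  have hle : ∀ s₂ : unitInterval, ∫⁻ s₁, ENNReal.ofReal
        (D.payoff g V (holding t₀ k h)
          (if (stationary t₀ p).play k h (withLast (ctrlSeeds ω k) s₁) then 1 else 0)
          (if σ.play k h (withLast (attSeeds ω k) s₂) then 1 else 0)) ∂uniformSeed
      ≤ ENNReal.ofReal (V (holding t₀ k h)) := by
    intro s₂
    simp only [stationary_play_withLast]
    rw [lintegral_payoff_left hA hlam hl hcs hca hη hg hV _ _ (hmem _)]
    exact ENNReal.ofReal_le_ofReal (hp _ _ (hmem _))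
  exact (lintegral_mono hle).trans_eq (by simp)

/-- The mirror image: the controller's seed is fixed and the attacker's is averaged first. -/
theorem le_lintegral_stage_add_value (hη : 0 ≤ D.eta) (hA : 0 ≤ D.lamA) (hlam : D.lamA ≤ D.lam)
    (hl : D.lam ≤ 1) (hcs : 0 ≤ D.cs) (hca : 0 ≤ D.ca) (hg : ∀ t, 0 ≤ g t) (hV : ∀ t, 0 ≤ V t)
    {q : ℕ → unitInterval}
    (hq : ∀ t, ∀ b ∈ Set.Icc (0 : ℝ) 1, V t ≤ D.payoff g V t b (q t))
    (t₀ : ℕ) (ρ : LinkStrategy) (k : ℕ) :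
    ∫⁻ ω, ENNReal.ofReal (V (holding t₀ k (linkAcks D ρ (stationary t₀ q) ω k))) ∂linkLaw
    ≤ ∫⁻ ω, (stageCost D.cs D.ca
        (ENNReal.ofReal (g (holding t₀ (k + 1) (linkAcks D ρ (stationary t₀ q) ω (k + 1)))))
        (ρ.play k (linkAcks D ρ (stationary t₀ q) ω k) (ctrlSeeds ω k))
        ((stationary t₀ q).play k (linkAcks D ρ (stationary t₀ q) ω k) (attSeeds ω k))
      + ENNReal.ofReal (D.eta * V (holding t₀ (k + 1)
          (linkAcks D ρ (stationary t₀ q) ω (k + 1))))) ∂linkLaw := by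
  rw [lintegral_stage_add_value hη hA hlam hl hcs hca hg hV]
  refine lintegral_mono fun ω => ?_
  set h := linkAcks D ρ (stationary t₀ q) ω k
  have hmem : ∀ b : Bool, (if b then (1 : ℝ) else 0) ∈ Set.Icc (0 : ℝ) 1 := by
    intro b; cases b <;> simp
  have hm : Measurable fun s : unitInterval × unitInterval => ENNReal.ofReal
        (D.payoff g V (holding t₀ k h)
          (if ρ.play k h (withLast (ctrlSeeds ω k) s.1) then 1 else 0)
          (if (stationary t₀ q).play k h (withLast (attSeeds ω k) s.2) then 1 else 0)) :=
    (measurable_of_countable fun b : Bool × Bool => ENNReal.ofReal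
        (D.payoff g V (holding t₀ k h) (if b.1 then 1 else 0) (if b.2 then 1 else 0))).comp
      ((ρ.measurable_comp measurable_const
          ((measurable_withLast _).comp measurable_fst)).prodMk
        ((stationary t₀ q).measurable_comp measurable_const
          ((measurable_withLast _).comp measurable_snd)))
  rw [lintegral_prod _ hm.aemeasurable]
  have hle : ∀ s₁ : unitInterval, ENNReal.ofReal (V (holding t₀ k h)) ≤
      ∫⁻ s₂, ENNReal.ofReal
        (D.payoff g V (holding t₀ k h)
          (if ρ.play k h (withLast (ctrlSeeds ω k) s₁) then 1 else 0)
          (if (stationary t₀ q).play k h (withLast (attSeeds ω k) s₂) then 1 else 0))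
        ∂uniformSeed := by
    intro s₁
    simp only [stationary_play_withLast]
    rw [lintegral_payoff_right hA hlam hl hcs hca hη hg hV _ (hmem _)]
    exact ENNReal.ofReal_le_ofReal (hq _ _ (hmem _))
  exact (by simp : _ = _).trans_le (lintegral_mono hle)

/-- The expectation of the holding-time function `V` before stage `k`. -/
noncomputable def expectedValue (D : GameData nx nu ny) (V : ℕ → ℝ) (t₀ : ℕ) (ρ σ : LinkStrategy)
    (k : ℕ) : ENNReal :=
  ∫⁻ ω, ENNReal.ofReal (V (holding t₀ k (linkAcks D ρ σ ω k))) ∂linkLaw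

/-- The expected normalized cost of stage `k`. -/
noncomputable def expectedStage (D : GameData nx nu ny) (g : ℕ → ℝ) (t₀ : ℕ) (ρ σ : LinkStrategy)
    (k : ℕ) : ENNReal :=
  ∫⁻ ω, stageCost D.cs D.ca
    (ENNReal.ofReal (g (holding t₀ (k + 1) (linkAcks D ρ σ ω (k + 1)))))
    (ρ.play k (linkAcks D ρ σ ω k) (ctrlSeeds ω k))
    (σ.play k (linkAcks D ρ σ ω k) (attSeeds ω k)) ∂linkLaw

theorem measurable_value (V : ℕ → ℝ) (t₀ : ℕ) (ρ σ : LinkStrategy) (k : ℕ) :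
    Measurable fun ω => ENNReal.ofReal (V (holding t₀ k (linkAcks D ρ σ ω k))) :=
  (measurable_of_countable fun t : ℕ => ENNReal.ofReal (V t)).comp
    (measurable_holding t₀ (measurable_linkAcks ρ σ k))

theorem measurable_stage (g : ℕ → ℝ) (t₀ : ℕ) (ρ σ : LinkStrategy) (k : ℕ) :
    Measurable fun ω => stageCost D.cs D.ca
      (ENNReal.ofReal (g (holding t₀ (k + 1) (linkAcks D ρ σ ω (k + 1)))))
      (ρ.play k (linkAcks D ρ σ ω k) (ctrlSeeds ω k))
      (σ.play k (linkAcks D ρ σ ω k) (attSeeds ω k)) :=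
  measurable_stageCost _ _ (measurable_value g t₀ ρ σ (k + 1)) (measurable_schedule ρ σ k)
    (measurable_attack ρ σ k)

theorem linkCost_eq_tsum (g : ℕ → ℝ) (t₀ : ℕ) (ρ σ : LinkStrategy) :
    linkCost D g t₀ ρ σ = ∑' k, ENNReal.ofReal (D.eta ^ k) * expectedStage D g t₀ ρ σ k := by
  unfold linkCost expectedStage
  rw [lintegral_tsum fun k => ((measurable_stage g t₀ ρ σ k).const_mul _).aemeasurable]
  exact tsum_congr fun k => lintegral_const_mul _ (measurable_stage g t₀ ρ σ k)

theorem expectedStage_add (hη : 0 ≤ D.eta) (g V : ℕ → ℝ) (t₀ : ℕ) (ρ σ : LinkStrategy) (k : ℕ) :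
    expectedStage D g t₀ ρ σ k + ENNReal.ofReal D.eta * expectedValue D V t₀ ρ σ (k + 1)
    = ∫⁻ ω, (stageCost D.cs D.ca
        (ENNReal.ofReal (g (holding t₀ (k + 1) (linkAcks D ρ σ ω (k + 1)))))
        (ρ.play k (linkAcks D ρ σ ω k) (ctrlSeeds ω k))
        (σ.play k (linkAcks D ρ σ ω k) (attSeeds ω k))
      + ENNReal.ofReal (D.eta * V (holding t₀ (k + 1) (linkAcks D ρ σ ω (k + 1))))) ∂linkLaw := by
  rw [lintegral_add_left (measurable_stage g t₀ ρ σ k), expectedStage, expectedValue,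
    ← lintegral_const_mul _ (measurable_value V t₀ ρ σ (k + 1))]
  simp only [ENNReal.ofReal_mul hη]

theorem expectedValue_zero (V : ℕ → ℝ) (t₀ : ℕ) (ρ σ : LinkStrategy) :
    expectedValue D V t₀ ρ σ 0 = ENNReal.ofReal (V t₀) := by
  simp [expectedValue, holding]

/-- The stationary schedule `p` guarantees the value. -/
theorem linkCost_stationary_le (hη : 0 ≤ D.eta) (hA : 0 ≤ D.lamA) (hlam : D.lamA ≤ D.lam)
    (hl : D.lam ≤ 1) (hcs : 0 ≤ D.cs) (hca : 0 ≤ D.ca) (hg : ∀ t, 0 ≤ g t) (hV : ∀ t, 0 ≤ V t)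
    {p : ℕ → unitInterval}
    (hp : ∀ t, ∀ a ∈ Set.Icc (0 : ℝ) 1, D.payoff g V t (p t) a ≤ V t)
    (t₀ : ℕ) (σ : LinkStrategy) :
    linkCost D g t₀ (stationary t₀ p) σ ≤ ENNReal.ofReal (V t₀) := by
  -- The expected cost so far plus the discounted value ahead does not increase with K; at K = 0 it
  -- is V t₀.
  have hsum : ∀ K : ℕ, ∑ k ∈ Finset.range K,
        ENNReal.ofReal (D.eta ^ k) * expectedStage D g t₀ (stationary t₀ p) σ k
      + ENNReal.ofReal (D.eta ^ K) * expectedValue D V t₀ (stationary t₀ p) σ K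
      ≤ ENNReal.ofReal (V t₀) := by
    intro K
    induction K with
    | zero => simp [expectedValue_zero]
    | succ K ih =>
      refine le_trans ?_ ih
      rw [Finset.sum_range_succ, add_assoc, pow_succ, ENNReal.ofReal_mul (pow_nonneg hη K),
        mul_assoc, ← mul_add, expectedStage_add hη]
      gcongr
      exact lintegral_stage_add_value_le hη hA hlam hl hcs hca hg hV hp t₀ σ K
  rw [linkCost_eq_tsum]
  exact ENNReal.tsum_le_of_sum_range_le fun K => le_self_add.trans (hsum K)

/-- The stationary attack `q` guarantees the value. -/
theorem le_linkCost_stationary (hη : 0 ≤ D.eta) (hη₁ : D.eta < 1) (hA : 0 ≤ D.lamA)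
    (hlam : D.lamA ≤ D.lam)
    (hl : D.lam ≤ 1) (hcs : 0 ≤ D.cs) (hca : 0 ≤ D.ca) (hg : ∀ t, 0 ≤ g t) (hV : ∀ t, 0 ≤ V t)
    {C : ℝ} (hC : 0 ≤ C) (hVg : ∀ t, V t ≤ C * (1 + g t)) {q : ℕ → unitInterval}
    (hq : ∀ t, ∀ b ∈ Set.Icc (0 : ℝ) 1, V t ≤ D.payoff g V t b (q t))
    (t₀ : ℕ) (ρ : LinkStrategy) :
    ENNReal.ofReal (V t₀) ≤ linkCost D g t₀ ρ (stationary t₀ q) := by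
  set σ := stationary t₀ q with hσ
  have hsum : ∀ K : ℕ, ENNReal.ofReal (V t₀) ≤
      ∑ k ∈ Finset.range K, ENNReal.ofReal (D.eta ^ k) * expectedStage D g t₀ ρ σ k
      + ENNReal.ofReal (D.eta ^ K) * expectedValue D V t₀ ρ σ K := by
    intro K
    induction K with
    | zero => simp [expectedValue_zero]
    | succ K ih =>
      refine ih.trans ?_
      rw [Finset.sum_range_succ, add_assoc, pow_succ, ENNReal.ofReal_mul (pow_nonneg hη K),
        mul_assoc, ← mul_add, expectedStage_add hη]
      gcongr
      exact le_lintegral_stage_add_value hη hA hlam hl hcs hca hg hV hq t₀ ρ K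
  rw [linkCost_eq_tsum]
  -- If the cost is finite, its terms tend to 0, and this forces the discounted value ahead to
  -- vanish.
  by_cases htop : ∑' k, ENNReal.ofReal (D.eta ^ k) * expectedStage D g t₀ ρ σ k = ⊤
  · rw [htop]; exact le_top
  have hterm := ENNReal.tendsto_atTop_zero_of_tsum_ne_top htop
  -- The cost g of the holding time before stage K + 1 is part of the cost of stage K. With V ≤ C (1
  -- + g) this bounds the value by a term of the series, after weakening η^(K+1) to η^K.
  have hvalue : ∀ K : ℕ, ENNReal.ofReal (D.eta ^ (K + 1)) * expectedValue D V t₀ ρ σ (K + 1)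
      ≤ ENNReal.ofReal C * (ENNReal.ofReal (D.eta ^ (K + 1))
        + ENNReal.ofReal (D.eta ^ K) * expectedStage D g t₀ ρ σ K) := by
    intro K
    have h1 : expectedValue D V t₀ ρ σ (K + 1)
        ≤ ENNReal.ofReal C * (1 + expectedStage D g t₀ ρ σ K) := by
      have h2 : (1 : ENNReal) = ∫⁻ _, 1 ∂linkLaw := by simp
      rw [h2, expectedStage, ← lintegral_add_left measurable_const,
        ← lintegral_const_mul _ ((measurable_stage g t₀ ρ σ K).const_add 1)]
      refine lintegral_mono fun ω => ?_
      refine (ENNReal.ofReal_le_ofReal (hVg _)).trans ?_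
      rw [ENNReal.ofReal_mul hC, ENNReal.ofReal_add zero_le_one (hg _), ENNReal.ofReal_one]
      gcongr
      unfold stageCost
      rw [add_assoc]
      exact le_self_add
    calc ENNReal.ofReal (D.eta ^ (K + 1)) * expectedValue D V t₀ ρ σ (K + 1)
        ≤ ENNReal.ofReal (D.eta ^ (K + 1))
          * (ENNReal.ofReal C * (1 + expectedStage D g t₀ ρ σ K)) := by gcongr
      _ = ENNReal.ofReal C * (ENNReal.ofReal (D.eta ^ (K + 1))
        + ENNReal.ofReal (D.eta ^ (K + 1)) * expectedStage D g t₀ ρ σ K) := by ring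
      _ ≤ _ := by
        gcongr ENNReal.ofReal C * (_ + ENNReal.ofReal ?_ * _)
        exact pow_le_pow_of_le_one hη hη₁.le K.le_succ
  have hpow : Tendsto (fun K : ℕ => ENNReal.ofReal (D.eta ^ (K + 1))) atTop (𝓝 0) := by
    rw [← ENNReal.ofReal_zero]
    exact ENNReal.tendsto_ofReal
      ((tendsto_add_atTop_iff_nat 1).2 (tendsto_pow_atTop_nhds_zero_of_lt_one hη hη₁))
  have hlim : Tendsto (fun K : ℕ => ∑' k, ENNReal.ofReal (D.eta ^ k) * expectedStage D g t₀ ρ σ k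
      + ENNReal.ofReal C * (ENNReal.ofReal (D.eta ^ (K + 1))
        + ENNReal.ofReal (D.eta ^ K) * expectedStage D g t₀ ρ σ K)) atTop
      (𝓝 (∑' k, ENNReal.ofReal (D.eta ^ k) * expectedStage D g t₀ ρ σ k
        + ENNReal.ofReal C * (0 + 0))) :=
    tendsto_const_nhds.add (ENNReal.Tendsto.const_mul (hpow.add hterm) (.inr ENNReal.ofReal_ne_top))
  rw [add_zero, mul_zero, add_zero] at hlim
  refine ge_of_tendsto' hlim fun K => (hsum (K + 1)).trans ?_
  exact add_le_add (ENNReal.sum_le_tsum _) (hvalue K)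

end LinkVerification

/-! ### Moments and characteristic functions of Gaussian vectors -/

section GaussianVectors

variable {n : ℕ} {M : Matrix (Fin n) (Fin n) ℝ}

theorem integral_gaussianVec {E : Type*} [NormedAddCommGroup E] [NormedSpace ℝ E] (f : Vec n → E) :
    ∫ v, f v ∂gaussianVec M = ∫ v, f (WithLp.ofLp v) ∂multivariateGaussian 0 M :=
  integral_map_equiv (MeasurableEquiv.toLp 2 (Fin n → ℝ)).symm f

theorem memLp_gaussianVec (M : Matrix (Fin n) (Fin n) ℝ) (i : Fin n) :
    MemLp (fun v : Vec n => v i) 2 (gaussianVec M) := by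
  refine (memLp_map_measure_iff (g := fun v : Vec n => v i)
    (measurable_pi_apply i).aestronglyMeasurable (by fun_prop)).2 ?_
  exact IsGaussian.memLp_dual (multivariateGaussian 0 M) (EuclideanSpace.proj i) 2 (by simp)

theorem integral_eval_gaussianVec (M : Matrix (Fin n) (Fin n) ℝ) (i : Fin n) :
    ∫ v, v i ∂gaussianVec M = 0 := by
  rw [integral_gaussianVec]
  have h := ContinuousLinearMap.integral_comp_id_comm (μ := multivariateGaussian 0 M)
    (IsGaussian.integrable_id) (EuclideanSpace.proj i : EuclideanSpace ℝ (Fin n) →L[ℝ] ℝ)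
  simpa using h

theorem integral_mul_gaussianVec (hM : M.PosSemidef) (i j : Fin n) :
    ∫ v, v i * v j ∂gaussianVec M = M i j := by
  have h := covariance_eval_multivariateGaussian (μ := 0) hM i j
  have hL : ∀ i, MemLp (fun x : EuclideanSpace ℝ (Fin n) => x i) 2 (multivariateGaussian 0 M) :=
    fun i => IsGaussian.memLp_dual _ (EuclideanSpace.proj i : EuclideanSpace ℝ (Fin n) →L[ℝ] ℝ) 2 (by simp)
  have h0 : ∀ i, ∫ x : EuclideanSpace ℝ (Fin n), x i ∂multivariateGaussian 0 M = 0 := fun i => by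
    have := integral_eval_gaussianVec M i
    rwa [integral_gaussianVec] at this
  rw [covariance_eq_sub (hL i) (hL j), h0, h0, mul_zero, sub_zero] at h
  rw [integral_gaussianVec]
  exact h

theorem dual_eq_dotProduct (L : StrongDual ℝ (Vec n)) (v : Vec n) :
    L v = v ⬝ᵥ fun i => L (Pi.single i 1) := by
  conv_lhs => rw [pi_eq_sum_univ' v]
  simp only [map_sum, map_smul, smul_eq_mul, dotProduct]

theorem charFunDual_gaussianVec (hM : M.PosSemidef) (L : StrongDual ℝ (Vec n)) (l : Vec n)
    (hl : ∀ v, L v = v ⬝ᵥ l) :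
    charFunDual (gaussianVec M) L = Complex.exp (-((l ⬝ᵥ (M *ᵥ l) : ℝ) : ℂ) / 2) := by
  have h := charFun_multivariateGaussian (μ := 0) hM (WithLp.toLp 2 l)
  rw [charFun_apply] at h
  rw [charFunDual_apply, integral_gaussianVec]
  simp only [inner_zero_right, Complex.ofReal_zero, zero_mul, zero_sub] at h
  rw [neg_div]
  rw [← h]
  refine integral_congr_ae (Eventually.of_forall fun v => ?_)
  simp [hl, EuclideanSpace.inner_eq_star_dotProduct, dotProduct_comm]

end GaussianVectors

/-! ### Independence of the filter's correction and its next error -/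

namespace GameData

variable {nx nu ny : ℕ} {D : GameData nx nu ny} {P : Matrix (Fin nx) (Fin nx) ℝ}

/-- The correction made by the filter, for the error `e` and the noises `w` and `v`. -/
noncomputable def correction (D : GameData nx nu ny) (P : Matrix (Fin nx) (Fin nx) ℝ) (e w : Vec nx)
    (v : Vec ny) : Vec nx :=
  D.kalmanGain P *ᵥ (D.C *ᵥ (D.A *ᵥ e + w) + v)

/-- The correction of the filter and its next error, as a linear map of the present error and the
noises. -/
noncomputable def filterMap (D : GameData nx nu ny) (P : Matrix (Fin nx) (Fin nx) ℝ) :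
    Vec nx × Vec nx × Vec ny →ₗ[ℝ] Vec nx × Vec nx where
  toFun z := (D.correction P z.1 z.2.1 z.2.2,
    D.A *ᵥ z.1 + z.2.1 - D.correction P z.1 z.2.1 z.2.2)
  map_add' z z' := by
    simp only [correction, Prod.fst_add, Prod.snd_add, mulVec_add, Prod.mk_add_mk, Prod.mk.injEq]
    constructor <;> abel
  map_smul' c z := by
    simp only [correction, Prod.smul_fst, Prod.smul_snd, mulVec_smul, RingHom.id_apply,
      mulVec_add, Prod.smul_mk, smul_sub, smul_add]

/-- In steady state, the correction of the filter and its next error are independent. -/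
theorem IsSteadyState.map_filterMap (hQ : D.Q.PosSemidef) (hR : D.R.PosDef)
    (h : D.IsSteadyState P) :
    ((gaussianVec P).prod ((gaussianVec D.Q).prod (gaussianVec D.R))).map (D.filterMap P)
      = (gaussianVec (D.f P - P)).prod (gaussianVec P) := by
  set Ψ := LinearMap.toContinuousLinearMap (D.filterMap P)
  have hmap : ((gaussianVec P).prod ((gaussianVec D.Q).prod (gaussianVec D.R))).map (D.filterMap P)
      = ((gaussianVec P).prod ((gaussianVec D.Q).prod (gaussianVec D.R))).map Ψ := rfl
  rw [hmap]
  have : IsProbabilityMeasure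
      (((gaussianVec P).prod ((gaussianVec D.Q).prod (gaussianVec D.R))).map Ψ) :=
    Measure.isProbabilityMeasure_map (by fun_prop)
  refine Measure.ext_of_charFunDual ?_
  funext L
  set t : Vec nx := fun i => L (Pi.single i 1, 0) with ht
  set s : Vec nx := fun i => L (0, Pi.single i 1) with hs
  have hL : ∀ x y, L (x, y) = x ⬝ᵥ t + y ⬝ᵥ s := by
    intro x y
    have h1 := dual_eq_dotProduct (L.comp (.inl ℝ _ _)) x
    have h2 := dual_eq_dotProduct (L.comp (.inr ℝ _ _)) y
    simp only [ContinuousLinearMap.comp_apply, ContinuousLinearMap.inl_apply,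
      ContinuousLinearMap.inr_apply] at h1 h2
    rw [ht, hs, ← h1, ← h2, ← map_add]
    simp
  set K := D.kalmanGain P
  -- The weights t and s act on the correction d = K (C (A e + w) + v) and on the next error A e + w
  -- - d. The functional equals c · (A e + w) + (t - s) · K v, which defines c.
  set c : Vec nx := s + (K * D.C)ᵀ *ᵥ (t - s) with hc
  have hdot : ∀ e w v, L (Ψ (e, w, v))
      = e ⬝ᵥ (D.Aᵀ *ᵥ c) + (w ⬝ᵥ c + v ⬝ᵥ (Kᵀ *ᵥ (t - s))) := by
    intro e w v
    have h1 : Ψ (e, w, v) = (D.correction P e w v, D.A *ᵥ e + w - D.correction P e w v) := rfl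
    rw [h1, hL, hc]
    have h2 : ∀ {a b : ℕ} (X : Matrix (Fin a) (Fin b) ℝ) (y : Vec b) (z : Vec a),
        y ⬝ᵥ (Xᵀ *ᵥ z) = (X *ᵥ y) ⬝ᵥ z := by
      intro a b X y z
      rw [dotProduct_mulVec_transpose, transpose_transpose]
    rw [h2, dotProduct_add, dotProduct_add, h2, h2, h2, ← mulVec_mulVec, ← mulVec_mulVec]
    simp only [correction, mulVec_add, dotProduct_sub, add_dotProduct, sub_dotProduct]
    ring
  rw [charFunDual_map, charFunDual_prod, charFunDual_prod, charFunDual_prod,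
    charFunDual_gaussianVec h.1 _ (D.Aᵀ *ᵥ c), charFunDual_gaussianVec hQ _ c,
    charFunDual_gaussianVec hR.posSemidef _ (Kᵀ *ᵥ (t - s)),
    charFunDual_gaussianVec (h.f_sub_posSemidef hQ hR) _ t, charFunDual_gaussianVec h.1 _ s,
    ← Complex.exp_add, ← Complex.exp_add, ← Complex.exp_add]
  · congr 1
    -- Both laws are centred Gaussians, so the variances decide. The identity for z = t - s has no
    -- term mixing s and t, which is the independence.
    have h1 := h.variance_identity hQ hR s (t - s)
    rw [add_sub_cancel, ← hc] at h1
    have h2 : c ⬝ᵥ (D.f P *ᵥ c) = (D.Aᵀ *ᵥ c) ⬝ᵥ (P *ᵥ (D.Aᵀ *ᵥ c)) + c ⬝ᵥ (D.Q *ᵥ c) := by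
      rw [f, add_mulVec, dotProduct_add, ← quadForm_congr, transpose_transpose]
    rw [h2] at h1
    have h3 := congrArg (fun r : ℝ => (r : ℂ)) h1
    simp only [Complex.ofReal_add] at h3
    linear_combination (-1 / 2 : ℂ) * h3
  · intro v
    simpa using hL 0 v
  · intro v
    simpa using hL v 0
  · intro v
    have := hdot 0 0 v
    simp only [zero_dotProduct, zero_add] at this
    exact this
  · intro v
    have := hdot 0 v 0
    simp only [zero_dotProduct, zero_add, add_zero] at this
    exact this
  · intro v
    have := hdot v 0 0
    simp only [zero_dotProduct, add_zero] at this
    exact this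

end GameData

/-! ### Calculus of resampling maps -/

section Resamples

/-- `Θ` replaces a part of the sample `ω` by an independent copy with the law `ν`. -/
structure Resamples {Ω X : Type*} [MeasurableSpace Ω] [MeasurableSpace X] (μ : Measure Ω)
    (ν : Measure X) (Θ : Ω → X → Ω) : Prop where
  measurable : Measurable fun p : Ω × X => Θ p.1 p.2
  lintegral_eq : ∀ F : Ω → ENNReal, Measurable F → ∫⁻ ω, ∫⁻ x, F (Θ ω x) ∂ν ∂μ = ∫⁻ ω, F ω ∂μ

variable {Ω Ω' X Y : Type*} [MeasurableSpace Ω] [MeasurableSpace Ω'] [MeasurableSpace X]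
  [MeasurableSpace Y] {μ : Measure Ω} {μ' : Measure Ω'} {ν : Measure X} {ν' : Measure Y}

theorem resamples_snd (μ : Measure Ω) [IsProbabilityMeasure μ] : Resamples μ μ fun _ x => x :=
  ⟨measurable_snd, fun F _ => by simp⟩

theorem Resamples.prod_left [SFinite μ] [SFinite μ'] [SFinite ν] {Θ : Ω → X → Ω}
    (h : Resamples μ ν Θ) :
    Resamples (μ.prod μ') ν fun (ω : Ω × Ω') x => (Θ ω.1 x, ω.2) := by
  have hm : Measurable fun p : (Ω × Ω') × X => (Θ p.1.1 p.2, p.1.2) :=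
    (h.measurable.comp ((measurable_fst.comp measurable_fst).prodMk measurable_snd)).prodMk
      (measurable_snd.comp measurable_fst)
  refine ⟨hm, fun F hF => ?_⟩
  have h1 : Measurable fun p : (Ω × Ω') × X => F (Θ p.1.1 p.2, p.1.2) := hF.comp hm
  rw [lintegral_prod_symm _ h1.lintegral_prod_right'.aemeasurable,
    lintegral_prod_symm _ hF.aemeasurable]
  refine lintegral_congr fun ω' => ?_
  exact h.lintegral_eq (fun ω => F (ω, ω')) (hF.comp measurable_prodMk_right)

theorem Resamples.prod_right [SFinite μ] [SFinite μ'] [SFinite ν] {Θ : Ω → X → Ω}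
    (h : Resamples μ ν Θ) :
    Resamples (μ'.prod μ) ν fun (ω : Ω' × Ω) x => (ω.1, Θ ω.2 x) := by
  have hm : Measurable fun p : (Ω' × Ω) × X => (p.1.1, Θ p.1.2 p.2) :=
    (measurable_fst.comp measurable_fst).prodMk
      (h.measurable.comp ((measurable_snd.comp measurable_fst).prodMk measurable_snd))
  refine ⟨hm, fun F hF => ?_⟩
  have h1 : Measurable fun p : (Ω' × Ω) × X => F (p.1.1, Θ p.1.2 p.2) := hF.comp hm
  rw [lintegral_prod _ h1.lintegral_prod_right'.aemeasurable, lintegral_prod _ hF.aemeasurable]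
  refine lintegral_congr fun ω' => ?_
  exact h.lintegral_eq (fun ω => F (ω', ω)) (hF.comp measurable_prodMk_left)

/-- Used for noises w_k and v_(k+1), which sit in different coordinates of the noise sequence. -/
theorem Resamples.comp [SFinite ν] [SFinite ν'] [SFinite μ] {Θ : Ω → X → Ω} {Θ' : Ω → Y → Ω}
    (h : Resamples μ ν Θ) (h' : Resamples μ ν' Θ') :
    Resamples μ (ν.prod ν') fun ω z => Θ' (Θ ω z.1) z.2 := by
  have hm : Measurable fun p : Ω × X × Y => Θ' (Θ p.1 p.2.1) p.2.2 :=
    h'.measurable.comp ((h.measurable.comp (measurable_fst.prodMk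
      (measurable_fst.comp measurable_snd))).prodMk (measurable_snd.comp measurable_snd))
  refine ⟨hm, fun F hF => ?_⟩
  have h1 : Measurable fun ω => ∫⁻ y, F (Θ' ω y) ∂ν' :=
    (hF.comp h'.measurable).lintegral_prod_right'
  rw [← h'.lintegral_eq F hF, ← h.lintegral_eq (fun ω => ∫⁻ y, F (Θ' ω y) ∂ν') h1]
  refine lintegral_congr fun ω => ?_
  have h2 : Measurable fun z : X × Y => F (Θ' (Θ ω z.1) z.2) :=
    (hF.comp hm).comp measurable_prodMk_left
  exact lintegral_prod _ h2.aemeasurable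

/-- Resampling the whole coordinate k on both sides reduces the claim to that coordinate. -/
theorem Resamples.infinitePi {ι : Type*} [DecidableEq ι] {Z : ι → Type*}
    [∀ i, MeasurableSpace (Z i)] {μ : ∀ i, Measure (Z i)} [∀ i, IsProbabilityMeasure (μ i)]
    [SFinite ν] {k : ι} {Θ : Z k → X → Z k} (h : Resamples (μ k) ν Θ) :
    Resamples (Measure.infinitePi μ) ν fun ω x => Function.update ω k (Θ (ω k) x) := by
  have hu : Measurable fun p : (∀ i, Z i) × Z k => Function.update p.1 k p.2 :=
    (measurePreserving_update_infinitePi μ k).measurable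
  have hm : Measurable fun p : (∀ i, Z i) × X => Function.update p.1 k (Θ (p.1 k) p.2) :=
    hu.comp (measurable_fst.prodMk (h.measurable.comp
      (((measurable_pi_apply k).comp measurable_fst).prodMk measurable_snd)))
  refine ⟨hm, fun F hF => ?_⟩
  have h1 : Measurable fun ω => ∫⁻ x, F (Function.update ω k (Θ (ω k) x)) ∂ν :=
    (hF.comp hm).lintegral_prod_right'
  rw [lintegral_infinitePi_update μ k h1, lintegral_infinitePi_update μ k hF]
  refine lintegral_congr fun ω => ?_
  simp only [Function.update_self, Function.update_idem]
  exact h.lintegral_eq (fun z => F (Function.update ω k z))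
    (hF.comp (hu.comp measurable_prodMk_left))

end Resamples

/-! ### Gaussian integrals of quadratic forms -/

section GaussianIntegrals

variable {m n : ℕ}

/-- A linear image of a Gaussian vector plus an independent Gaussian vector. -/
theorem map_mulVec_add_gaussianVec {M : Matrix (Fin n) (Fin n) ℝ} {N : Matrix (Fin m) (Fin m) ℝ}
    (hM : M.PosSemidef) (hN : N.PosSemidef) (L : Matrix (Fin m) (Fin n) ℝ) :
    ((gaussianVec M).prod (gaussianVec N)).map (fun z => L *ᵥ z.1 + z.2)
      = gaussianVec (L * M * Lᵀ + N) := by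
  set Ψ : Vec n × Vec m →L[ℝ] Vec m := LinearMap.toContinuousLinearMap
    (L.mulVecLin.comp (.fst ℝ _ _) + .snd ℝ _ _)
  have hΨ : ∀ z, Ψ z = L *ᵥ z.1 + z.2 := fun z => rfl
  have hmap : ((gaussianVec M).prod (gaussianVec N)).map (fun z => L *ᵥ z.1 + z.2)
      = ((gaussianVec M).prod (gaussianVec N)).map Ψ := rfl
  rw [hmap]
  have : IsProbabilityMeasure (((gaussianVec M).prod (gaussianVec N)).map Ψ) :=
    Measure.isProbabilityMeasure_map (by fun_prop)
  refine Measure.ext_of_charFunDual ?_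
  funext l
  set c : Vec m := fun i => l (Pi.single i 1) with hc
  have hl : ∀ v, l v = v ⬝ᵥ c := fun v => dual_eq_dotProduct l v
  have hdot : ∀ y d, l (Ψ (y, d)) = y ⬝ᵥ (Lᵀ *ᵥ c) + d ⬝ᵥ c := by
    intro y d
    rw [hΨ, hl, add_dotProduct, dotProduct_mulVec_transpose, transpose_transpose]
  rw [charFunDual_map, charFunDual_prod, charFunDual_gaussianVec hM _ (Lᵀ *ᵥ c),
    charFunDual_gaussianVec hN _ c,
    charFunDual_gaussianVec ((hM.congr_transpose L).add hN) _ c hl, ← Complex.exp_add]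
  · congr 1
    rw [add_mulVec, dotProduct_add, ← quadForm_congr, transpose_transpose]
    push_cast
    ring
  · intro v
    have := hdot 0 v
    simp only [zero_dotProduct, zero_add] at this
    exact this
  · intro v
    have := hdot v 0
    simp only [zero_dotProduct, add_zero] at this
    exact this

theorem measurable_const_mulVec {Ω : Type*} [MeasurableSpace Ω] (L : Matrix (Fin m) (Fin n) ℝ)
    {v : Ω → Vec n} (hv : Measurable v) : Measurable fun ω => L *ᵥ v ω :=
  (Continuous.matrix_mulVec continuous_const continuous_id).measurable.comp hv

theorem lintegral_gaussianVec_add {M : Matrix (Fin n) (Fin n) ℝ} {N : Matrix (Fin m) (Fin m) ℝ}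
    (hM : M.PosSemidef) (hN : N.PosSemidef) (L : Matrix (Fin m) (Fin n) ℝ) {F : Vec m → ENNReal}
    (hF : Measurable F) :
    ∫⁻ y, ∫⁻ d, F (L *ᵥ y + d) ∂gaussianVec N ∂gaussianVec M
      = ∫⁻ y, F y ∂gaussianVec (L * M * Lᵀ + N) := by
  have hm : Measurable fun z : Vec n × Vec m => L *ᵥ z.1 + z.2 :=
    (measurable_const_mulVec L measurable_fst).add measurable_snd
  have h1 : Measurable fun z : Vec n × Vec m => F (L *ᵥ z.1 + z.2) := hF.comp hm
  rw [← map_mulVec_add_gaussianVec hM hN L, lintegral_map hF hm, lintegral_prod _ h1.aemeasurable]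

theorem measurable_quadForm {Ω : Type*} [MeasurableSpace Ω] (T : Matrix (Fin n) (Fin n) ℝ)
    {v : Ω → Vec n} (hv : Measurable v) : Measurable fun ω => v ω ⬝ᵥ (T *ᵥ v ω) :=
  (show Continuous fun x : Vec n => x ⬝ᵥ (T *ᵥ x) by fun_prop).measurable.comp hv

/-- In the expanded square the linear term is centred, and the quadratic term integrates to a trace
against the covariance. -/
theorem lintegral_quadForm_gaussianVec {T : Matrix (Fin m) (Fin m) ℝ}
    {M : Matrix (Fin n) (Fin n) ℝ} (hT : T.PosSemidef) (hM : M.PosSemidef) (a : Vec m)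
    (L : Matrix (Fin m) (Fin n) ℝ) :
    ∫⁻ y, ENNReal.ofReal ((a + L *ᵥ y) ⬝ᵥ (T *ᵥ (a + L *ᵥ y))) ∂gaussianVec M
      = ENNReal.ofReal (a ⬝ᵥ (T *ᵥ a)) + ENNReal.ofReal (Lᵀ * T * L * M).trace := by
  set N := Lᵀ * T * L with hN
  have hNp : N.PosSemidef := hT.transpose_congr L
  set b : Vec n := Lᵀ *ᵥ (T *ᵥ a)
  have hexp : ∀ y : Vec n, (a + L *ᵥ y) ⬝ᵥ (T *ᵥ (a + L *ᵥ y))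
      = a ⬝ᵥ (T *ᵥ a) + 2 * ∑ i, b i * y i + ∑ i, ∑ j, N i j * (y i * y j) := by
    intro y
    have h1 : a ⬝ᵥ (T *ᵥ (L *ᵥ y)) = ∑ i, b i * y i := by
      rw [dotProduct_mulVec_transpose, hT.transpose_eq, dotProduct_mulVec_transpose]
      rfl
    have h2 : (L *ᵥ y) ⬝ᵥ (T *ᵥ a) = ∑ i, b i * y i := by
      rw [dotProduct_mulVec_symm hT.transpose_eq, h1]
    have h3 : (L *ᵥ y) ⬝ᵥ (T *ᵥ (L *ᵥ y)) = ∑ i, ∑ j, N i j * (y i * y j) := by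
      rw [← quadForm_congr]
      simp only [dotProduct, mulVec, Finset.mul_sum]
      exact Finset.sum_congr rfl fun i _ => Finset.sum_congr rfl fun j _ => by
        rw [hN]; ring
    rw [mulVec_add, add_dotProduct, dotProduct_add, dotProduct_add, h1, h2, h3]
    ring
  have hi : ∀ i, Integrable (fun y : Vec n => y i) (gaussianVec M) := fun i =>
    (memLp_gaussianVec M i).integrable one_le_two
  have hij : ∀ i j, Integrable (fun y : Vec n => y i * y j) (gaussianVec M) := fun i j =>
    (memLp_gaussianVec M i).integrable_mul (memLp_gaussianVec M j)
  have hI1 : Integrable (fun y : Vec n => a ⬝ᵥ (T *ᵥ a) + 2 * ∑ i, b i * y i) (gaussianVec M) :=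
    (integrable_const _).add ((integrable_finsetSum _ fun i _ => (hi i).const_mul _).const_mul _)
  have hI2 : Integrable (fun y : Vec n => ∑ i, ∑ j, N i j * (y i * y j)) (gaussianVec M) :=
    integrable_finsetSum _ fun i _ => integrable_finsetSum _ fun j _ => (hij i j).const_mul _
  have hI3 : ∫ y : Vec n, ∑ i, ∑ j, N i j * (y i * y j) ∂gaussianVec M
      = ∑ i, ∑ j, N i j * M i j := by
    rw [integral_finsetSum Finset.univ
      (f := fun i (y : Vec n) => ∑ j, N i j * (y i * y j))
      fun i _ => integrable_finsetSum _ fun j _ => (hij i j).const_mul _]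
    refine Finset.sum_congr rfl fun i _ => ?_
    rw [integral_finsetSum _ fun j _ => (hij i j).const_mul _]
    refine Finset.sum_congr rfl fun j _ => ?_
    rw [integral_const_mul, integral_mul_gaussianVec hM]
  have hint : Integrable (fun y : Vec n => (a + L *ᵥ y) ⬝ᵥ (T *ᵥ (a + L *ᵥ y)))
      (gaussianVec M) := by
    simp only [hexp]
    exact hI1.add hI2
  rw [← ofReal_integral_eq_lintegral_ofReal hint
    (Eventually.of_forall fun y => hT.quadForm_nonneg _), ← ENNReal.ofReal_add
    (hT.quadForm_nonneg _) (hNp.trace_mul_nonneg hM)]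
  congr 1
  simp only [hexp]
  rw [integral_add hI1 hI2, integral_add (integrable_const _)
    ((integrable_finsetSum _ fun i _ => (hi i).const_mul _).const_mul _), integral_const_mul,
    integral_finsetSum _ fun i _ => (hi i).const_mul _, hI3]
  simp only [integral_const_mul, integral_eval_gaussianVec, mul_zero, Finset.sum_const_zero,
    add_zero, integral_const, probReal_univ, one_smul, trace, diag_apply, mul_apply]
  congr 1
  refine Finset.sum_congr rfl fun i _ => Finset.sum_congr rfl fun j _ => ?_
  have h4 : M i j = M j i := congrFun (congrFun hM.transpose_eq j) i
  rw [h4]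

end GaussianIntegrals

/-! ### Histories and the evolution of the sensor's filter -/

/-- What the controller knows at the start of stage `k` about the plant, together with the seeds of
all the stages. -/
abbrev History (nx k : ℕ) := Vec nx × (Fin k → CtrlObs nx) × (ℕ → LinkNoise)

section Histories

variable {nx nu ny k : ℕ} (D : GameData nx nu ny) (P : Matrix (Fin nx) (Fin nx) ℝ)
  (π : ControllerStrategy nx nu) (σ : LinkStrategy)

/-- The transmission command of stage `k`. -/
def schedules (h : History nx k) : Bool := π.1.sched k h.2.1 h.1 (ctrlSeeds h.2.2 k)

/-- The attack of stage `k`. -/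
def attacks (h : History nx k) : Bool := σ.play k (acks h.2.1) (attSeeds h.2.2 k)

/-- The reception indicator of stage `k`. -/
noncomputable def receives (h : History nx k) : Bool :=
  received D (h.2.2 k).1 (schedules π h) (attacks σ h)

/-- The observation of stage `k` when the sensor's estimate is `xs`. -/
noncomputable def observe (xs : Vec nx) (h : History nx k) : CtrlObs nx :=
  (h.1, schedules π h, receives D π σ h, if receives D π σ h then xs else 0)

/-- The observations up to stage `k`. -/
noncomputable def observations (xs : Vec nx) (h : History nx k) : Fin (k + 1) → CtrlObs nx :=
  Fin.snoc h.2.1 (observe D π σ xs h)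

/-- The control input of stage `k`. -/
noncomputable def inputFor (xs : Vec nx) (h : History nx k) : Vec nu :=
  π.2.control k (observations D π σ xs h) (ctrlSeeds h.2.2 k)

/-- The history of the next stage. -/
noncomputable def nextHistory (xs : Vec nx) (h : History nx k) : History nx (k + 1) :=
  (D.A *ᵥ estimate (observe D π σ xs h) + D.B *ᵥ inputFor D π σ xs h, observations D π σ xs h, h.2.2)

/-- The history at the start of stage `k` in the sample `ω`. -/
noncomputable def history (ω : Sample nx ny) (k : ℕ) : History nx k :=
  ((situation D P π σ ω k).xbar, (situation D P π σ ω k).obs, ω.2.2)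

variable {D P π σ}

theorem inputAt_eq_inputFor (ω : Sample nx ny) (k : ℕ) :
    inputAt D π σ ω (situation D P π σ ω k)
      = inputFor D π σ (situation D P π σ ω k).xs (history D P π σ ω k) := rfl

/-- Without a reception the last slot is 0 and nothing about the sensor's estimate is revealed. This
is why a missing packet leaves the conditional law of that estimate intact. -/
theorem observe_eq_of_not_receives {h : History nx k} (hr : receives D π σ h = false)
    (xs : Vec nx) : observe D π σ xs h = observe D π σ 0 h := by
  simp [observe, hr]

theorem observations_eq_of_not_receives {h : History nx k} (hr : receives D π σ h = false)
    (xs : Vec nx) : observations D π σ xs h = observations D π σ 0 h := by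
  rw [observations, observe_eq_of_not_receives hr, observations]

theorem nextHistory_eq_of_not_receives {h : History nx k} (hr : receives D π σ h = false)
    (xs : Vec nx) : nextHistory D π σ xs h = nextHistory D π σ 0 h := by
  rw [nextHistory, inputFor, observe_eq_of_not_receives hr, observations_eq_of_not_receives hr, nextHistory,
    inputFor]

theorem estimate_observe (xs : Vec nx) (h : History nx k) :
    estimate (observe D π σ xs h) = if receives D π σ h then xs else h.1 := by
  by_cases hr : receives D π σ h = true <;> simp [observe, estimate, hr]

theorem holding_observations (t₀ : ℕ) (xs : Vec nx) (h : History nx k) :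
    holding t₀ (k + 1) (acks (observations D π σ xs h))
      = if receives D π σ h then 0 else holding t₀ k (acks h.2.1) + 1 := by
  have : acks (observations D π σ xs h) = Fin.snoc (acks h.2.1) (receives D π σ h) := by
    funext i
    induction i using Fin.lastCases with
    | last => simp [acks, observations, observe]
    | cast i => simp [acks, observations]
  rw [this, holding_snoc]

theorem measurable_acks : Measurable fun obs : Fin k → CtrlObs nx => acks obs := by
  unfold acks
  fun_prop

theorem measurable_estimate : Measurable (estimate : CtrlObs nx → Vec nx) := by
  unfold estimate
  refine Measurable.ite ?_ (by fun_prop) (by fun_prop)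
  exact (measurable_fst.comp (measurable_snd.comp measurable_snd)) (measurableSet_singleton true)

theorem measurable_schedules : Measurable fun h : History nx k => schedules π h :=
  (π.1.measurable_sched k).comp ((measurable_fst.comp measurable_snd).prodMk
    (measurable_fst.prodMk ((measurable_ctrlSeeds k).comp (measurable_snd.comp measurable_snd))))

theorem measurable_attacks : Measurable fun h : History nx k => attacks σ h :=
  σ.measurable_comp (measurable_acks.comp (measurable_fst.comp measurable_snd))
    ((measurable_attSeeds k).comp (measurable_snd.comp measurable_snd))

theorem measurable_receives : Measurable fun h : History nx k => receives D π σ h :=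
  measurable_received (measurable_fst.comp ((measurable_pi_apply k).comp
    (measurable_snd.comp measurable_snd))) measurable_schedules measurable_attacks

theorem measurableSet_receives : MeasurableSet {h : History nx k | receives D π σ h = true} :=
  measurable_receives (measurableSet_singleton true)

theorem measurable_observe :
    Measurable fun z : Vec nx × History nx k => observe D π σ z.1 z.2 := by
  refine (measurable_fst.comp measurable_snd).prodMk
    ((measurable_schedules.comp measurable_snd).prodMk
    ((measurable_receives.comp measurable_snd).prodMk ?_))
  exact .ite (measurable_snd measurableSet_receives) measurable_fst measurable_const

theorem measurable_observations :
    Measurable fun z : Vec nx × History nx k => observations D π σ z.1 z.2 :=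
  measurable_finSnoc (measurable_fst.comp (measurable_snd.comp measurable_snd)) measurable_observe

theorem measurable_inputFor :
    Measurable fun z : Vec nx × History nx k => inputFor D π σ z.1 z.2 :=
  (π.2.measurable_control k).comp (measurable_observations.prodMk
    ((measurable_ctrlSeeds k).comp (measurable_snd.comp (measurable_snd.comp measurable_snd))))

theorem measurable_nextHistory :
    Measurable fun z : Vec nx × History nx k => nextHistory D π σ z.1 z.2 :=
  ((measurable_const_mulVec _ (measurable_estimate.comp measurable_observe)).add
    (measurable_const_mulVec _ measurable_inputFor)).prodMk
    (measurable_observations.prodMk (measurable_snd.comp (measurable_snd.comp measurable_snd)))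

theorem measurable_comp_nextHistory {Ω : Type*} [MeasurableSpace Ω] {xs : Ω → Vec nx}
    {h : Ω → History nx k} (hxs : Measurable xs) (hh : Measurable h) :
    Measurable fun ω => nextHistory D π σ (xs ω) (h ω) := by
  have := Measurable.comp (measurable_nextHistory (D := D) (π := π) (σ := σ) (k := k))
    (hxs.prodMk hh)
  exact this

theorem situation_zero_xs_sub (ω : Sample nx ny) :
    (situation D P π σ ω 0).xs - (situation D P π σ ω 0).xbar = ω.1.2.1 :=
  add_sub_cancel_left _ _

/-- The sensor's estimation error. -/
noncomputable def sensorError (D : GameData nx nu ny) (P : Matrix (Fin nx) (Fin nx) ℝ)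
    (π : ControllerStrategy nx nu) (σ : LinkStrategy) (ω : Sample nx ny) (k : ℕ) : Vec nx :=
  (situation D P π σ ω k).x - (situation D P π σ ω k).xs

theorem situation_succ_xs (ω : Sample nx ny) (k : ℕ) :
    (situation D P π σ ω (k + 1)).xs = D.A *ᵥ (situation D P π σ ω k).xs
      + D.B *ᵥ inputFor D π σ (situation D P π σ ω k).xs (history D P π σ ω k)
      + (D.filterMap P (sensorError D P π σ ω k, (ω.2.1 k).1, (ω.2.1 (k + 1)).2)).1 := by
  change _ + D.kalmanGain P *ᵥ (D.C *ᵥ (_ + _ + _) + _ - D.C *ᵥ _) = _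
  rw [inputAt_eq_inputFor]
  refine congrArg₂ _ rfl ?_
  change _ = D.kalmanGain P *ᵥ (D.C *ᵥ (D.A *ᵥ sensorError D P π σ ω k + _) + _)
  simp only [sensorError, mulVec_add, mulVec_sub]
  abel

/-- The input enters plant and filter alike and cancels, so the recursion of the sensor's error does
not involve the strategies. -/
theorem sensorError_succ (ω : Sample nx ny) (k : ℕ) :
    sensorError D P π σ ω (k + 1)
      = (D.filterMap P (sensorError D P π σ ω k, (ω.2.1 k).1, (ω.2.1 (k + 1)).2)).2 := by
  rw [sensorError, situation_succ_xs]
  change D.A *ᵥ _ + D.B *ᵥ inputAt D π σ ω (situation D P π σ ω k) + _ - _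
    = D.A *ᵥ sensorError D P π σ ω k + _ - (D.filterMap P _).1
  rw [inputAt_eq_inputFor, sensorError, mulVec_sub]
  abel

theorem measurable_situation (k : ℕ) : Measurable fun ω : Sample nx ny =>
    ((situation D P π σ ω k).x, (situation D P π σ ω k).xs, history D P π σ ω k) := by
  induction k with
  | zero =>
    refine Measurable.prodMk ?_ (.prodMk ?_ (.prodMk ?_ (.prodMk measurable_const ?_)))
    all_goals
      try change Measurable fun ω : Sample nx ny => ω.1.1 + ω.1.2.1 + ω.1.2.2
      fun_prop
  | succ k ih =>
    have hx := measurable_fst.comp ih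
    have hz : Measurable fun ω : Sample nx ny =>
      ((situation D P π σ ω k).xs, history D P π σ ω k) := measurable_snd.comp ih
    have hxs := measurable_fst.comp hz
    have hu := measurable_inputFor (D := D) (π := π) (σ := σ).comp hz
    have hw : Measurable fun ω : Sample nx ny => (ω.2.1 k).1 := by fun_prop
    have hv : Measurable fun ω : Sample nx ny => (ω.2.1 (k + 1)).2 := by fun_prop
    have hx' := ((measurable_const_mulVec D.A hx).add (measurable_const_mulVec D.B hu)).add hw
    have he : Measurable fun ω : Sample nx ny => sensorError D P π σ ω k := hx.sub hxs
    have hd : Measurable fun ω : Sample nx ny =>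
        (D.filterMap P (sensorError D P π σ ω k, (ω.2.1 k).1, (ω.2.1 (k + 1)).2)).1 :=
      measurable_fst.comp ((LinearMap.continuous_of_finiteDimensional (D.filterMap P)).measurable.comp
        (he.prodMk (hw.prodMk hv)))
    have hxs' : Measurable fun ω : Sample nx ny => (situation D P π σ ω (k + 1)).xs := by
      simp only [situation_succ_xs]
      exact ((measurable_const_mulVec D.A hxs).add (measurable_const_mulVec D.B hu)).add hd
    have hh : Measurable fun ω : Sample nx ny => history D P π σ ω (k + 1) := by
      have h := measurable_comp_nextHistory (D := D) (π := π) (σ := σ) hz.fst hz.snd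
      exact h
    exact hx'.prodMk (hxs'.prodMk hh)

theorem measurable_view (k : ℕ) : Measurable fun ω : Sample nx ny =>
    ((situation D P π σ ω k).xs, history D P π σ ω k) :=
  measurable_snd.comp (measurable_situation k)

theorem measurable_history (k : ℕ) : Measurable fun ω : Sample nx ny => history D P π σ ω k :=
  measurable_snd.comp (measurable_view k)

theorem measurable_state (k : ℕ) :
    Measurable fun ω : Sample nx ny => (situation D P π σ ω k).x :=
  measurable_fst.comp (measurable_situation k)

theorem measurable_sensorError (k : ℕ) :
    Measurable fun ω : Sample nx ny => sensorError D P π σ ω k :=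
  (measurable_state k).sub (measurable_fst.comp (measurable_view k))

/-- The situation at stage `k` depends only on the plant noises of the earlier stages. -/
theorem situation_congr {ω ω' : Sample nx ny} (h₁ : ω.1 = ω'.1) (h₂ : ω.2.2 = ω'.2.2) (k : ℕ)
    (hw : ∀ j < k, (ω.2.1 j).1 = (ω'.2.1 j).1)
    (hv : ∀ j < k, (ω.2.1 (j + 1)).2 = (ω'.2.1 (j + 1)).2) :
    situation D P π σ ω k = situation D P π σ ω' k := by
  induction k with
  | zero => simp only [situation, h₁]
  | succ k ih =>
    have ih := ih (fun j hj => hw j (hj.trans k.lt_succ_self))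
      (fun j hj => hv j (hj.trans k.lt_succ_self))
    have ho : ∀ s : Situation nx k, observationAt D π σ ω s = observationAt D π σ ω' s := fun s => by
      unfold observationAt commandAt attackAt
      rw [h₂]
    have hu : ∀ s : Situation nx k, inputAt D π σ ω s = inputAt D π σ ω' s := fun s => by
      unfold inputAt
      rw [h₂, ho]
    rw [situation, situation, ih]
    simp only [ho, hu, hw k k.lt_succ_self, hv k k.lt_succ_self]

end Histories

/-- V is exactly the resampled part and Z does not see it, so V has law ν and is independent of Z.
Independence and conditional laws below are stated in this form, as a joint integral that equals an
iterated one. -/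
theorem Resamples.lintegral_comp_eq {Ω Ω' X : Type*} [MeasurableSpace Ω] [MeasurableSpace Ω']
    [MeasurableSpace X] {μ : Measure Ω} {ν : Measure X} {Θ : Ω → X → Ω} (h : Resamples μ ν Θ)
    {Z : Ω → Ω'} (hZ : Measurable Z) (hZΘ : ∀ ω x, Z (Θ ω x) = Z ω) {V : Ω → X} (hV : Measurable V)
    (hVΘ : ∀ ω x, V (Θ ω x) = x) {F : Ω' × X → ENNReal} (hF : Measurable F) :
    ∫⁻ ω, F (Z ω, V ω) ∂μ = ∫⁻ ω, ∫⁻ x, F (Z ω, x) ∂ν ∂μ := by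
  have h1 : Measurable fun ω => F (Z ω, V ω) := hF.comp (hZ.prodMk hV)
  rw [← h.lintegral_eq (fun ω => F (Z ω, V ω)) h1]
  simp only [hZΘ, hVΘ]

/-! ### The sensor's error is independent of everything observed -/

section Filtering

variable {nx nu ny : ℕ} {D : GameData nx nu ny} {P Sig : Matrix (Fin nx) (Fin nx) ℝ} {t₀ : ℕ}
  {π : ControllerStrategy nx nu} {σ : LinkStrategy}

theorem resamples_initError : Resamples (gameLaw D P Sig t₀) (gaussianVec P)
    fun ω e => ((ω.1.1, ω.1.2.1, e), ω.2) :=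
  (resamples_snd (gaussianVec P)).prod_right.prod_right.prod_left

theorem resamples_initCorrection : Resamples (gameLaw D P Sig t₀) (gaussianVec (D.f^[t₀ + 1] P - P))
    fun ω y => ((ω.1.1, y, ω.1.2.2), ω.2) :=
  (resamples_snd (gaussianVec (D.f^[t₀ + 1] P - P))).prod_left.prod_right.prod_left

/-- Replace the noises `w_k` and `v_{k+1}`. -/
def replaceNoise (k : ℕ) (ω : Sample nx ny) (z : Vec nx × Vec ny) : Sample nx ny :=
  (ω.1, Function.update (Function.update ω.2.1 k (z.1, (ω.2.1 k).2)) (k + 1)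
    ((Function.update ω.2.1 k (z.1, (ω.2.1 k).2) (k + 1)).1, z.2), ω.2.2)

/-- The filter's step from stage k to k + 1 is driven by w_k and v_(k+1), so these are replaced
together. -/
theorem resamples_replaceNoise (k : ℕ) :
    Resamples (gameLaw D P Sig t₀) ((gaussianVec D.Q).prod (gaussianVec D.R)) (replaceNoise k) := by
  have h1 : Resamples (gameLaw D P Sig t₀) (gaussianVec D.Q)
      fun ω w => (ω.1, Function.update ω.2.1 k (w, (ω.2.1 k).2), ω.2.2) :=
    (Resamples.prod_left (Resamples.infinitePi (k := k)
      (μ := fun _ : ℕ => (gaussianVec D.Q).prod (gaussianVec D.R))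
      (resamples_snd (gaussianVec D.Q)).prod_left)).prod_right
  have h2 : Resamples (gameLaw D P Sig t₀) (gaussianVec D.R)
      fun ω v => (ω.1, Function.update ω.2.1 (k + 1) ((ω.2.1 (k + 1)).1, v), ω.2.2) :=
    (Resamples.prod_left (Resamples.infinitePi (k := k + 1)
      (μ := fun _ : ℕ => (gaussianVec D.Q).prod (gaussianVec D.R))
      (resamples_snd (gaussianVec D.R)).prod_right)).prod_right
  have : IsProbabilityMeasure (gameLaw D P Sig t₀) := by unfold gameLaw; infer_instance
  exact h1.comp h2

instance : IsProbabilityMeasure (gameLaw D P Sig t₀) := by unfold gameLaw; infer_instance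

theorem situation_replaceNoise (k : ℕ) (ω : Sample nx ny) (z : Vec nx × Vec ny) :
    situation D P π σ (replaceNoise k ω z) k = situation D P π σ ω k := by
  refine situation_congr (ω := replaceNoise k ω z) (ω' := ω) rfl rfl k (fun j hj => ?_) (fun j hj => ?_)
  · have h1 : j ≠ k := by omega
    have h2 : j ≠ k + 1 := by omega
    simp [replaceNoise, h1, h2]
  · have h2 : j + 1 ≠ k + 1 := by omega
    simp only [replaceNoise, Function.update_of_ne h2]
    -- v_k shares its coordinate with the replaced w_k but keeps its value.
    by_cases h1 : j + 1 = k
    · rw [h1, Function.update_self]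
    · rw [Function.update_of_ne h1]

/-- The sensor's estimate and the history at the start of stage `k`. -/
noncomputable def view (D : GameData nx nu ny) (P : Matrix (Fin nx) (Fin nx) ℝ)
    (π : ControllerStrategy nx nu) (σ : LinkStrategy) (ω : Sample nx ny) (k : ℕ) :
    Vec nx × History nx k :=
  ((situation D P π σ ω k).xs, history D P π σ ω k)

/-- The correction that the sensor's filter makes after stage `k`, and its next error. -/
noncomputable def filterStep (D : GameData nx nu ny) (P : Matrix (Fin nx) (Fin nx) ℝ)
    (π : ControllerStrategy nx nu) (σ : LinkStrategy) (ω : Sample nx ny) (k : ℕ) :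
    Vec nx × Vec nx :=
  D.filterMap P (sensorError D P π σ ω k, (ω.2.1 k).1, (ω.2.1 (k + 1)).2)

theorem measurable_filterMap : Measurable (D.filterMap P) :=
  (LinearMap.continuous_of_finiteDimensional (D.filterMap P)).measurable

theorem lintegral_filterMap (hQ : D.Q.PosSemidef) (hR : D.R.PosDef) (hP : D.IsSteadyState P)
    {F : Vec nx × Vec nx → ENNReal} (hF : Measurable F) :
    ∫⁻ e, ∫⁻ x, F (D.filterMap P (e, x)) ∂((gaussianVec D.Q).prod (gaussianVec D.R)) ∂gaussianVec P
      = ∫⁻ z, F z ∂((gaussianVec (D.f P - P)).prod (gaussianVec P)) := by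
  have h1 : Measurable fun z => F (D.filterMap P z) := hF.comp measurable_filterMap
  rw [← hP.map_filterMap hQ hR, lintegral_map hF measurable_filterMap,
    lintegral_prod _ h1.aemeasurable]

/-- The present error is N(0, P) and independent of the view, the noises are fresh, and `filterMap`
turns their joint law into a product. The independence is a hypothesis here because the lemma serves
in the induction that proves it. -/
theorem lintegral_view_filterStep_of (hQ : D.Q.PosSemidef) (hR : D.R.PosDef)
    (hP : D.IsSteadyState P) (k : ℕ)
    (h : ∀ F : (Vec nx × History nx k) × Vec nx → ENNReal, Measurable F →
      ∫⁻ ω, F (view D P π σ ω k, sensorError D P π σ ω k) ∂(gameLaw D P Sig t₀)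
        = ∫⁻ ω, ∫⁻ e, F (view D P π σ ω k, e) ∂gaussianVec P ∂(gameLaw D P Sig t₀))
    {F : (Vec nx × History nx k) × Vec nx × Vec nx → ENNReal} (hF : Measurable F) :
    ∫⁻ ω, F (view D P π σ ω k, filterStep D P π σ ω k) ∂(gameLaw D P Sig t₀)
      = ∫⁻ ω, ∫⁻ z, F (view D P π σ ω k, z) ∂((gaussianVec (D.f P - P)).prod (gaussianVec P))
        ∂(gameLaw D P Sig t₀) := by
  have hview : Measurable fun ω : Sample nx ny => view D P π σ ω k := measurable_view k
  have hZ : Measurable fun ω : Sample nx ny => (view D P π σ ω k, sensorError D P π σ ω k) :=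
    hview.prodMk (measurable_sensorError k)
  have hV : Measurable fun ω : Sample nx ny => ((ω.2.1 k).1, (ω.2.1 (k + 1)).2) := by fun_prop
  have hG : Measurable fun p : ((Vec nx × History nx k) × Vec nx) × Vec nx × Vec ny =>
      F (p.1.1, D.filterMap P (p.1.2, p.2)) :=
    hF.comp ((measurable_fst.comp measurable_fst).prodMk (measurable_filterMap.comp
      ((measurable_snd.comp measurable_fst).prodMk measurable_snd)))
  have h1 := (resamples_replaceNoise (D := D) (P := P) (Sig := Sig) (t₀ := t₀) k).lintegral_comp_eq
    hZ (fun ω z => by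
      simp only [view, history, sensorError, situation_replaceNoise]
      rfl) hV (fun ω z => by
      simp [replaceNoise]) hG
  have h2 := h (fun p => ∫⁻ x, F (p.1, D.filterMap P (p.2, x))
    ∂((gaussianVec D.Q).prod (gaussianVec D.R))) hG.lintegral_prod_right'
  refine (h1.trans h2).trans (lintegral_congr fun ω => ?_)
  exact lintegral_filterMap hQ hR hP (F := fun z => F (view D P π σ ω k, z))
    (hF.comp measurable_prodMk_left)

/-- The view of the next stage, when the filter makes the correction `d`. -/
noncomputable def nextView (D : GameData nx nu ny) (π : ControllerStrategy nx nu) (σ : LinkStrategy)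
    {k : ℕ} (z : Vec nx × History nx k) (d : Vec nx) : Vec nx × History nx (k + 1) :=
  (D.A *ᵥ z.1 + D.B *ᵥ inputFor D π σ z.1 z.2 + d, nextHistory D π σ z.1 z.2)

theorem view_succ (ω : Sample nx ny) (k : ℕ) :
    view D P π σ ω (k + 1)
      = nextView D π σ (view D P π σ ω k) (filterStep D P π σ ω k).1 := by
  rw [view, situation_succ_xs]
  rfl

theorem measurable_nextView {k : ℕ} :
    Measurable fun p : (Vec nx × History nx k) × Vec nx => nextView D π σ p.1 p.2 := by
  have h0 : Measurable fun p : (Vec nx × History nx k) × Vec nx => p.1 := measurable_fst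
  have h1 := Measurable.comp (measurable_inputFor (D := D) (π := π) (σ := σ) (k := k)) h0
  have h2 := Measurable.comp (measurable_nextHistory (D := D) (π := π) (σ := σ) (k := k)) h0
  have h3 : Measurable fun p : (Vec nx × History nx k) × Vec nx => p.1.1 :=
    measurable_fst.comp measurable_fst
  have h4 := ((measurable_const_mulVec D.A h3).add (measurable_const_mulVec D.B h1)).add
    measurable_snd
  exact h4.prodMk h2

/-- The sensor's error is independent of its estimate, of the controller's history and of the
link. -/
theorem lintegral_view_sensorError (hQ : D.Q.PosSemidef) (hR : D.R.PosDef)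
    (hP : D.IsSteadyState P) (k : ℕ)
    {F : (Vec nx × History nx k) × Vec nx → ENNReal} (hF : Measurable F) :
    ∫⁻ ω, F (view D P π σ ω k, sensorError D P π σ ω k) ∂(gameLaw D P Sig t₀)
      = ∫⁻ ω, ∫⁻ e, F (view D P π σ ω k, e) ∂gaussianVec P ∂(gameLaw D P Sig t₀) := by
  induction k with
  | zero =>
    have hview : Measurable fun ω : Sample nx ny => view D P π σ ω 0 := measurable_view 0
    exact resamples_initError.lintegral_comp_eq hview (fun ω z => rfl) (measurable_sensorError 0)
      (fun ω z => add_sub_cancel_left _ _) hF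
  | succ k ih =>
    have hG : Measurable fun p : (Vec nx × History nx k) × Vec nx × Vec nx =>
        F (nextView D π σ p.1 p.2.1, p.2.2) := by
      have h1 := Measurable.comp (measurable_nextView (D := D) (π := π) (σ := σ) (k := k))
        (measurable_fst.prodMk measurable_snd.fst : Measurable
          fun p : (Vec nx × History nx k) × Vec nx × Vec nx => (p.1, p.2.1))
      have h2 : Measurable fun p : (Vec nx × History nx k) × Vec nx × Vec nx => p.2.2 :=
        measurable_snd.comp measurable_snd
      have h3 := Measurable.comp hF (h1.prodMk h2)
      exact h3
    have hE : Measurable fun z : Vec nx × History nx (k + 1) => ∫⁻ e, F (z, e) ∂gaussianVec P :=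
      hF.lintegral_prod_right'
    have hE' : Measurable fun p : (Vec nx × History nx k) × Vec nx × Vec nx =>
        ∫⁻ e, F (nextView D π σ p.1 p.2.1, e) ∂gaussianVec P := by
      have h1 := Measurable.comp (measurable_nextView (D := D) (π := π) (σ := σ) (k := k))
        (measurable_fst.prodMk measurable_snd.fst : Measurable
          fun p : (Vec nx × History nx k) × Vec nx × Vec nx => (p.1, p.2.1))
      have h2 := Measurable.comp hE h1
      exact h2
    -- The same law is applied twice: to F at the actual next error, and to F already averaged over
    -- an error. Under the product law both give the same inner integral.
    have h1 := lintegral_view_filterStep_of hQ hR hP k (fun F hF => ih hF) hG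
    have h2 := lintegral_view_filterStep_of hQ hR hP k (fun F hF => ih hF) hE'
    have h3 : ∀ ω, sensorError D P π σ ω (k + 1) = (filterStep D P π σ ω k).2 :=
      fun ω => sensorError_succ ω k
    simp only [view_succ, h3]
    refine (h1.trans ?_).trans h2.symm
    refine lintegral_congr fun ω => ?_
    have h4 : Measurable fun z : Vec nx × Vec nx =>
        F (nextView D π σ (view D P π σ ω k) z.1, z.2) := by
      have := Measurable.comp hG (measurable_prodMk_left (x := view D P π σ ω k))
      exact this
    have h5 : Measurable fun z : Vec nx × Vec nx =>
        ∫⁻ e, F (nextView D π σ (view D P π σ ω k) z.1, e) ∂gaussianVec P := by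
      have := Measurable.comp hE' (measurable_prodMk_left (x := view D P π σ ω k))
      exact this
    rw [lintegral_prod _ h4.aemeasurable, lintegral_prod _ h5.aemeasurable]
    simp

end Filtering

/-! ### Conditional law of the controller's estimation error -/

section EstimationError

variable {nx nu ny k : ℕ} {D : GameData nx nu ny} {P Sig : Matrix (Fin nx) (Fin nx) ℝ} {t₀ : ℕ}
  {π : ControllerStrategy nx nu} {σ : LinkStrategy}

/-- The difference between the sensor's estimate and the controller's prediction. -/
def predictionGap (z : Vec nx × History nx k) : Vec nx := z.1 - z.2.1

/-- The holding time at the start of stage `k`. -/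
def historyHolding (t₀ : ℕ) (h : History nx k) : ℕ := holding t₀ k (acks h.2.1)

theorem historyHolding_nextHistory (xs : Vec nx) (h : History nx k) :
    historyHolding t₀ (nextHistory D π σ xs h)
      = if receives D π σ h then 0 else historyHolding t₀ h + 1 :=
  holding_observations t₀ xs h

theorem measurable_predictionGap : Measurable (predictionGap : Vec nx × History nx k → Vec nx) :=
  measurable_fst.sub (measurable_fst.comp measurable_snd)

theorem lintegral_view_correction (hQ : D.Q.PosSemidef) (hR : D.R.PosDef)
    (hP : D.IsSteadyState P) (k : ℕ) {F : (Vec nx × History nx k) × Vec nx → ENNReal}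
    (hF : Measurable F) :
    ∫⁻ ω, F (view D P π σ ω k, (filterStep D P π σ ω k).1) ∂(gameLaw D P Sig t₀)
      = ∫⁻ ω, ∫⁻ d, F (view D P π σ ω k, d) ∂gaussianVec (D.f P - P) ∂(gameLaw D P Sig t₀) := by
  have hG : Measurable fun p : (Vec nx × History nx k) × Vec nx × Vec nx => F (p.1, p.2.1) := by
    have h1 : Measurable fun p : (Vec nx × History nx k) × Vec nx × Vec nx => (p.1, p.2.1) :=
      measurable_fst.prodMk measurable_snd.fst
    have h2 := Measurable.comp hF h1
    exact h2
  refine (lintegral_view_filterStep_of hQ hR hP k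
    (fun F hF => lintegral_view_sensorError hQ hR hP k hF) hG).trans (lintegral_congr fun ω => ?_)
  have h4 : Measurable fun z : Vec nx × Vec nx => F (view D P π σ ω k, z.1) := by
    have := Measurable.comp hG (measurable_prodMk_left (x := view D P π σ ω k))
    exact this
  rw [lintegral_prod _ h4.aemeasurable]
  simp

/-- If the prediction gap is conditionally Gaussian given the history, then so is the sum of an
independent Gaussian vector and, unless a packet is received, of a linear image of this gap. -/
theorem lintegral_gap_add_of
    (hB : ∀ F : History nx k × Vec nx → ENNReal, Measurable F →
      ∫⁻ ω, F ((view D P π σ ω k).2, predictionGap (view D P π σ ω k)) ∂(gameLaw D P Sig t₀)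
        = ∫⁻ ω, ∫⁻ y, F ((view D P π σ ω k).2, y)
          ∂gaussianVec (D.f^[historyHolding t₀ (view D P π σ ω k).2 + 1] P - P)
          ∂(gameLaw D P Sig t₀))
    (hf : ∀ t, (D.f^[t] P - P).PosSemidef)
    {Y : Type*} [MeasurableSpace Y] {Φ : Vec nx × History nx k → Y} (hΦ : Measurable Φ)
    (hΦr : ∀ xs h, receives D π σ h = false → Φ (xs, h) = Φ (0, h))
    {m : ℕ} (L : Matrix (Fin m) (Fin nx) ℝ) {c : ℕ → Matrix (Fin m) (Fin m) ℝ}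
    (hc₀ : (c 0).PosSemidef)
    (hc : ∀ t, c (t + 1) = L * (D.f^[t + 1] P - P) * Lᵀ + c 0)
    {F : Y × Vec m → ENNReal} (hF : Measurable F) :
    ∫⁻ ω, ∫⁻ d, F (Φ (view D P π σ ω k), (if receives D π σ (view D P π σ ω k).2 then 0
        else L *ᵥ predictionGap (view D P π σ ω k)) + d) ∂gaussianVec (c 0) ∂(gameLaw D P Sig t₀)
      = ∫⁻ ω, ∫⁻ y, F (Φ (view D P π σ ω k), y)
        ∂gaussianVec (c (if receives D π σ (view D P π σ ω k).2 then 0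
          else historyHolding t₀ (view D P π σ ω k).2 + 1)) ∂(gameLaw D P Sig t₀) := by
  have hview : Measurable fun ω : Sample nx ny => view D P π σ ω k := measurable_view k
  have hr : MeasurableSet {ω : Sample nx ny | receives D π σ (view D P π σ ω k).2 = true} := by
    have := Measurable.comp (measurable_receives (D := D) (π := π) (σ := σ) (k := k)) hview.snd
    exact this (measurableSet_singleton true)
  -- After a reception the gap drops out and both sides already agree (G₁). Without one, Φ ignores
  -- the sensor's estimate, replaced by 0 in G₂, so the integrand depends on the history and the gap
  -- only and hB applies.
  set G₁ : Sample nx ny → ENNReal := fun ω =>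
    ∫⁻ d, F (Φ (view D P π σ ω k), d) ∂gaussianVec (c 0) with hG₁
  have hG₁m : Measurable G₁ := by
    have h1 : Measurable fun y : Y => ∫⁻ d, F (y, d) ∂gaussianVec (c 0) := hF.lintegral_prod_right'
    have h2 := Measurable.comp h1 (hΦ.comp hview)
    exact h2
  have hΦ₀ : Measurable fun h : History nx k => Φ (0, h) := hΦ.comp measurable_prodMk_left
  set G₂ : History nx k × Vec nx → ENNReal := fun p =>
    if receives D π σ p.1 then 0 else ∫⁻ d, F (Φ (0, p.1), L *ᵥ p.2 + d) ∂gaussianVec (c 0) with hG₂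
  have hG₂m : Measurable G₂ := by
    refine .ite (measurable_fst measurableSet_receives) measurable_const ?_
    have h1 : Measurable fun p : (History nx k × Vec nx) × Vec m =>
        (Φ (0, p.1.1), L *ᵥ p.1.2 + p.2) :=
      (hΦ₀.comp (measurable_fst.comp measurable_fst)).prodMk
        ((measurable_const_mulVec L (measurable_snd.comp measurable_fst)).add measurable_snd)
    have h2 : Measurable fun p : (History nx k × Vec nx) × Vec m =>
        F (Φ (0, p.1.1), L *ᵥ p.1.2 + p.2) := hF.comp h1
    exact h2.lintegral_prod_right'
  have hG₁' : Measurable fun ω =>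
      if receives D π σ (view D P π σ ω k).2 then G₁ ω else 0 := .ite hr hG₁m measurable_const
  have hleft : ∀ ω, ∫⁻ d, F (Φ (view D P π σ ω k), (if receives D π σ (view D P π σ ω k).2 then 0
        else L *ᵥ predictionGap (view D P π σ ω k)) + d) ∂gaussianVec (c 0)
      = (if receives D π σ (view D P π σ ω k).2 then G₁ ω else 0)
        + G₂ ((view D P π σ ω k).2, predictionGap (view D P π σ ω k)) := by
    intro ω
    simp only [hG₁, hG₂]
    generalize view D P π σ ω k = z
    obtain ⟨xs, h⟩ := z
    by_cases h1 : receives D π σ h = true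
    · simp [h1]
    · rw [Bool.not_eq_true] at h1
      simp [h1, hΦr xs h h1]
  have hright : ∀ ω, ∫⁻ y, F (Φ (view D P π σ ω k), y)
        ∂gaussianVec (c (if receives D π σ (view D P π σ ω k).2 then 0
          else historyHolding t₀ (view D P π σ ω k).2 + 1))
      = (if receives D π σ (view D P π σ ω k).2 then G₁ ω else 0)
        + ∫⁻ y, G₂ ((view D P π σ ω k).2, y)
          ∂gaussianVec (D.f^[historyHolding t₀ (view D P π σ ω k).2 + 1] P - P) := by
    intro ω
    simp only [hG₁, hG₂]
    generalize view D P π σ ω k = z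
    obtain ⟨xs, h⟩ := z
    by_cases h1 : receives D π σ h = true
    · simp [h1]
    · rw [Bool.not_eq_true] at h1
      have hFm : Measurable fun y => F (Φ (0, h), y) := hF.comp measurable_prodMk_left
      simp only [h1, hΦr xs h h1, Bool.false_eq_true, if_false, zero_add]
      rw [hc, lintegral_gaussianVec_add (hf _) hc₀ L hFm]
  rw [lintegral_congr hleft, lintegral_congr hright, lintegral_add_left hG₁',
    lintegral_add_left hG₁', hB G₂ hG₂m]

theorem predictionGap_succ (ω : Sample nx ny) (k : ℕ) :
    predictionGap (view D P π σ ω (k + 1))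
      = (if receives D π σ (view D P π σ ω k).2 then 0
        else D.A *ᵥ predictionGap (view D P π σ ω k)) + (filterStep D P π σ ω k).1 := by
  rw [view_succ]
  simp only [predictionGap, nextView, nextHistory, estimate_observe]
  split_ifs
  · abel
  · rw [mulVec_sub]
    abel

/-- The covariance of the gap, propagated by A, plus that of one new correction. -/
theorem iterate_f_sub_succ (t : ℕ) :
    D.f^[t + 1 + 1] P - P = D.A * (D.f^[t + 1] P - P) * D.Aᵀ + (D.f^[0 + 1] P - P) := by
  rw [Function.iterate_succ_apply', zero_add, Function.iterate_one]
  generalize D.f^[t + 1] P = X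
  simp only [GameData.f, Matrix.mul_sub, Matrix.sub_mul]
  abel

/-- Given the history, the prediction gap is Gaussian, with a covariance that depends on the holding
time. -/
theorem lintegral_history_gap (hQ : D.Q.PosSemidef) (hR : D.R.PosDef)
    (hP : D.IsSteadyState P) (k : ℕ) {F : History nx k × Vec nx → ENNReal} (hF : Measurable F) :
    ∫⁻ ω, F ((view D P π σ ω k).2, predictionGap (view D P π σ ω k)) ∂(gameLaw D P Sig t₀)
      = ∫⁻ ω, ∫⁻ y, F ((view D P π σ ω k).2, y)
        ∂gaussianVec (D.f^[historyHolding t₀ (view D P π σ ω k).2 + 1] P - P)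
        ∂(gameLaw D P Sig t₀) := by
  induction k with
  | zero =>
    have h1 : ∀ ω, predictionGap (view D P π σ ω 0) = ω.1.2.1 :=
      situation_zero_xs_sub (D := D) (P := P) (π := π) (σ := σ)
    simp only [h1]
    exact resamples_initCorrection.lintegral_comp_eq (measurable_history (π := π) (σ := σ) (D := D)
      (P := P) 0) (fun ω z => rfl) (by fun_prop : Measurable fun ω : Sample nx ny => ω.1.2.1)
      (fun ω z => rfl) hF
  | succ k ih =>
    have hG : Measurable fun p : (Vec nx × History nx k) × Vec nx =>
        F (nextHistory D π σ p.1.1 p.1.2, (if receives D π σ p.1.2 then 0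
        else D.A *ᵥ predictionGap p.1) + p.2) := by
      have h0 : Measurable fun p : (Vec nx × History nx k) × Vec nx => p.1 := measurable_fst
      have h1 := Measurable.comp (measurable_nextHistory (D := D) (π := π) (σ := σ) (k := k)) h0
      have h2 : Measurable fun p : (Vec nx × History nx k) × Vec nx =>
          if receives D π σ p.1.2 then 0 else D.A *ᵥ predictionGap p.1 :=
        .ite (h0.snd measurableSet_receives) measurable_const
          (measurable_const_mulVec D.A (measurable_predictionGap.comp h0))
      have h3 := Measurable.comp hF (h1.prodMk (h2.add measurable_snd))
      exact h3
    have h1 := lintegral_view_correction (Sig := Sig) (t₀ := t₀) (π := π) (σ := σ) hQ hR hP k hG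
    have h2 : ∀ ω, (view D P π σ ω (k + 1)).2
        = nextHistory D π σ (view D P π σ ω k).1 (view D P π σ ω k).2 := fun ω => rfl
    simp only [predictionGap_succ, h2, historyHolding_nextHistory]
    refine h1.trans ?_
    -- c t is the covariance of the gap at holding time t; c 0 = f P - P is that of a single
    -- correction.
    have h3 := lintegral_gap_add_of (Sig := Sig) (t₀ := t₀) (π := π) (σ := σ) (fun F hF => ih hF)
      (hP.iterate_f_sub_posSemidef hQ hR) (measurable_nextHistory (D := D) (π := π) (σ := σ))
      (fun xs h hr => nextHistory_eq_of_not_receives hr xs) D.A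
      (c := fun t => D.f^[t + 1] P - P) (hP.iterate_f_sub_posSemidef hQ hR 1) iterate_f_sub_succ hF
    exact h3

/-- What the controller knows when it chooses the input of stage `k`, with all the seeds. -/
noncomputable def information (D : GameData nx nu ny) (π : ControllerStrategy nx nu)
    (σ : LinkStrategy) (z : Vec nx × History nx k) : (Fin (k + 1) → CtrlObs nx) × (ℕ → LinkNoise) :=
  (observations D π σ z.1 z.2, z.2.2.2)

theorem measurable_information :
    Measurable fun z : Vec nx × History nx k => information D π σ z :=
  measurable_observations.prodMk (measurable_snd.comp (measurable_snd.comp measurable_snd))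

/-- The error of the controller's estimate. -/
noncomputable def estimationError (D : GameData nx nu ny) (P : Matrix (Fin nx) (Fin nx) ℝ)
    (π : ControllerStrategy nx nu) (σ : LinkStrategy) (ω : Sample nx ny) (k : ℕ) : Vec nx :=
  (situation D P π σ ω k).x - estimate (observe D π σ (view D P π σ ω k).1 (view D P π σ ω k).2)

theorem estimationError_eq (ω : Sample nx ny) (k : ℕ) :
    estimationError D P π σ ω k = (if receives D π σ (view D P π σ ω k).2 then 0
        else (1 : Matrix (Fin nx) (Fin nx) ℝ) *ᵥ predictionGap (view D P π σ ω k))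
      + sensorError D P π σ ω k := by
  have h : (view D P π σ ω k).1 = (situation D P π σ ω k).xs := rfl
  rw [estimationError, estimate_observe, sensorError, predictionGap, one_mulVec, h]
  split_ifs <;> abel

/-- Given the information of the controller, the error of its estimate is Gaussian with covariance
`f^τ(P)`, where `τ` is the holding time. -/
theorem lintegral_information_estimationError (hQ : D.Q.PosSemidef) (hR : D.R.PosDef)
    (hP : D.IsSteadyState P) (k : ℕ)
    {F : ((Fin (k + 1) → CtrlObs nx) × (ℕ → LinkNoise)) × Vec nx → ENNReal} (hF : Measurable F) :
    ∫⁻ ω, F (information D π σ (view D P π σ ω k), estimationError D P π σ ω k)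
        ∂(gameLaw D P Sig t₀)
      = ∫⁻ ω, ∫⁻ y, F (information D π σ (view D P π σ ω k), y)
        ∂gaussianVec (D.f^[holding t₀ (k + 1) (acks (situation D P π σ ω (k + 1)).obs)] P)
        ∂(gameLaw D P Sig t₀) := by
  have hG : Measurable fun p : (Vec nx × History nx k) × Vec nx =>
      F (information D π σ p.1, (if receives D π σ p.1.2 then 0
      else (1 : Matrix (Fin nx) (Fin nx) ℝ) *ᵥ predictionGap p.1) + p.2) := by
    have h0 : Measurable fun p : (Vec nx × History nx k) × Vec nx => p.1 := measurable_fst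
    have h1 := Measurable.comp (measurable_information (D := D) (π := π) (σ := σ) (k := k)) h0
    have h2 : Measurable fun p : (Vec nx × History nx k) × Vec nx =>
        if receives D π σ p.1.2 then 0
        else (1 : Matrix (Fin nx) (Fin nx) ℝ) *ᵥ predictionGap p.1 :=
      .ite (h0.snd measurableSet_receives) measurable_const
        (measurable_const_mulVec _ (measurable_predictionGap.comp h0))
    have h3 := Measurable.comp hF (h1.prodMk (h2.add measurable_snd))
    exact h3
  have h1 := lintegral_view_sensorError (Sig := Sig) (t₀ := t₀) (π := π) (σ := σ) hQ hR hP k hG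
  have h2 : ∀ ω, holding t₀ (k + 1) (acks (situation D P π σ ω (k + 1)).obs)
      = if receives D π σ (view D P π σ ω k).2 then 0
        else historyHolding t₀ (view D P π σ ω k).2 + 1 :=
    fun ω => holding_observations t₀ (view D P π σ ω k).1 (view D P π σ ω k).2
  simp only [estimationError_eq, h2]
  refine h1.trans ?_
  -- The gap is not propagated this time, and the added vector is the sensor's error: f^(t+1)(P) =
  -- (f^(t+1)(P) - P) + P.
  have h3 := lintegral_gap_add_of (Sig := Sig) (t₀ := t₀) (π := π) (σ := σ)
    (fun F hF => lintegral_history_gap hQ hR hP k hF)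
    (hP.iterate_f_sub_posSemidef hQ hR) (measurable_information (D := D) (π := π) (σ := σ))
    (fun xs h hr => by
      simp only [information, observations_eq_of_not_receives hr xs])
    (1 : Matrix (Fin nx) (Fin nx) ℝ)
    (c := fun t => D.f^[t] P) hP.1 (fun t => by simp) hF
  exact h3

end EstimationError

/-! ### Separation of the expected quadratic cost -/

section CostDecomposition

variable {nx nu ny : ℕ} (D : GameData nx nu ny) (P Sig : Matrix (Fin nx) (Fin nx) ℝ) (t₀ : ℕ)
  (π : ControllerStrategy nx nu) (σ : LinkStrategy)

/-- The expectation of `x_kᵀ T x_k`. -/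
noncomputable def expectedState (T : Matrix (Fin nx) (Fin nx) ℝ) (k : ℕ) : ENNReal :=
  ∫⁻ ω, ENNReal.ofReal ((situation D P π σ ω k).x ⬝ᵥ (T *ᵥ (situation D P π σ ω k).x))
    ∂(gameLaw D P Sig t₀)

/-- The expectation of the quadratic cost of stage `k`. -/
noncomputable def expectedQuadratic (k : ℕ) : ENNReal :=
  ∫⁻ ω, ENNReal.ofReal (quadraticCost D P π σ ω k) ∂(gameLaw D P Sig t₀)

/-- The holding time after stage `k`. -/
noncomputable def holdingAfter (ω : Sample nx ny) (k : ℕ) : ℕ :=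
  holding t₀ (k + 1) (acks (situation D P π σ ω (k + 1)).obs)

/-- The expected cost of the estimation error of stage `k`. -/
noncomputable def expectedTracking (T : Matrix (Fin nx) (Fin nx) ℝ) (k : ℕ) : ENNReal :=
  ∫⁻ ω, ENNReal.ofReal ((D.errorWeight T * D.f^[holdingAfter D P t₀ π σ ω k] P).trace)
    ∂(gameLaw D P Sig t₀)

/-- The controller's estimate at stage `k`. -/
noncomputable def estimateAt (ω : Sample nx ny) (k : ℕ) : Vec nx :=
  estimate (observe D π σ (view D P π σ ω k).1 (view D P π σ ω k).2)

/-- The deviation of the input of stage `k` from the linear feedback with the gain of `T`. -/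
noncomputable def inputDeviation (T : Matrix (Fin nx) (Fin nx) ℝ) (ω : Sample nx ny) (k : ℕ) :
    Vec nu :=
  inputAt D π σ ω (situation D P π σ ω k) - D.gain T *ᵥ estimateAt D P π σ ω k

/-- The expected cost of the deviation of the input from the linear feedback. -/
noncomputable def expectedDeviation (T : Matrix (Fin nx) (Fin nx) ℝ) (k : ℕ) : ENNReal :=
  ∫⁻ ω, ENNReal.ofReal (inputDeviation D P π σ T ω k ⬝ᵥ
    (D.inputWeight T *ᵥ inputDeviation D P π σ T ω k)) ∂(gameLaw D P Sig t₀)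

variable {D P Sig t₀ π σ}

theorem measurable_inputAt (k : ℕ) : Measurable fun ω : Sample nx ny =>
    inputAt D π σ ω (situation D P π σ ω k) := by
  have := Measurable.comp (measurable_inputFor (D := D) (π := π) (σ := σ) (k := k))
    (measurable_view (D := D) (P := P) (π := π) (σ := σ) k)
  exact this

theorem measurable_quadraticCost (k : ℕ) :
    Measurable fun ω : Sample nx ny => quadraticCost D P π σ ω k :=
  (measurable_quadForm D.W (measurable_state k)).add
    (measurable_quadForm D.U (measurable_inputAt k))

theorem measurable_holdingAfter (k : ℕ) :
    Measurable fun ω : Sample nx ny => holdingAfter D P t₀ π σ ω k :=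
  measurable_holding t₀ (measurable_acks.comp
    (measurable_fst.comp (measurable_snd.comp (measurable_history (k + 1)))))

theorem measurable_trackingCost (T : Matrix (Fin nx) (Fin nx) ℝ) (k : ℕ) :
    Measurable fun ω : Sample nx ny => ENNReal.ofReal
      ((D.errorWeight T * D.f^[holdingAfter D P t₀ π σ ω k] P).trace) :=
  (measurable_of_countable fun t : ℕ => ENNReal.ofReal
    ((D.errorWeight T * D.f^[t] P).trace)).comp (measurable_holdingAfter k)

theorem measurable_inputDeviation (T : Matrix (Fin nx) (Fin nx) ℝ) (k : ℕ) :
    Measurable fun ω : Sample nx ny => inputDeviation D P π σ T ω k := by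
  have h1 := Measurable.comp (measurable_observe (D := D) (π := π) (σ := σ) (k := k))
    (measurable_view (D := D) (P := P) (π := π) (σ := σ) k)
  exact (measurable_inputAt k).sub (measurable_const_mulVec _ (measurable_estimate.comp h1))

/-- w_k is independent of the state and the input of stage k and contributes a trace of its own. -/
theorem expectedState_succ (hQ : D.Q.PosSemidef) {T : Matrix (Fin nx) (Fin nx) ℝ}
    (hT : T.PosSemidef) (k : ℕ) :
    expectedState D P Sig t₀ π σ T (k + 1)
      = ∫⁻ ω, ENNReal.ofReal
          ((D.A *ᵥ (situation D P π σ ω k).x + D.B *ᵥ inputAt D π σ ω (situation D P π σ ω k)) ⬝ᵥ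
            (T *ᵥ (D.A *ᵥ (situation D P π σ ω k).x
              + D.B *ᵥ inputAt D π σ ω (situation D P π σ ω k)))) ∂(gameLaw D P Sig t₀)
        + ENNReal.ofReal (T * D.Q).trace := by
  set Z : Sample nx ny → Vec nx := fun ω => D.A *ᵥ (situation D P π σ ω k).x
    + D.B *ᵥ inputAt D π σ ω (situation D P π σ ω k) with hZdef
  have hZ : Measurable Z := (measurable_const_mulVec D.A (measurable_state k)).add
    (measurable_const_mulVec D.B (measurable_inputAt k))
  have hZΘ : ∀ ω z, Z (replaceNoise k ω z) = Z ω := by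
    intro ω z
    simp only [hZdef, situation_replaceNoise]
    rfl
  have hV : Measurable fun ω : Sample nx ny => ((ω.2.1 k).1, (ω.2.1 (k + 1)).2) := by fun_prop
  have hF : Measurable fun p : Vec nx × Vec nx × Vec ny =>
      ENNReal.ofReal ((p.1 + p.2.1) ⬝ᵥ (T *ᵥ (p.1 + p.2.1))) :=
    (measurable_quadForm T (measurable_fst.add measurable_snd.fst)).ennreal_ofReal
  have h1 := (resamples_replaceNoise (D := D) (P := P) (Sig := Sig) (t₀ := t₀) k).lintegral_comp_eq
    hZ hZΘ hV (fun ω z => by simp [replaceNoise]) hF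
  have hZT : Measurable fun ω => ENNReal.ofReal (Z ω ⬝ᵥ (T *ᵥ Z ω)) :=
    (measurable_quadForm T hZ).ennreal_ofReal
  refine (show expectedState D P Sig t₀ π σ T (k + 1) = _ from h1).trans ?_
  have h2 : ∀ ω, ∫⁻ x, ENNReal.ofReal ((Z ω + x.1) ⬝ᵥ (T *ᵥ (Z ω + x.1)))
      ∂((gaussianVec D.Q).prod (gaussianVec D.R))
      = ENNReal.ofReal (Z ω ⬝ᵥ (T *ᵥ Z ω)) + ENNReal.ofReal (T * D.Q).trace := by
    intro ω
    have h3 : Measurable fun x : Vec nx × Vec ny =>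
      ENNReal.ofReal ((Z ω + x.1) ⬝ᵥ (T *ᵥ (Z ω + x.1))) :=
      (measurable_quadForm T (measurable_const.add measurable_fst)).ennreal_ofReal
    have h4 := lintegral_quadForm_gaussianVec hT hQ (Z ω) (1 : Matrix (Fin nx) (Fin nx) ℝ)
    simp only [one_mulVec, transpose_one, Matrix.one_mul, Matrix.mul_one] at h4
    rw [lintegral_prod _ h3.aemeasurable, ← h4]
    simp
  rw [lintegral_congr h2, lintegral_add_left hZT, lintegral_const, measure_univ, mul_one]

/-- With G the gain, u - G x = (u - G x̂) - G e. The first term is a function of the controller's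
information and seeds, given which e is centred with covariance f^τ(P); the mixed term vanishes and
e contributes a trace. -/
theorem expectedDeviation_add_tracking (hη : 0 ≤ D.eta) (hQ : D.Q.PosSemidef) (hR : D.R.PosDef)
    (hU : D.U.PosDef) (hP : D.IsSteadyState P) {T : Matrix (Fin nx) (Fin nx) ℝ}
    (hT : T.PosSemidef) (k : ℕ) :
    ∫⁻ ω, ENNReal.ofReal
        ((inputAt D π σ ω (situation D P π σ ω k) - D.gain T *ᵥ (situation D P π σ ω k).x) ⬝ᵥ
          (D.inputWeight T *ᵥ (inputAt D π σ ω (situation D P π σ ω k)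
            - D.gain T *ᵥ (situation D P π σ ω k).x))) ∂(gameLaw D P Sig t₀)
      = expectedDeviation D P Sig t₀ π σ T k + expectedTracking D P Sig t₀ π σ T k := by
  set a : (Fin (k + 1) → CtrlObs nx) × (ℕ → LinkNoise) → Vec nu := fun i =>
    π.2.control k i.1 (ctrlSeeds i.2 k) - D.gain T *ᵥ estimate (i.1 (Fin.last k)) with ha
  have ham : Measurable a := by
    have h1 := (π.2.measurable_control k).comp
      (measurable_fst.prodMk ((measurable_ctrlSeeds k).comp measurable_snd) :
        Measurable fun i : (Fin (k + 1) → CtrlObs nx) × (ℕ → LinkNoise) =>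
          (i.1, ctrlSeeds i.2 k))
    exact h1.sub (measurable_const_mulVec _ (measurable_estimate.comp
      ((measurable_pi_apply _).comp measurable_fst)))
  have hF : Measurable fun p : ((Fin (k + 1) → CtrlObs nx) × (ℕ → LinkNoise)) × Vec nx =>
      ENNReal.ofReal ((a p.1 + (-D.gain T) *ᵥ p.2) ⬝ᵥ
        (D.inputWeight T *ᵥ (a p.1 + (-D.gain T) *ᵥ p.2))) :=
    (measurable_quadForm _ ((ham.comp measurable_fst).add
      (measurable_const_mulVec _ measurable_snd))).ennreal_ofReal
  have h1 := lintegral_information_estimationError (Sig := Sig) (t₀ := t₀) (π := π) (σ := σ)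
    hQ hR hP k hF
  have h2 : ∀ ω, a (information D π σ (view D P π σ ω k)) = inputDeviation D P π σ T ω k := by
    intro ω
    have h3 : (information D π σ (view D P π σ ω k)).1 (Fin.last k)
        = observe D π σ (view D P π σ ω k).1 (view D P π σ ω k).2 := by
      simp [information, observations]
    rw [ha, inputDeviation, estimateAt, ← h3]
    rfl
  have hN := (GameData.inputWeight_posDef hη hU hT).posSemidef
  have h3 : ∀ ω, inputAt D π σ ω (situation D P π σ ω k) - D.gain T *ᵥ (situation D P π σ ω k).x
      = a (information D π σ (view D P π σ ω k))
        + (-D.gain T) *ᵥ estimationError D P π σ ω k := by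
    intro ω
    rw [h2, inputDeviation, estimateAt, estimationError, neg_mulVec, mulVec_sub]
    abel
  have h4 : ∀ M, (-D.gain T)ᵀ * D.inputWeight T * (-D.gain T) * M = D.errorWeight T * M := by
    intro M
    rw [GameData.errorWeight_eq hη hU hT, transpose_neg, Matrix.neg_mul, Matrix.neg_mul,
      Matrix.mul_neg, neg_neg]
  simp only [h3]
  refine h1.trans ?_
  have h5 : Measurable fun ω : Sample nx ny => ENNReal.ofReal (inputDeviation D P π σ T ω k ⬝ᵥ
      (D.inputWeight T *ᵥ inputDeviation D P π σ T ω k)) :=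
    (measurable_quadForm _ (measurable_inputDeviation T k)).ennreal_ofReal
  rw [expectedDeviation, expectedTracking, ← lintegral_add_left h5]
  refine lintegral_congr fun ω => ?_
  have h6 := lintegral_quadForm_gaussianVec hN (GameData.iterate_f_posSemidef hQ hP.1
    (holdingAfter D P t₀ π σ ω k)) (inputDeviation D P π σ T ω k) (-D.gain T)
  rw [h4] at h6
  rw [← h6, ← h2]
  rfl

/-- The dynamic programming identity of the linear quadratic problem. -/
theorem expectedQuadratic_add (hη : 0 ≤ D.eta) (hQ : D.Q.PosSemidef) (hR : D.R.PosDef)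
    (hW : D.W.PosSemidef) (hU : D.U.PosDef) (hP : D.IsSteadyState P)
    {T : Matrix (Fin nx) (Fin nx) ℝ} (hT : T.PosSemidef) (k : ℕ) :
    expectedQuadratic D P Sig t₀ π σ k
        + ENNReal.ofReal D.eta * expectedState D P Sig t₀ π σ T (k + 1)
      = expectedState D P Sig t₀ π σ (D.riccati T) k
        + (expectedTracking D P Sig t₀ π σ T k + ENNReal.ofReal D.eta * ENNReal.ofReal (T * D.Q).trace)
        + expectedDeviation D P Sig t₀ π σ T k := by
  have hq := (measurable_quadraticCost (D := D) (P := P) (π := π) (σ := σ) k).ennreal_ofReal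
  have hx := measurable_state (D := D) (P := P) (π := π) (σ := σ) k
  have hu := measurable_inputAt (D := D) (P := P) (π := π) (σ := σ) k
  have hx' : Measurable fun ω : Sample nx ny => ENNReal.ofReal
      ((D.A *ᵥ (situation D P π σ ω k).x + D.B *ᵥ inputAt D π σ ω (situation D P π σ ω k)) ⬝ᵥ
        (T *ᵥ (D.A *ᵥ (situation D P π σ ω k).x
          + D.B *ᵥ inputAt D π σ ω (situation D P π σ ω k)))) :=
    (measurable_quadForm T ((measurable_const_mulVec _ hx).add
      (measurable_const_mulVec _ hu))).ennreal_ofReal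
  have hr : Measurable fun ω : Sample nx ny => ENNReal.ofReal
      ((situation D P π σ ω k).x ⬝ᵥ (D.riccati T *ᵥ (situation D P π σ ω k).x)) :=
    (measurable_quadForm _ hx).ennreal_ofReal
  have h1 : expectedQuadratic D P Sig t₀ π σ k + ENNReal.ofReal D.eta * ∫⁻ ω, ENNReal.ofReal
      ((D.A *ᵥ (situation D P π σ ω k).x + D.B *ᵥ inputAt D π σ ω (situation D P π σ ω k)) ⬝ᵥ
        (T *ᵥ (D.A *ᵥ (situation D P π σ ω k).x
          + D.B *ᵥ inputAt D π σ ω (situation D P π σ ω k)))) ∂(gameLaw D P Sig t₀)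
      = expectedState D P Sig t₀ π σ (D.riccati T) k
        + (expectedDeviation D P Sig t₀ π σ T k + expectedTracking D P Sig t₀ π σ T k) := by
    rw [← expectedDeviation_add_tracking hη hQ hR hU hP hT, ← lintegral_const_mul _ hx',
      expectedQuadratic, ← lintegral_add_left hq, expectedState, ← lintegral_add_left hr]
    refine lintegral_congr fun ω => ?_
    have h2 := GameData.completion_of_squares hη hU hT (situation D P π σ ω k).x
      (inputAt D π σ ω (situation D P π σ ω k))
    rw [← ENNReal.ofReal_mul hη, ← ENNReal.ofReal_add _ (mul_nonneg hη (hT.quadForm_nonneg _)),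
      ← ENNReal.ofReal_add
      ((GameData.riccati_posSemidef hη hU hW hT).quadForm_nonneg _)
      ((GameData.inputWeight_posDef hη hU hT).posSemidef.quadForm_nonneg _), quadraticCost]
    · exact congrArg ENNReal.ofReal h2
    · exact add_nonneg (hW.quadForm_nonneg _) (hU.posSemidef.quadForm_nonneg _)
  rw [expectedState_succ hQ hT, mul_add, ← add_assoc, h1]
  ac_rfl

theorem resamples_initPrediction : Resamples (gameLaw D P Sig t₀) (gaussianVec Sig)
    fun ω y => ((y, ω.1.2.1, ω.1.2.2), ω.2) :=
  (resamples_snd (gaussianVec Sig)).prod_left.prod_left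

theorem lintegral_quadForm_add_of_resamples {Ω : Type*} [MeasurableSpace Ω] {μ : Measure Ω}
    [IsProbabilityMeasure μ] {n : ℕ} {M T : Matrix (Fin n) (Fin n) ℝ} (hM : M.PosSemidef)
    (hT : T.PosSemidef)
    {Θ : Ω → Vec n → Ω} (h : Resamples μ (gaussianVec M) Θ) {Z V : Ω → Vec n} (hZ : Measurable Z)
    (hZΘ : ∀ ω x, Z (Θ ω x) = Z ω) (hV : Measurable V) (hVΘ : ∀ ω x, V (Θ ω x) = x) :
    ∫⁻ ω, ENNReal.ofReal ((Z ω + V ω) ⬝ᵥ (T *ᵥ (Z ω + V ω))) ∂μ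
      = ∫⁻ ω, ENNReal.ofReal (Z ω ⬝ᵥ (T *ᵥ Z ω)) ∂μ + ENNReal.ofReal (T * M).trace := by
  have hF : Measurable fun p : Vec n × Vec n =>
      ENNReal.ofReal ((p.1 + p.2) ⬝ᵥ (T *ᵥ (p.1 + p.2))) :=
    (measurable_quadForm T (measurable_fst.add measurable_snd)).ennreal_ofReal
  refine (h.lintegral_comp_eq hZ hZΘ hV hVΘ hF).trans ?_
  have hZT : Measurable fun ω => ENNReal.ofReal (Z ω ⬝ᵥ (T *ᵥ Z ω)) :=
    (measurable_quadForm T hZ).ennreal_ofReal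
  have h2 : ∀ ω, ∫⁻ x, ENNReal.ofReal ((Z ω + x) ⬝ᵥ (T *ᵥ (Z ω + x))) ∂gaussianVec M
      = ENNReal.ofReal (Z ω ⬝ᵥ (T *ᵥ Z ω)) + ENNReal.ofReal (T * M).trace := by
    intro ω
    have h4 := lintegral_quadForm_gaussianVec hT hM (Z ω) (1 : Matrix (Fin n) (Fin n) ℝ)
    simpa only [one_mulVec, transpose_one, Matrix.one_mul, Matrix.mul_one] using h4
  rw [lintegral_congr h2, lintegral_add_left hZT, lintegral_const, measure_univ, mul_one]

/-- x₀ is a sum of three independent centred Gaussian vectors, integrated out one at a time. -/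
theorem expectedState_zero (hQ : D.Q.PosSemidef) (hR : D.R.PosDef) (hP : D.IsSteadyState P)
    (hSig : Sig.PosSemidef) {T : Matrix (Fin nx) (Fin nx) ℝ} (hT : T.PosSemidef) :
    expectedState D P Sig t₀ π σ T 0 = ENNReal.ofReal (T * Sig).trace
      + ENNReal.ofReal (T * (D.f^[t₀ + 1] P - P)).trace + ENNReal.ofReal (T * P).trace := by
  have h1 := lintegral_quadForm_add_of_resamples hP.1 hT
    (resamples_initError (D := D) (P := P) (Sig := Sig) (t₀ := t₀))
    (Z := fun ω => ω.1.1 + ω.1.2.1) (V := fun ω => ω.1.2.2) (by fun_prop) (fun ω x => rfl)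
    (by fun_prop) (fun ω x => rfl)
  have h2 := lintegral_quadForm_add_of_resamples (hP.iterate_f_sub_posSemidef hQ hR (t₀ + 1)) hT
    (resamples_initCorrection (D := D) (P := P) (Sig := Sig) (t₀ := t₀))
    (Z := fun ω => ω.1.1) (V := fun ω => ω.1.2.1) (by fun_prop) (fun ω x => rfl)
    (by fun_prop) (fun ω x => rfl)
  have h3 := lintegral_quadForm_add_of_resamples hSig hT
    (resamples_initPrediction (D := D) (P := P) (Sig := Sig) (t₀ := t₀))
    (Z := fun ω => 0) (V := fun ω => ω.1.1) (by fun_prop) (fun ω x => rfl)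
    (by fun_prop) (fun ω x => rfl)
  simp only [zero_add, zero_dotProduct, ENNReal.ofReal_zero, lintegral_zero] at h3
  rw [h2, h3] at h1
  exact h1

end CostDecomposition

/-! ### Bounds for the infinite-horizon quadratic cost -/

section CostBounds

variable {nx nu ny : ℕ} {D : GameData nx nu ny} {P Sig : Matrix (Fin nx) (Fin nx) ℝ} {t₀ : ℕ}
  {π : ControllerStrategy nx nu} {σ : LinkStrategy}

/-- Dynamic programming over n + 1 stages, with the nonnegative deviations dropped. The last stage
has the matrix `D.W`, covered by its own state cost, so no terminal condition is needed. -/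
theorem expectedState_add_sum_le (hη : 0 ≤ D.eta) (hQ : D.Q.PosSemidef) (hR : D.R.PosDef)
    (hW : D.W.PosSemidef) (hU : D.U.PosDef) (hP : D.IsSteadyState P) (n k : ℕ) :
    expectedState D P Sig t₀ π σ (D.riccati^[n] D.W) k
        + ∑ i ∈ Finset.range n, ENNReal.ofReal D.eta ^ i *
          (expectedTracking D P Sig t₀ π σ (D.riccati^[n - 1 - i] D.W) (k + i)
            + ENNReal.ofReal D.eta * ENNReal.ofReal (D.riccati^[n - 1 - i] D.W * D.Q).trace)
      ≤ ∑ i ∈ Finset.range (n + 1), ENNReal.ofReal D.eta ^ i *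
          expectedQuadratic D P Sig t₀ π σ (k + i) := by
  induction n generalizing k with
  | zero =>
    simp only [Function.iterate_zero, id_eq, Finset.range_zero, Finset.sum_empty, add_zero, zero_add,
      Finset.sum_range_one, pow_zero, one_mul]
    refine lintegral_mono fun ω => ENNReal.ofReal_le_ofReal ?_
    exact le_add_of_nonneg_right (hU.posSemidef.quadForm_nonneg _)
  | succ n ih =>
    rw [Finset.sum_range_succ' _ (n + 1), Finset.sum_range_succ' _ n]
    have h1 := expectedQuadratic_add (Sig := Sig) (t₀ := t₀) (π := π) (σ := σ) hη hQ hR hW hU hP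
      (GameData.iterate_riccati_posSemidef hη hU hW n) k
    have h2 := mul_le_mul_right (ih (k + 1)) (ENNReal.ofReal D.eta)
    rw [mul_add, Finset.mul_sum, Finset.mul_sum] at h2
    have h3 : ∀ i, k + 1 + i = k + (i + 1) := fun i => by ring
    have h4 : ∀ i, n - 1 - i = n - (i + 1) := fun i => by omega
    simp only [h3, h4] at h2
    simp only [pow_succ', mul_assoc, Nat.add_sub_cancel, Nat.sub_zero, pow_zero, one_mul,
      add_zero]
    rw [← Function.iterate_succ_apply' D.riccati n] at h1
    calc _ = (expectedState D P Sig t₀ π σ (D.riccati^[n + 1] D.W) k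
            + (expectedTracking D P Sig t₀ π σ (D.riccati^[n] D.W) k
              + ENNReal.ofReal D.eta * ENNReal.ofReal (D.riccati^[n] D.W * D.Q).trace))
          + ∑ i ∈ Finset.range n, ENNReal.ofReal D.eta * (ENNReal.ofReal D.eta ^ i *
            (expectedTracking D P Sig t₀ π σ (D.riccati^[n - (i + 1)] D.W) (k + (i + 1))
              + ENNReal.ofReal D.eta * ENNReal.ofReal (D.riccati^[n - (i + 1)] D.W * D.Q).trace)) := by
          ac_rfl
      _ ≤ (expectedQuadratic D P Sig t₀ π σ k + ENNReal.ofReal D.eta *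
            expectedState D P Sig t₀ π σ (D.riccati^[n] D.W) (k + 1))
          + ∑ i ∈ Finset.range n, ENNReal.ofReal D.eta * (ENNReal.ofReal D.eta ^ i *
            (expectedTracking D P Sig t₀ π σ (D.riccati^[n - (i + 1)] D.W) (k + (i + 1))
              + ENNReal.ofReal D.eta * ENNReal.ofReal (D.riccati^[n - (i + 1)] D.W * D.Q).trace)) := by
          refine add_le_add ?_ le_rfl
          rw [h1]
          exact le_self_add
      _ ≤ _ := by
          rw [add_assoc, add_comm (∑ i ∈ Finset.range (n + 1), _)]
          exact add_le_add le_rfl h2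

/-- The state cost and the tracking costs of the first `j` stages, along a sample. -/
noncomputable def pathCost (D : GameData nx nu ny) (P : Matrix (Fin nx) (Fin nx) ℝ) (t₀ : ℕ)
    (π : ControllerStrategy nx nu) (σ : LinkStrategy) (j : ℕ) (T₀ : Matrix (Fin nx) (Fin nx) ℝ)
    (T : ℕ → Matrix (Fin nx) (Fin nx) ℝ) (ω : Sample nx ny) : ENNReal :=
  ENNReal.ofReal ((situation D P π σ ω 0).x ⬝ᵥ (T₀ *ᵥ (situation D P π σ ω 0).x))
    + ∑ i ∈ Finset.range j, ENNReal.ofReal D.eta ^ i *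
      (ENNReal.ofReal ((D.errorWeight (T i) * D.f^[holdingAfter D P t₀ π σ ω i] P).trace)
        + ENNReal.ofReal D.eta * ENNReal.ofReal (T i * D.Q).trace)

theorem measurable_pathCost (j : ℕ) (T₀ : Matrix (Fin nx) (Fin nx) ℝ)
    (T : ℕ → Matrix (Fin nx) (Fin nx) ℝ) : Measurable (pathCost D P t₀ π σ j T₀ T) :=
  (measurable_quadForm T₀ (measurable_state 0)).ennreal_ofReal.add
    (Finset.measurable_fun_sum _ fun i _ =>
      ((measurable_trackingCost (T i) i).add_const _).const_mul _)

theorem lintegral_pathCost (j : ℕ) (T₀ : Matrix (Fin nx) (Fin nx) ℝ)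
    (T : ℕ → Matrix (Fin nx) (Fin nx) ℝ) :
    ∫⁻ ω, pathCost D P t₀ π σ j T₀ T ω ∂(gameLaw D P Sig t₀)
      = expectedState D P Sig t₀ π σ T₀ 0 + ∑ i ∈ Finset.range j, ENNReal.ofReal D.eta ^ i *
        (expectedTracking D P Sig t₀ π σ (T i) i
          + ENNReal.ofReal D.eta * ENNReal.ofReal (T i * D.Q).trace) := by
  unfold pathCost
  have h1 := (measurable_quadForm T₀
    (measurable_state (D := D) (P := P) (π := π) (σ := σ) 0)).ennreal_ofReal
  have h2 := fun i => measurable_trackingCost (D := D) (P := P) (π := π) (σ := σ) (t₀ := t₀) (T i) i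
  rw [lintegral_add_left h1, lintegral_finsetSum _ fun i _ => ((h2 i).add_const _).const_mul _]
  congr 1
  refine Finset.sum_congr rfl fun i _ => ?_
  rw [lintegral_const_mul _ ((h2 i).add_const _), lintegral_add_left (h2 i), lintegral_const,
    measure_univ, mul_one, expectedTracking]

theorem tendsto_pathCost (hη : 0 ≤ D.eta) (hU : D.U.PosDef) {S : Matrix (Fin nx) (Fin nx) ℝ}
    (hS : S.PosSemidef) (j : ℕ) {T₀ : ℕ → Matrix (Fin nx) (Fin nx) ℝ}
    {T : ℕ → ℕ → Matrix (Fin nx) (Fin nx) ℝ} (hT₀ : Tendsto T₀ atTop (𝓝 S))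
    (hT : ∀ i, Tendsto (fun n => T n i) atTop (𝓝 S)) (ω : Sample nx ny) :
    Tendsto (fun n => pathCost D P t₀ π σ j (T₀ n) (T n) ω) atTop
      (𝓝 (pathCost D P t₀ π σ j S (fun _ => S) ω)) := by
  have hE : ∀ i, Tendsto (fun n => D.errorWeight (T n i)) atTop (𝓝 (D.errorWeight S)) := by
    intro i
    have h1 : ContinuousAt D.errorWeight S := by
      refine ContinuousAt.sub ?_ (GameData.continuousAt_riccati hη hU hS)
      fun_prop
    exact h1.tendsto.comp (hT i)
  refine Tendsto.add ?_ (tendsto_finsetSum _ fun i _ => ?_)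
  · exact ENNReal.tendsto_ofReal (((continuous_quadForm _).tendsto S).comp hT₀)
  · refine ENNReal.Tendsto.const_mul (Tendsto.add ?_ ?_) (Or.inr (by finiteness))
    · refine ENNReal.tendsto_ofReal ?_
      have h2 : Continuous fun M : Matrix (Fin nx) (Fin nx) ℝ =>
        (M * D.f^[holdingAfter D P t₀ π σ ω i] P).trace := by fun_prop
      exact (h2.tendsto _).comp (hE i)
    · refine ENNReal.Tendsto.const_mul (ENNReal.tendsto_ofReal ?_) (Or.inr (by finiteness))
      have h2 : Continuous fun M : Matrix (Fin nx) (Fin nx) ℝ => (M * D.Q).trace := by fun_prop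
      exact (h2.tendsto _).comp (hT i)

/-- The number j of tracking terms is fixed while the horizon n tends to infinity; the weights tend
to S along every sample, and Fatou's lemma passes to the limit. Nothing is required of the
discounted state cost at infinity. -/
theorem expectedState_add_tsum_le (hη : 0 ≤ D.eta) (hQ : D.Q.PosSemidef) (hR : D.R.PosDef)
    (hW : D.W.PosSemidef) (hU : D.U.PosDef) (hP : D.IsSteadyState P)
    {S : Matrix (Fin nx) (Fin nx) ℝ} (hS : S.PosSemidef)
    (hlim : Tendsto (fun n : ℕ => D.riccati^[n] D.W) atTop (𝓝 S)) :
    expectedState D P Sig t₀ π σ S 0 + ∑' i, ENNReal.ofReal D.eta ^ i *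
        (expectedTracking D P Sig t₀ π σ S i + ENNReal.ofReal D.eta * ENNReal.ofReal (S * D.Q).trace)
      ≤ ∑' i, ENNReal.ofReal D.eta ^ i * expectedQuadratic D P Sig t₀ π σ i := by
  rw [ENNReal.tsum_eq_iSup_nat, ENNReal.add_iSup]
  refine iSup_le fun j => ?_
  rw [← lintegral_pathCost j S fun _ => S]
  have h1 : ∀ ω, pathCost D P t₀ π σ j S (fun _ => S) ω = liminf (fun n : ℕ =>
      pathCost D P t₀ π σ j (D.riccati^[n] D.W) (fun i => D.riccati^[n - 1 - i] D.W) ω) atTop := by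
    intro ω
    refine ((tendsto_pathCost hη hU hS j hlim (fun i => ?_) ω).liminf_eq).symm
    refine hlim.comp ?_
    simp only [Nat.sub_sub]
    exact tendsto_sub_atTop_nat _
  simp only [h1]
  refine (lintegral_liminf_le fun n => measurable_pathCost j _ _).trans ?_
  refine Filter.liminf_le_of_frequently_le' (Eventually.frequently ?_)
  filter_upwards [eventually_ge_atTop j] with n hn
  rw [lintegral_pathCost]
  refine le_trans ?_ (ENNReal.sum_le_tsum (Finset.range (n + 1)))
  have h2 := expectedState_add_sum_le (Sig := Sig) (t₀ := t₀) (π := π) (σ := σ) hη hQ hR hW hU hP n 0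
  simp only [zero_add] at h2
  refine le_trans ?_ h2
  gcongr

/-- With the fixed point S and no deviation the dynamic programming identity telescopes; the
terminal state cost is nonnegative and is dropped. -/
theorem tsum_expectedQuadratic_le (hη : 0 ≤ D.eta) (hQ : D.Q.PosSemidef) (hR : D.R.PosDef)
    (hW : D.W.PosSemidef) (hU : D.U.PosDef) (hP : D.IsSteadyState P)
    {S : Matrix (Fin nx) (Fin nx) ℝ} (hS : S.PosSemidef) (hfix : S = D.riccati S)
    (hdev : ∀ k, expectedDeviation D P Sig t₀ π σ S k = 0) :
    ∑' i, ENNReal.ofReal D.eta ^ i * expectedQuadratic D P Sig t₀ π σ i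
      ≤ expectedState D P Sig t₀ π σ S 0 + ∑' i, ENNReal.ofReal D.eta ^ i *
        (expectedTracking D P Sig t₀ π σ S i
          + ENNReal.ofReal D.eta * ENNReal.ofReal (S * D.Q).trace) := by
  have h1 : ∀ n : ℕ, ∑ i ∈ Finset.range n, ENNReal.ofReal D.eta ^ i *
        expectedQuadratic D P Sig t₀ π σ i
      + ENNReal.ofReal D.eta ^ n * expectedState D P Sig t₀ π σ S n
      = expectedState D P Sig t₀ π σ S 0 + ∑ i ∈ Finset.range n, ENNReal.ofReal D.eta ^ i *
        (expectedTracking D P Sig t₀ π σ S i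
          + ENNReal.ofReal D.eta * ENNReal.ofReal (S * D.Q).trace) := by
    intro n
    induction n with
    | zero => simp
    | succ n ih =>
      have h2 := expectedQuadratic_add (Sig := Sig) (t₀ := t₀) (π := π) (σ := σ) hη hQ hR hW hU hP
        hS n
      rw [hdev, add_zero, ← hfix] at h2
      rw [Finset.sum_range_succ, Finset.sum_range_succ, ← add_assoc, ← ih, pow_succ, add_assoc,
        mul_assoc, ← mul_add, h2, mul_add]
      ac_rfl
  rw [ENNReal.tsum_eq_iSup_nat]
  refine iSup_le fun n => ?_
  refine le_trans (le_self_add.trans (h1 n).le) ?_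
  gcongr
  exact ENNReal.sum_le_tsum _

end CostBounds

/-! ### The cost of the game and its lower bound -/

section GameCost

variable {nx nu ny : ℕ} (D : GameData nx nu ny) (P Sig S : Matrix (Fin nx) (Fin nx) ℝ) (t₀ : ℕ)
  (π : ControllerStrategy nx nu) (σ : LinkStrategy)

/-- The cost of the game, normalized so that all its terms are nonnegative. -/
noncomputable def normalizedCost : ENNReal :=
  ∫⁻ ω, ∑' k, ENNReal.ofReal (D.eta ^ k) * stageCost D.cs D.ca
    (ENNReal.ofReal (quadraticCost D P π σ ω k)) (commandAt π ω (situation D P π σ ω k))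
    (attackAt σ ω (situation D P π σ ω k)) ∂(gameLaw D P Sig t₀)

/-- The normalized cost of the estimation errors and of the link. -/
noncomputable def trackingGameCost : ENNReal :=
  ∫⁻ ω, ∑' k, ENNReal.ofReal (D.eta ^ k) * stageCost D.cs D.ca
    (ENNReal.ofReal ((D.errorWeight S * D.f^[holdingAfter D P t₀ π σ ω k] P).trace))
    (commandAt π ω (situation D P π σ ω k))
    (attackAt σ ω (situation D P π σ ω k)) ∂(gameLaw D P Sig t₀)

/-- The cost that no strategy can influence. -/
noncomputable def baseCost : ENNReal :=
  ENNReal.ofReal (S * Sig).trace + ENNReal.ofReal (S * (D.f^[t₀ + 1] P - P)).trace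
    + ENNReal.ofReal (S * P).trace
    + ∑' i : ℕ, ENNReal.ofReal D.eta ^ i * (ENNReal.ofReal D.eta * ENNReal.ofReal (S * D.Q).trace)

variable {D P Sig S t₀ π σ}

theorem measurable_commandAt (k : ℕ) :
    Measurable fun ω : Sample nx ny => commandAt π ω (situation D P π σ ω k) := by
  have := Measurable.comp (measurable_schedules (π := π) (k := k))
    (measurable_history (D := D) (P := P) (π := π) (σ := σ) k)
  exact this

theorem measurable_attackAt (k : ℕ) :
    Measurable fun ω : Sample nx ny => attackAt σ ω (situation D P π σ ω k) := by
  have := Measurable.comp (measurable_attacks (σ := σ) (k := k))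
    (measurable_history (D := D) (P := P) (π := π) (σ := σ) k)
  exact this

theorem gameCost_eq (hη₀ : 0 < D.eta) (hη₁ : D.eta < 1) (hcs : 0 ≤ D.cs) (hca : 0 ≤ D.ca) :
    gameCost D P Sig t₀ π σ
      = (normalizedCost D P Sig t₀ π σ : EReal) + ((-(D.ca / (1 - D.eta)) : ℝ) : EReal) :=
  limsup_discounted_eq (gameLaw D P Sig t₀) hη₀ hη₁ hcs hca
    (fun k => (measurable_quadraticCost k).ennreal_ofReal) measurable_commandAt measurable_attackAt

/-- Finiteness allows this cost to be cancelled when strategies are compared. -/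
theorem baseCost_ne_top (hη₁ : D.eta < 1) : baseCost D P Sig S t₀ ≠ ⊤ := by
  unfold baseCost
  rw [ENNReal.tsum_mul_right, ENNReal.tsum_geometric]
  have h : (1 - ENNReal.ofReal D.eta)⁻¹ ≠ ⊤ := by
    rw [ENNReal.inv_ne_top, Ne, tsub_eq_zero_iff_le, not_le]
    exact ENNReal.ofReal_lt_one.2 hη₁
  finiteness

theorem stageCost_eq_add (cs ca : ℝ) (c : ENNReal) (ν a : Bool) :
    stageCost cs ca c ν a = c + stageCost cs ca 0 ν a := by
  simp only [stageCost, zero_add, add_assoc]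

theorem lintegral_tsum_stageCost (hη : 0 ≤ D.eta) {c : ℕ → Sample nx ny → ENNReal}
    (hc : ∀ k, Measurable (c k)) :
    ∫⁻ ω, ∑' k, ENNReal.ofReal (D.eta ^ k) * stageCost D.cs D.ca (c k ω)
        (commandAt π ω (situation D P π σ ω k)) (attackAt σ ω (situation D P π σ ω k))
        ∂(gameLaw D P Sig t₀)
      = ∑' k, ENNReal.ofReal D.eta ^ k * ∫⁻ ω, c k ω ∂(gameLaw D P Sig t₀)
        + ∑' k, ENNReal.ofReal D.eta ^ k * ∫⁻ ω, stageCost D.cs D.ca 0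
          (commandAt π ω (situation D P π σ ω k)) (attackAt σ ω (situation D P π σ ω k))
          ∂(gameLaw D P Sig t₀) := by
  have hm := fun k => measurable_stageCost D.cs D.ca (hc k)
    (measurable_commandAt (D := D) (P := P) (π := π) (σ := σ) k)
    (measurable_attackAt (D := D) (P := P) (π := π) (σ := σ) k)
  rw [lintegral_tsum fun k => ((hm k).const_mul _).aemeasurable, ← ENNReal.tsum_add]
  refine tsum_congr fun k => ?_
  rw [lintegral_const_mul _ (hm k), ENNReal.ofReal_pow hη, ← mul_add, ← lintegral_add_left (hc k)]
  congr 1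
  exact lintegral_congr fun ω => stageCost_eq_add _ _ _ _ _

theorem tsum_expectedQuadratic_add (hη : 0 ≤ D.eta) :
    normalizedCost D P Sig t₀ π σ
      = ∑' k, ENNReal.ofReal D.eta ^ k * expectedQuadratic D P Sig t₀ π σ k
        + ∑' k, ENNReal.ofReal D.eta ^ k * ∫⁻ ω, stageCost D.cs D.ca 0
          (commandAt π ω (situation D P π σ ω k)) (attackAt σ ω (situation D P π σ ω k))
          ∂(gameLaw D P Sig t₀) :=
  lintegral_tsum_stageCost hη fun k => (measurable_quadraticCost k).ennreal_ofReal

theorem baseCost_add_trackingGameCost (hη : 0 ≤ D.eta) (hQ : D.Q.PosSemidef) (hR : D.R.PosDef)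
    (hP : D.IsSteadyState P) (hSig : Sig.PosSemidef) (hS : S.PosSemidef) :
    baseCost D P Sig S t₀ + trackingGameCost D P Sig S t₀ π σ
      = (expectedState D P Sig t₀ π σ S 0 + ∑' i, ENNReal.ofReal D.eta ^ i *
          (expectedTracking D P Sig t₀ π σ S i
            + ENNReal.ofReal D.eta * ENNReal.ofReal (S * D.Q).trace))
        + ∑' k, ENNReal.ofReal D.eta ^ k * ∫⁻ ω, stageCost D.cs D.ca 0
          (commandAt π ω (situation D P π σ ω k)) (attackAt σ ω (situation D P π σ ω k))
          ∂(gameLaw D P Sig t₀) := by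
  have h1 : trackingGameCost D P Sig S t₀ π σ = _ := lintegral_tsum_stageCost hη
    fun k => measurable_trackingCost S k
  rw [h1, expectedState_zero hQ hR hP hSig hS, baseCost]
  simp only [mul_add (ENNReal.ofReal D.eta ^ _)]
  rw [ENNReal.tsum_add]
  simp only [expectedTracking]
  ac_rfl

/-- Whatever the players do, the cost is at least that of the estimation errors and of the link. -/
theorem baseCost_add_le_normalizedCost (hη : 0 ≤ D.eta) (hQ : D.Q.PosSemidef) (hR : D.R.PosDef)
    (hW : D.W.PosSemidef) (hU : D.U.PosDef) (hP : D.IsSteadyState P) (hSig : Sig.PosSemidef)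
    (hS : S.PosSemidef) (hlim : Tendsto (fun n : ℕ => D.riccati^[n] D.W) atTop (𝓝 S)) :
    baseCost D P Sig S t₀ + trackingGameCost D P Sig S t₀ π σ
      ≤ normalizedCost D P Sig t₀ π σ := by
  rw [baseCost_add_trackingGameCost hη hQ hR hP hSig hS, tsum_expectedQuadratic_add hη]
  exact add_le_add (expectedState_add_tsum_le hη hQ hR hW hU hP hS hlim) le_rfl

theorem expectedDeviation_linearControl (T : Matrix (Fin nx) (Fin nx) ℝ) (s : SchedulingPolicy nx)
    (k : ℕ) : expectedDeviation D P Sig t₀ (s, linearControl (D.gain T)) σ T k = 0 := by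
  have h : ∀ ω, inputDeviation D P (s, linearControl (D.gain T)) σ T ω k = 0 := by
    intro ω
    rw [inputDeviation, inputAt_eq_inputFor, sub_eq_zero]
    simp only [inputFor, linearControl, estimateAt, view, observations, Fin.snoc_last]
  simp [expectedDeviation, h]

/-- The linear feedback attains the lower bound. -/
theorem normalizedCost_linearControl (hη : 0 ≤ D.eta) (hQ : D.Q.PosSemidef) (hR : D.R.PosDef)
    (hW : D.W.PosSemidef) (hU : D.U.PosDef) (hP : D.IsSteadyState P) (hSig : Sig.PosSemidef)
    (hS : S.PosSemidef) (hlim : Tendsto (fun n : ℕ => D.riccati^[n] D.W) atTop (𝓝 S))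
    (hfix : S = D.riccati S) (s : SchedulingPolicy nx) :
    normalizedCost D P Sig t₀ (s, linearControl (D.gain S)) σ
      = baseCost D P Sig S t₀ + trackingGameCost D P Sig S t₀ (s, linearControl (D.gain S)) σ := by
  refine le_antisymm ?_ (baseCost_add_le_normalizedCost hη hQ hR hW hU hP hSig hS hlim)
  rw [baseCost_add_trackingGameCost hη hQ hR hP hSig hS, tsum_expectedQuadratic_add hη]
  exact add_le_add (tsum_expectedQuadratic_le hη hQ hR hW hU hP hS hfix
    (expectedDeviation_linearControl S s)) le_rfl

end GameCost

/-! ### Reduction to the link game -/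

section Reduction

variable {nx nu ny : ℕ} {D : GameData nx nu ny} {P Sig S : Matrix (Fin nx) (Fin nx) ℝ} {t₀ : ℕ}
  {π : ControllerStrategy nx nu} {σ σ' : LinkStrategy}

/-- The situation depends on the channel and on the attacks only through the receptions. -/
theorem situation_eq_of_receptions_eq {ω ω' : Sample nx ny} (h₁ : ω'.1 = ω.1) (h₂ : ω'.2.1 = ω.2.1)
    (k : ℕ) (hs : ∀ j < k, (ω'.2.2 j).2.1 = (ω.2.2 j).2.1)
    (hγ : ∀ j < k, received D (ω'.2.2 j).1 (commandAt π ω (situation D P π σ ω j))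
        (attackAt σ' ω' (situation D P π σ ω j))
      = received D (ω.2.2 j).1 (commandAt π ω (situation D P π σ ω j))
        (attackAt σ ω (situation D P π σ ω j))) :
    situation D P π σ' ω' k = situation D P π σ ω k := by
  induction k with
  | zero => simp only [situation, h₁]
  | succ k ih =>
    have ih := ih (fun j hj => hs j (hj.trans k.lt_succ_self))
      (fun j hj => hγ j (hj.trans k.lt_succ_self))
    have hseeds : ctrlSeeds ω'.2.2 k = ctrlSeeds ω.2.2 k :=
      funext fun i => hs i i.2
    have hν : commandAt π ω' (situation D P π σ ω k) = commandAt π ω (situation D P π σ ω k) := by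
      unfold commandAt
      rw [hseeds]
    have ho : observationAt D π σ' ω' (situation D P π σ ω k)
        = observationAt D π σ ω (situation D P π σ ω k) := by
      unfold observationAt
      simp only [hν, hγ k k.lt_succ_self]
    have hu : inputAt D π σ' ω' (situation D P π σ ω k)
        = inputAt D π σ ω (situation D P π σ ω k) := by
      unfold inputAt
      rw [hseeds, ho]
    rw [situation, situation, ih]
    simp only [ho, hu, h₂]

theorem acks_succ (ω : Sample nx ny) (k : ℕ) :
    acks (situation D P π σ ω (k + 1)).obs = Fin.snoc (acks (situation D P π σ ω k).obs)
      (received D (ω.2.2 k).1 (commandAt π ω (situation D P π σ ω k))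
        (attackAt σ ω (situation D P π σ ω k))) := by
  funext i
  induction i using Fin.lastCases with
  | last => simp [acks, situation, observationAt]
  | cast i => simp [acks, situation]

theorem acks_apply (ω : Sample nx ny) (k j : ℕ) (hj : j < k) :
    acks (situation D P π σ ω k).obs ⟨j, hj⟩
      = received D (ω.2.2 j).1 (commandAt π ω (situation D P π σ ω j))
        (attackAt σ ω (situation D P π σ ω j)) := by
  induction k with
  | zero => exact absurd hj (Nat.not_lt_zero j)
  | succ k ih =>
    rw [acks_succ]
    rcases Nat.lt_succ_iff_lt_or_eq.1 hj with h | rfl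
    · rw [← ih h]
      exact Fin.snoc_castSucc (α := fun _ => Bool) _ _ (⟨j, h⟩ : Fin k)
    · exact Fin.snoc_last (α := fun _ => Bool) _ _

/-- The attacker that never attacks. -/
def noAttack : LinkStrategy where
  play _ _ _ := false
  measurable_play _ := measurable_const

/-- A sample with the given plant data and controller's seeds in which, without attacks, the given
acknowledgements occur. -/
def replay (w₀ : InitNoise nx) (w : ℕ → Vec nx × Vec ny) {k : ℕ} (h : Fin k → Bool)
    (s : Fin (k + 1) → unitInterval) : Sample nx ny :=
  -- Channel seed 0 lets a transmitted packet through when lam > 0, and seed 1 stops it when lam ≤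
  -- 1.
  (w₀, w, fun j => (if hj : j < k then if h ⟨j, hj⟩ then 0 else 1 else 1,
    if hj : j < k + 1 then s ⟨j, hj⟩ else 0, 0))

theorem measurable_replay (w₀ : InitNoise nx) (w : ℕ → Vec nx × Vec ny) (k : ℕ) :
    Measurable fun z : (Fin k → Bool) × (Fin (k + 1) → unitInterval) =>
      replay w₀ w z.1 z.2 := by
  refine measurable_const.prodMk (measurable_const.prodMk (measurable_pi_iff.2 fun j => ?_))
  refine Measurable.prodMk ?_ (.prodMk ?_ measurable_const)
  · by_cases hj : j < k
    · simp only [hj, dif_pos]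
      have h1 : Measurable fun z : (Fin k → Bool) × (Fin (k + 1) → unitInterval) => z.1 ⟨j, hj⟩ := by
        fun_prop
      exact .ite (h1 (measurableSet_singleton true)) measurable_const measurable_const
    · simp only [hj, dif_neg, not_false_eq_true]
      exact measurable_const
  · by_cases hj : j < k + 1
    · simp only [hj, dif_pos]
      fun_prop
    · simp only [hj, dif_neg, not_false_eq_true]
      exact measurable_const

/-- The schedule of the controller when the plant data are known in advance. -/
noncomputable def informedSchedule (D : GameData nx nu ny) (P : Matrix (Fin nx) (Fin nx) ℝ)
    (π : ControllerStrategy nx nu) (w₀ : InitNoise nx) (w : ℕ → Vec nx × Vec ny) :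
    LinkStrategy where
  play k h s := commandAt π (replay w₀ w h s) (situation D P π noAttack (replay w₀ w h s) k)
  measurable_play k := by
    have := Measurable.comp (measurable_commandAt (D := D) (P := P) (π := π) (σ := noAttack) k)
      (measurable_replay w₀ w k)
    exact this

/-- A reception implies a transmission, which seed 0 lets through without an attack; otherwise seed
1 blocks the packet. -/
theorem received_replay (hlam : 0 < D.lam) (hl : D.lam ≤ 1) (c : unitInterval) (ν a : Bool) :
    received D (if received D c ν a then 0 else 1) ν false = received D c ν a := by
  by_cases h : received D c ν a = true
  · have hν : ν = true := by
      simp only [received, Bool.and_eq_true] at h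
      exact h.1
    rw [h, hν]
    simp [received, hlam]
  · rw [Bool.not_eq_true] at h
    rw [h]
    simp [received, hl]

/-- Attacks and channel seeds act on the plant only through receptions. The replay has the same
receptions, hence the same situation at stage k and the same command. -/
theorem informedSchedule_play (hlam : 0 < D.lam) (hl : D.lam ≤ 1) (ω : Sample nx ny) (k : ℕ) :
    (informedSchedule D P π ω.1 ω.2.1).play k (acks (situation D P π σ ω k).obs)
        (ctrlSeeds ω.2.2 k) = commandAt π ω (situation D P π σ ω k) := by
  set ω' := replay ω.1 ω.2.1 (acks (situation D P π σ ω k).obs) (ctrlSeeds ω.2.2 k) with hω'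
  have hs : ∀ j < k + 1, (ω'.2.2 j).2.1 = (ω.2.2 j).2.1 := by
    intro j hj
    simp only [hω', replay, dif_pos hj, ctrlSeeds]
  have h1 : situation D P π noAttack ω' k = situation D P π σ ω k := by
    refine situation_eq_of_receptions_eq (ω := ω) (ω' := ω') rfl rfl k
      (fun j hj => hs j (hj.trans k.lt_succ_self)) (fun j hj => ?_)
    have h2 : (ω'.2.2 j).1 = if received D (ω.2.2 j).1 (commandAt π ω (situation D P π σ ω j))
        (attackAt σ ω (situation D P π σ ω j)) then 0 else 1 := by
      rw [← acks_apply ω k j hj]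
      simp [hω', replay, hj]
    rw [h2]
    exact received_replay hlam hl _ _ _
  have hseeds : ctrlSeeds ω'.2.2 k = ctrlSeeds ω.2.2 k := funext fun i => hs i i.2
  change commandAt π ω' (situation D P π noAttack ω' k) = _
  rw [h1]
  unfold commandAt
  rw [hseeds]

theorem acks_eq_linkAcks {ρ : LinkStrategy} (ω : Sample nx ny)
    (hρ : ∀ k, ρ.play k (acks (situation D P π σ ω k).obs) (ctrlSeeds ω.2.2 k)
      = commandAt π ω (situation D P π σ ω k)) (k : ℕ) :
    acks (situation D P π σ ω k).obs = linkAcks D ρ σ ω.2.2 k := by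
  induction k with
  | zero => exact Subsingleton.elim _ _
  | succ k ih =>
    rw [acks_succ, linkAcks, ← hρ k, attackAt, ih]

/-- The cost of the link game along a sample, for a schedule that agrees with the controller's. -/
theorem tsum_stageCost_eq_of_play {ρ : LinkStrategy} (ω : Sample nx ny)
    (hρ : ∀ k, ρ.play k (acks (situation D P π σ ω k).obs) (ctrlSeeds ω.2.2 k)
      = commandAt π ω (situation D P π σ ω k)) (g : ℕ → ℝ) :
    ∑' k, ENNReal.ofReal (D.eta ^ k) * stageCost D.cs D.ca
        (ENNReal.ofReal (g (holdingAfter D P t₀ π σ ω k)))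
        (commandAt π ω (situation D P π σ ω k)) (attackAt σ ω (situation D P π σ ω k))
      = ∑' k, ENNReal.ofReal (D.eta ^ k) * stageCost D.cs D.ca
        (ENNReal.ofReal (g (holding t₀ (k + 1) (linkAcks D ρ σ ω.2.2 (k + 1)))))
        (ρ.play k (linkAcks D ρ σ ω.2.2 k) (ctrlSeeds ω.2.2 k))
        (σ.play k (linkAcks D ρ σ ω.2.2 k) (attSeeds ω.2.2 k)) := by
  refine tsum_congr fun k => ?_
  rw [← hρ k, attackAt, holdingAfter, acks_eq_linkAcks ω hρ k, acks_eq_linkAcks ω hρ (k + 1)]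

theorem measurable_tsum_stageCost (g : ℕ → ℝ) : Measurable fun ω : Sample nx ny =>
    ∑' k, ENNReal.ofReal (D.eta ^ k) * stageCost D.cs D.ca
        (ENNReal.ofReal (g (holdingAfter D P t₀ π σ ω k)))
        (commandAt π ω (situation D P π σ ω k)) (attackAt σ ω (situation D P π σ ω k)) :=
  Measurable.tsum fun k => (measurable_stageCost _ _
    ((measurable_of_countable fun t : ℕ => ENNReal.ofReal (g t)).comp (measurable_holdingAfter k))
    (measurable_commandAt k) (measurable_attackAt k)).const_mul _

theorem lintegral_gameLaw {F : Sample nx ny → ENNReal} (hF : Measurable F) :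
    ∫⁻ ω, F ω ∂(gameLaw D P Sig t₀) = ∫⁻ w₀, ∫⁻ w, ∫⁻ ℓ, F (w₀, w, ℓ) ∂linkLaw
      ∂(Measure.infinitePi fun _ => (gaussianVec D.Q).prod (gaussianVec D.R))
      ∂((gaussianVec Sig).prod ((gaussianVec (D.f^[t₀ + 1] P - P)).prod (gaussianVec P))) := by
  rw [gameLaw, lintegral_prod _ hF.aemeasurable]
  refine lintegral_congr fun w₀ => ?_
  have h : Measurable fun z => F (w₀, z) := hF.comp measurable_prodMk_left
  exact lintegral_prod _ h.aemeasurable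

/-- The plant data are independent of the link seeds. With these data frozen, the schedule is a
strategy of the link game and the inner integral is its cost. -/
theorem trackingGameCost_eq {ρ : InitNoise nx → (ℕ → Vec nx × Vec ny) → LinkStrategy}
    (hρ : ∀ (ω : Sample nx ny) k, (ρ ω.1 ω.2.1).play k (acks (situation D P π σ ω k).obs)
      (ctrlSeeds ω.2.2 k) = commandAt π ω (situation D P π σ ω k)) :
    trackingGameCost D P Sig S t₀ π σ
      = ∫⁻ w₀, ∫⁻ w, linkCost D (fun t => (D.errorWeight S * D.f^[t] P).trace) t₀ (ρ w₀ w) σ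
          ∂(Measure.infinitePi fun _ => (gaussianVec D.Q).prod (gaussianVec D.R))
          ∂((gaussianVec Sig).prod ((gaussianVec (D.f^[t₀ + 1] P - P)).prod (gaussianVec P))) := by
  have hm := measurable_tsum_stageCost (D := D) (P := P) (π := π) (σ := σ) (t₀ := t₀)
    (fun t => (D.errorWeight S * D.f^[t] P).trace)
  refine (lintegral_gameLaw hm).trans ?_
  refine lintegral_congr fun w₀ => lintegral_congr fun w => ?_
  unfold linkCost
  refine lintegral_congr fun ℓ => ?_
  exact tsum_stageCost_eq_of_play (w₀, w, ℓ) (hρ (w₀, w, ℓ))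
    fun t => (D.errorWeight S * D.f^[t] P).trace

/-- An average of link costs is at least their infimum, so scheduling on plant information brings no
gain. -/
theorem iInf_linkCost_le_trackingGameCost (hlam : 0 < D.lam) (hl : D.lam ≤ 1) :
    ⨅ ρ, linkCost D (fun t => (D.errorWeight S * D.f^[t] P).trace) t₀ ρ σ
      ≤ trackingGameCost D P Sig S t₀ π σ := by
  rw [trackingGameCost_eq (informedSchedule_play hlam hl)]
  calc _ = ∫⁻ _ : InitNoise nx, ∫⁻ _ : ℕ → Vec nx × Vec ny,
        ⨅ ρ, linkCost D (fun t => (D.errorWeight S * D.f^[t] P).trace) t₀ ρ σ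
          ∂(Measure.infinitePi fun _ => (gaussianVec D.Q).prod (gaussianVec D.R))
          ∂((gaussianVec Sig).prod ((gaussianVec (D.f^[t₀ + 1] P - P)).prod (gaussianVec P))) := by
        simp
    _ ≤ _ := lintegral_mono fun w₀ => lintegral_mono fun w => iInf_le _ _

theorem trackingGameCost_ackSchedule (ρ : LinkStrategy) (c : ControlPolicy nx nu) :
    trackingGameCost D P Sig S t₀ (ackSchedule nx ρ, c) σ
      = linkCost D (fun t => (D.errorWeight S * D.f^[t] P).trace) t₀ ρ σ := by
  rw [trackingGameCost_eq (ρ := fun _ _ => ρ) fun ω k => rfl]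
  simp

end Reduction

/-! ### Saddle points of the original game and of the link game -/

/-- A pair of strategies solves the min-max problem if and only if it is a saddle point. -/
theorem solvesMinMax_iff {X Y : Type*} (J : X → Y → EReal) (a : X) (b : Y) :
    SolvesMinMax J a b ↔ IsNashEquilibrium J a b := by
  have hle : (⨆ y, ⨅ x, J x y) ≤ ⨅ x, ⨆ y, J x y :=
    iSup_le fun y => le_iInf fun x => (iInf_le _ x).trans (le_iSup (J x) y)
  constructor
  · rintro ⟨h1, h2, h3⟩
    have h4 : (⨆ y, J a y) = ⨅ x, J x b := by rw [h2, h3, h1]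
    have h5 : ∀ x y, J a y ≤ J x b := fun x y =>
      (le_iSup (J a) y).trans (h4.le.trans (iInf_le _ x))
    exact ⟨fun x => h5 x b, fun y => h5 a y⟩
  · rintro ⟨h1, h2⟩
    have h3 : (⨆ y, J a y) = J a b := le_antisymm (iSup_le h2) (le_iSup (J a) b)
    have h4 : (⨅ x, J x b) = J a b := le_antisymm (iInf_le _ a) (le_iInf h1)
    have h5 : (⨅ x, ⨆ y, J x y) ≤ J a b := (iInf_le _ a).trans h3.le
    have h6 : J a b ≤ ⨆ y, ⨅ x, J x y := h4.ge.trans (le_iSup (fun y => ⨅ x, J x y) b)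
    exact ⟨le_antisymm (h5.trans h6) hle, h3.trans (le_antisymm (h6.trans hle) h5),
      h4.trans (le_antisymm h6 (hle.trans h5))⟩

theorem coe_ennreal_add_coe_le_iff (x y : ENNReal) (c : ℝ) :
    (x : EReal) + (c : EReal) ≤ (y : EReal) + (c : EReal) ↔ x ≤ y := by
  refine ⟨fun h => ?_, fun h => add_le_add (EReal.coe_ennreal_le_coe_ennreal_iff.2 h) le_rfl⟩
  have h1 := EReal.sub_le_sub h (le_refl (c : EReal))
  rwa [EReal.add_sub_cancel_right, EReal.add_sub_cancel_right,
    EReal.coe_ennreal_le_coe_ennreal_iff] at h1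

/-- There is a growth rate between the spectrum of `A Aᵀ` and the reliability of the attacked
channel. -/
theorem exists_growth_rate {n : ℕ} (A : Matrix (Fin n) (Fin n) ℝ) {η lamA : ℝ} (hη₀ : 0 < η)
    (hη₁ : η < 1) (h₀ : 0 ≤ lamA) (h₁ : lamA < 1)
    (hcond : ∀ z ∈ spectrum ℂ (A.map (algebraMap ℝ ℂ)), z ≠ 0 → 1 - η / ‖z‖ ^ 2 < lamA) :
    ∃ r : ℝ, 1 < r ∧ η * (1 - lamA) * r < 1 ∧
      ∀ z ∈ spectrum ℂ (A.map (algebraMap ℝ ℂ)), ‖z‖ ^ 2 < r := by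
  set b := η * (1 - lamA) with hb
  have hb0 : 0 < b := mul_pos hη₀ (by linarith)
  have hb1 : b < 1 := by nlinarith
  have hfin : (spectrum ℂ (A.map (algebraMap ℝ ℂ))).Finite := Matrix.finite_spectrum _
  -- r is taken just below 1 / (η (1 - lamA)). This number exceeds 1 and every |z|², and the
  -- spectrum is finite, so all the inequalities hold at once.
  have h1 : ∀ᶠ r : ℝ in 𝓝[<] b⁻¹, 1 < r :=
    eventually_nhdsWithin_of_eventually_nhds (eventually_gt_nhds (by
      rw [lt_inv_comm₀ one_pos hb0, inv_one]; exact hb1))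
  have h2 : ∀ᶠ r : ℝ in 𝓝[<] b⁻¹, ∀ z ∈ spectrum ℂ (A.map (algebraMap ℝ ℂ)), ‖z‖ ^ 2 < r := by
    refine (Filter.eventually_all_finite hfin).2 fun z hz => ?_
    refine eventually_nhdsWithin_of_eventually_nhds (eventually_gt_nhds ?_)
    rcases eq_or_ne z 0 with rfl | hz0
    · simpa using hb0
    · have hs : 0 < ‖z‖ ^ 2 := by positivity
      have h4 : 1 - lamA < η / ‖z‖ ^ 2 := by linarith [hcond z hz hz0]
      rw [lt_div_iff₀ hs] at h4
      rw [← one_div, lt_div_iff₀ hb0, hb]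
      nlinarith
  have h3 : ∀ᶠ r : ℝ in 𝓝[<] b⁻¹, r < b⁻¹ := self_mem_nhdsWithin
  obtain ⟨r, hr1, hr2, hr3⟩ := (h1.and (h2.and h3)).exists
  refine ⟨r, hr1, ?_, hr2⟩
  calc b * r < b * b⁻¹ := by gcongr
    _ = 1 := mul_inv_cancel₀ hb0.ne'

section Equilibrium

variable {nx nu ny : ℕ} {D : GameData nx nu ny} {P Sig S : Matrix (Fin nx) (Fin nx) ℝ} {t₀ : ℕ}

theorem solvesMinMax_reducedCost_iff (hη₀ : 0 < D.eta) (hη₁ : D.eta < 1) (hcs : 0 ≤ D.cs)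
    (hca : 0 ≤ D.ca) (hfix : S = D.riccati S) (ρ σ : LinkStrategy) :
    SolvesMinMax (reducedCost D P S t₀) ρ σ ↔
      (∀ ρ', linkCost D (fun t => (D.errorWeight S * D.f^[t] P).trace) t₀ ρ σ
        ≤ linkCost D (fun t => (D.errorWeight S * D.f^[t] P).trace) t₀ ρ' σ) ∧
      (∀ σ', linkCost D (fun t => (D.errorWeight S * D.f^[t] P).trace) t₀ ρ σ'
        ≤ linkCost D (fun t => (D.errorWeight S * D.f^[t] P).trace) t₀ ρ σ) := by
  have hN : D.eta • (D.Aᵀ * S * D.A) + D.W - S = D.errorWeight S := by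
    rw [GameData.errorWeight, ← hfix]
  rw [solvesMinMax_iff, IsNashEquilibrium]
  simp only [reducedCost_eq hη₀ hη₁ hcs hca, hN, coe_ennreal_add_coe_le_iff]

/-- Under the feedback law the cost is a constant plus the link cost, which settles the attacker's
deviations. An arbitrary deviation of the controller costs at least that constant plus the infimum
of the link costs, while every link schedule is itself a possible deviation. -/
theorem isNashEquilibrium_gameCost_iff (hη₀ : 0 < D.eta) (hη₁ : D.eta < 1) (hcs : 0 ≤ D.cs)
    (hca : 0 ≤ D.ca) (hlam : 0 < D.lam) (hl : D.lam ≤ 1)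
    (hQ : D.Q.PosSemidef) (hR : D.R.PosDef) (hW : D.W.PosSemidef)
    (hU : D.U.PosDef) (hP : D.IsSteadyState P) (hSig : Sig.PosSemidef)
    (hS : S.PosSemidef) (hlim : Tendsto (fun n : ℕ => D.riccati^[n] D.W) atTop (𝓝 S))
    (hfix : S = D.riccati S) (ρ σ : LinkStrategy) :
    IsNashEquilibrium (gameCost D P Sig t₀) (ackSchedule nx ρ, linearControl (D.gain S)) σ ↔
      (∀ ρ', linkCost D (fun t => (D.errorWeight S * D.f^[t] P).trace) t₀ ρ σ
        ≤ linkCost D (fun t => (D.errorWeight S * D.f^[t] P).trace) t₀ ρ' σ) ∧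
      (∀ σ', linkCost D (fun t => (D.errorWeight S * D.f^[t] P).trace) t₀ ρ σ'
        ≤ linkCost D (fun t => (D.errorWeight S * D.f^[t] P).trace) t₀ ρ σ) := by
  have hb := baseCost_ne_top (D := D) (P := P) (Sig := Sig) (S := S) (t₀ := t₀) hη₁
  have heq : ∀ ρ σ, normalizedCost D P Sig t₀ (ackSchedule nx ρ, linearControl (D.gain S)) σ
      = baseCost D P Sig S t₀
        + linkCost D (fun t => (D.errorWeight S * D.f^[t] P).trace) t₀ ρ σ := fun ρ σ => by
    rw [normalizedCost_linearControl hη₀.le hQ hR hW hU hP hSig hS hlim hfix,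
      trackingGameCost_ackSchedule]
  rw [IsNashEquilibrium]
  simp only [gameCost_eq hη₀ hη₁ hcs hca, coe_ennreal_add_coe_le_iff]
  simp only [heq, ENNReal.add_le_add_iff_left hb]
  refine and_congr_left fun _ => ⟨fun h ρ' => ?_, fun h π => ?_⟩
  · have h1 := h (ackSchedule nx ρ', linearControl (D.gain S))
    rwa [heq, ENNReal.add_le_add_iff_left hb] at h1
  · refine le_trans ?_ (baseCost_add_le_normalizedCost hη₀.le hQ hR hW hU hP hSig hS hlim)
    exact add_le_add le_rfl ((le_iInf h).trans (iInf_linkCost_le_trackingGameCost hlam hl))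

/-- When the schedule reads only acknowledgements, the tracking cost does not depend on the control
policy, so the lower bound is the same for all policies and the feedback law attains it. -/
theorem gameCost_linearControl_le (hη₀ : 0 < D.eta) (hη₁ : D.eta < 1) (hcs : 0 ≤ D.cs)
    (hca : 0 ≤ D.ca) (hQ : D.Q.PosSemidef) (hR : D.R.PosDef) (hW : D.W.PosSemidef)
    (hU : D.U.PosDef) (hP : D.IsSteadyState P) (hSig : Sig.PosSemidef)
    (hS : S.PosSemidef) (hlim : Tendsto (fun n : ℕ => D.riccati^[n] D.W) atTop (𝓝 S))
    (hfix : S = D.riccati S) (ρ σ : LinkStrategy) (c : ControlPolicy nx nu) :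
    gameCost D P Sig t₀ (ackSchedule nx ρ, linearControl (D.gain S)) σ
      ≤ gameCost D P Sig t₀ (ackSchedule nx ρ, c) σ := by
  rw [gameCost_eq hη₀ hη₁ hcs hca, gameCost_eq hη₀ hη₁ hcs hca, coe_ennreal_add_coe_le_iff,
    normalizedCost_linearControl hη₀.le hQ hR hW hU hP hSig hS hlim hfix,
    trackingGameCost_ackSchedule, ← trackingGameCost_ackSchedule (Sig := Sig) ρ c]
  exact baseCost_add_le_normalizedCost hη₀.le hQ hR hW hU hP hSig hS hlim

end Equilibrium

theorem corollary2 {nx nu ny : ℕ} (D : GameData nx nu ny) (P : Matrix (Fin nx) (Fin nx) ℝ)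
    (hQ : D.Q.PosDef) (hR : D.R.PosDef) (hW : D.W.PosSemidef) (hU : D.U.PosDef)
    (hη₀ : 0 < D.eta) (hη₁ : D.eta < 1)
    (hla₀ : 0 ≤ D.lamA) (hla : D.lamA < D.lam) (hl : D.lam ≤ 1)
    (hcs : 0 ≤ D.cs) (hca : 0 ≤ D.ca)
    (hAB : IsControllable D.A D.B) (hAC : IsDetectable D.A D.C)
    (hP : D.IsSteadyState P)
    -- `lamA > 1 - η / max |σ_i(A)|²`, where `η / 0 = ∞`
    (hcond : ∀ z ∈ spectrum ℂ (D.A.map (algebraMap ℝ ℂ)), z ≠ 0 →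
      1 - D.eta / ‖z‖ ^ 2 < D.lamA) :
    ∃ S : Matrix (Fin nx) (Fin nx) ℝ,
      -- `S` is the limit of the Riccati recursion and a solution of the Riccati equation
      S.PosSemidef ∧
      Tendsto (fun n : ℕ => D.riccati^[n] D.W) atTop (𝓝 S) ∧
      S = D.riccati S ∧
      -- the game has a Nash equilibrium, in stationary scheduling and attack strategies, with the
      -- linear control; the stationary strategies solve the min-max problem
      (∃ p q : ℕ → unitInterval, ∀ (t₀ : ℕ) (Sig : Matrix (Fin nx) (Fin nx) ℝ), Sig.PosSemidef →
        IsNashEquilibrium (gameCost D P Sig t₀)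
          (ackSchedule nx (stationary t₀ p), linearControl (D.gain S)) (stationary t₀ q) ∧
        SolvesMinMax (reducedCost D P S t₀) (stationary t₀ p) (stationary t₀ q)) ∧
      (∀ (t₀ : ℕ) (Sig : Matrix (Fin nx) (Fin nx) ℝ), Sig.PosSemidef → ∀ ρ σ : LinkStrategy,
        -- the linear control is optimal
        (∀ c : ControlPolicy nx nu,
          gameCost D P Sig t₀ (ackSchedule nx ρ, linearControl (D.gain S)) σ ≤
            gameCost D P Sig t₀ (ackSchedule nx ρ, c) σ) ∧
        -- the solutions of the min-max problem are the equilibrium schedules and attacks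
        (SolvesMinMax (reducedCost D P S t₀) ρ σ ↔
          IsNashEquilibrium (gameCost D P Sig t₀)
            (ackSchedule nx ρ, linearControl (D.gain S)) σ)) := by
  have hlam : 0 < D.lam := hla₀.trans_lt hla
  obtain ⟨S, hS, hlim, hfix⟩ := GameData.exists_tendsto_iterate_riccati hη₀.le hU hW hAB
  obtain ⟨r, hr1, hr2, hr3⟩ := exists_growth_rate D.A hη₀ hη₁ hla₀ (hla.trans_le hl) hcond
  have hN := GameData.errorWeight_posSemidef hη₀.le hU hS
  have hfP := hP.f_sub_posSemidef hQ.posSemidef hR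
  obtain ⟨C, hC, hgrowth⟩ := GameData.exists_trace_iterate_f_le hQ.posSemidef hN hP.1 hfP hr1 hr3
  have hg : ∀ t, 0 ≤ (D.errorWeight S * D.f^[t] P).trace := fun t =>
    hN.trace_mul_nonneg (GameData.iterate_f_posSemidef hQ.posSemidef hP.1 t)
  obtain ⟨V, p, q, hV, ⟨C', hC', hVC⟩, hp, hq⟩ := exists_holdingGame_value hη₀ hη₁ hla₀ hla.le hl
    hcs hca hg hC (zero_le_one.trans hr1.le) hr2 hgrowth
  have hup := fun t₀ σ => linkCost_stationary_le hη₀.le hla₀ hla.le hl hcs hca hg hV hp t₀ σ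
  have hlow := fun t₀ ρ =>
    le_linkCost_stationary hη₀.le hη₁ hla₀ hla.le hl hcs hca hg hV hC' hVC hq t₀ ρ
  have hred := fun t₀ => solvesMinMax_reducedCost_iff (P := P) (t₀ := t₀) hη₀ hη₁ hcs hca hfix
  have hgame := fun t₀ Sig hSig => isNashEquilibrium_gameCost_iff (t₀ := t₀) (Sig := Sig) hη₀ hη₁
    hcs hca hlam hl hQ.posSemidef hR hW hU hP hSig hS hlim hfix
  refine ⟨S, hS, hlim, hfix, ⟨p, q, fun t₀ Sig hSig => ?_⟩, fun t₀ Sig hSig ρ σ => ⟨fun c => ?_, ?_⟩⟩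
  -- Both claims amount to the same saddle inequalities for the link cost, and V t₀ separates their
  -- two sides.
  · rw [hred, hgame t₀ Sig hSig, and_self]
    exact ⟨fun ρ' => (hup t₀ _).trans (hlow t₀ ρ'), fun σ' => (hup t₀ σ').trans (hlow t₀ _)⟩
  · exact gameCost_linearControl_le hη₀ hη₁ hcs hca hQ.posSemidef hR hW hU hP hSig hS hlim hfix ρ σ c
  · rw [hred, hgame t₀ Sig hSig]
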